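/- Let $n\neq 1$ be a natural number and let $F_n$ be the free group on $X=\{x_1,\dots,x_n\}$. **Words.** Graphs are graphs in the sense of Serre, and labeled graphs are labeled by $X\cup X^{-1}$. A *u-word* is a nontrivial reduced word up to inversion, regarded as a labeled line segment; a *cyclic word* is a nontrivial cyclically reduced word up to cyclic permutation and inversion (equivalently, a nontrivial element of $F_n$ up to conjugation and inversion), regarded as a labeled circle. $|\mathrm{Hom}(u,w)|$ is the number of morphisms of labeled graphs $u\to w$. $\mathrm{Aut}(F_n)$ acts on the set $C$ of cyclic words. **The multisets $S_{u,\varphi}$.** Let $\varphi\in\mathrm{Aut}(F_n)$. For a labeled graph $\Gamma$ let $\tilde{\mathcal F}_\varphi(\Gamma)$ be the folded graph obtained by replacing every edge $e$ of $\Gamma$ by a path labeled by the reduced word $\varphi(\text{label of }e)$ and then folding; this is a functor. For a u-word $v$, $\tilde{\mathcal F}_\varphi(v)$ is a tree that contains the segment $\varphi(v)$. An *ideal preimage* of a u-word $u$ is a pair of a u-word $v$ (the base word) and a morphism $u\to\varphi(v)$ such that for every u-word $w$ and every morphism $v\to w$ there is a morphism $u\to\varphi(w)$ for which the composites $u\to\varphi(v)\to\tilde{\mathcal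 F}_\varphi(v)\to\tilde{\mathcal F}_\varphi(w)$ and $u\to\varphi(w)\to\tilde{\mathcal F}_\varphi(w)$ agree. An ideal preimage $u\to\varphi(v')$ is a sub ideal preimage of $u\to\varphi(v)$ if there is a morphism $v'\to v$ such that $u\to\varphi(v')\to\tilde{\mathcal F}_\varphi(v')\to\tilde{\mathcal F}_\varphi(v)$ and $u\to\varphi(v)\to\tilde{\mathcal F}_\varphi(v)$ agree, and an ideal preimage is minimal if all such $v'\to v$ are isomorphisms. $S_{u,\varphi}$ is the multiset of base words of the minimal ideal preimages of $u$. **The modules.** Let $W_k$ be the (finite) set of u-words of length $k$, $M_k$ the free $\mathbb Z$-module on $W_k$, $\mathbb Z[C]$ the free $\mathbb Z$-module on $C$, $\pi_k:\mathbb Z[C]\to M_k$, $\pi_k(w)=\sum_{u\in W_k}|\mathrm{Hom}(u,w)|\,u$, and $\tilde M_k=\mathrm{Im}\,\pi_k$. Fix any choice of an orientation of every u-word. Let $\overleftarrow p_{k}:M_{k}\to M_{k-1}$ (resp. $\overrightarrow p_{k}$) send a u-word $w$ to the sum of those $u\in W_{k-1}$ that are affixes of $w$ pointing outward (resp. inward):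 with the chosen orientations, $u^{-1}$ is a prefix of $w$ or $u$ is a suffix of $w$ (resp. $u$ is a prefix or $u^{-1}$ is a suffix). For $l\le m$ let $p_{m,l}=\overleftarrow p_{l+1}\circ\cdots\circ\overleftarrow p_{m}:M_m\to M_l$. Let $m_k=m_k^\varphi$ be the maximal length of a word in $\bigcup_{u\in W_k}S_{u,\varphi}$ ($0$ if there is none), and let $\varphi_k:M_{m_k}\to M_k$ be the homomorphism (an integer matrix) for which the coefficient of $\varphi_k(x)$ at $u\in W_k$ is $$\sum_{v\in S_{u,\varphi}}\bigl(\text{coefficient of } v \text{ in } p_{m_k,l(v)}(x)\bigr).$$ **Theorem.** 1. For all $u$ and $\varphi$ the multiset $S_{u,\varphi}$ is finite, and $|\mathrm{Hom}(u,\varphi(w))|=\sum_{v\in S_{u,\varphi}}|\mathrm{Hom}(v,w)|$ for every cyclic word $w$. 2. $\overleftarrow p_k$ and $\overrightarrow p_k$ agree on $\tilde M_k$, and their common restriction $p_k$ maps $\tilde M_k$ to $\tilde M_{k-1}$; moreover $\overleftarrow p_k\circ\pi_k=\pi_{k-1}$. 3. $\varphi_k\circ\pi_{m_k}=\pi_k\circ\varphi$,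 so that $\varphi_k$ maps $\tilde M_{m_k}$ to $\tilde M_k$; moreover $m_{k-1}\le m_k$ and $p_k\circ\varphi_k=\varphi_{k-1}\circ p_{m_k,m_{k-1}}$ on $\tilde M_{m_k}$. 4. There is a group homomorphism $$\rho:\mathrm{Out}(F_n)\to\mathrm{Aut}_{\mathbb Z}\bigl(\varprojlim\tilde M_k\bigr),\qquad \bigl(\rho([\varphi])\,x\bigr)_k=\varphi_k(x_{m_k^\varphi})\quad\text{for all } \varphi,\ k \text{ and } x=(x_k)_k,$$ that is, $\varphi\mapsto\varprojlim\varphi_k$ is well defined on outer automorphisms and is a homomorphism to the automorphism group. The homomorphism $\rho$ is injective. -/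

import Mathlib

namespace OutRep

/-! ### Labeled graphs in the sense of Serre -/

/-- Letters of `X ∪ X⁻¹`: `(x, true)` is `x` and `(x, false)` is `x⁻¹`. -/
abbrev Letter (X : Type) : Type := X × Bool

/-- The formal inverse of a letter. -/
def Letter.bar {X : Type} (a : Letter X) : Letter X := (a.1, !a.2)

@[simp] theorem Letter.bar_bar {X : Type} (a : Letter X) : Letter.bar (Letter.bar a) = a := by
  simp [Letter.bar]

theorem Letter.bar_ne {X : Type} (a : Letter X) : Letter.bar a ≠ a := by
  intro h
  have := congrArg Prod.snd h
  simp [Letter.bar] at this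

/-- An `X`-labeled graph: a graph in the sense of Serre (vertices, edges, initial vertex map,
fixed point free involution on the edges) with a graph morphism to the rose `R_X`. -/
structure LGraph (X : Type) where
  V : Type
  E : Type
  ini : E → V
  bar : E → E
  bar_bar : ∀ e, bar (bar e) = e
  bar_ne : ∀ e, bar e ≠ e
  label : E → Letter X
  label_bar : ∀ e, label (bar e) = Letter.bar (label e)

/-- A morphism of labeled graphs. -/
@[ext] structure LGraph.Hom {X : Type} (Γ Δ : LGraph X) where
  onV : Γ.V → Δ.V
  onE : Γ.E → Δ.E
  map_ini : ∀ e, onV (Γ.ini e) = Δ.ini (onE e)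
  map_bar : ∀ e, onE (Γ.bar e) = Δ.bar (onE e)
  map_label : ∀ e, Δ.label (onE e) = Γ.label e

/-- Composition of morphisms, first `f` and then `g`. -/
def LGraph.Hom.comp {X : Type} {Γ Δ Ξ : LGraph X} (g : LGraph.Hom Δ Ξ) (f : LGraph.Hom Γ Δ) :
    LGraph.Hom Γ Ξ where
  onV := fun v => g.onV (f.onV v)
  onE := fun e => g.onE (f.onE e)
  map_ini := fun e => by rw [f.map_ini, g.map_ini]
  map_bar := fun e => by rw [f.map_bar, g.map_bar]
  map_label := fun e => by rw [g.map_label, f.map_label]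

/-- A labeled graph is folded if edges with the same initial vertex have distinct labels. -/
def LGraph.IsFolded {X : Type} (Γ : LGraph X) : Prop :=
  ∀ e f : Γ.E, Γ.ini e = Γ.ini f → Γ.label e = Γ.label f → e = f

/-- The line segment whose successive edges are labeled by the letters of `L`. The edge
`(i, true)` goes from the vertex `i` to the vertex `i + 1`, and `(i, false)` is its reverse. -/
def seg {X : Type} (L : List (Letter X)) : LGraph X where
  V := Fin (L.length + 1)
  E := Fin L.length × Bool
  ini := fun e => if e.2 then e.1.castSucc else e.1.succ
  bar := fun e => (e.1, !e.2)
  bar_bar := fun e => by simp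
  bar_ne := fun e h => by
    have := congrArg Prod.snd h
    simp at this
  label := fun e => if e.2 then L.get e.1 else Letter.bar (L.get e.1)
  label_bar := fun e => by rcases e with ⟨i, b⟩; cases b <;> simp

/-- The circle whose successive edges are labeled by the letters of `L`. The edge `(i, true)`
goes from the vertex `i` to the vertex `i + 1` (modulo the length), `(i, false)` is its reverse. -/
def cyc {X : Type} (L : List (Letter X)) : LGraph X where
  V := Fin L.length
  E := Fin L.length × Bool
  ini := fun e =>
    if e.2 then e.1 else ⟨(e.1.val + 1) % L.length, Nat.mod_lt _ (Nat.zero_lt_of_lt e.1.isLt)⟩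
  bar := fun e => (e.1, !e.2)
  bar_bar := fun e => by simp
  bar_ne := fun e h => by
    have := congrArg Prod.snd h
    simp at this
  label := fun e => if e.2 then L.get e.1 else Letter.bar (L.get e.1)
  label_bar := fun e => by rcases e with ⟨i, b⟩; cases b <;> simp

/-! ### Folding -/

/-- The equivalence relation on vertices generated by folding: if `e` and `f` have the same label
and their initial vertices are identified then their terminal vertices are identified. -/
inductive LGraph.FoldRel {X : Type} (Γ : LGraph X) : Γ.V → Γ.V → Prop
  | refl (v : Γ.V) : LGraph.FoldRel Γ v v
  | symm {v w : Γ.V} : LGraph.FoldRel Γ v w → LGraph.FoldRel Γ w v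
  | trans {v w z : Γ.V} : LGraph.FoldRel Γ v w → LGraph.FoldRel Γ w z → LGraph.FoldRel Γ v z
  | step (e f : Γ.E) : LGraph.FoldRel Γ (Γ.ini e) (Γ.ini f) → Γ.label e = Γ.label f →
      LGraph.FoldRel Γ (Γ.ini (Γ.bar e)) (Γ.ini (Γ.bar f))

def LGraph.foldV {X : Type} (Γ : LGraph X) : Setoid Γ.V where
  r := Γ.FoldRel
  iseqv := ⟨LGraph.FoldRel.refl, LGraph.FoldRel.symm, LGraph.FoldRel.trans⟩

/-- Two edges are identified by folding iff they have the same label and their initial vertices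
are identified. -/
def LGraph.foldE {X : Type} (Γ : LGraph X) : Setoid Γ.E where
  r := fun e f => Γ.FoldRel (Γ.ini e) (Γ.ini f) ∧ Γ.label e = Γ.label f
  iseqv := ⟨fun _ => ⟨.refl _, rfl⟩, fun h => ⟨h.1.symm, h.2.symm⟩,
    fun h k => ⟨h.1.trans k.1, h.2.trans k.2⟩⟩

/-- The folded graph obtained from `Γ` by performing all foldings. -/
def LGraph.fold {X : Type} (Γ : LGraph X) : LGraph X where
  V := Quotient Γ.foldV
  E := Quotient Γ.foldE
  ini := Quotient.map' Γ.ini (fun _ _ h => h.1)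
  bar := Quotient.map' Γ.bar (fun e f h =>
    ⟨.step e f h.1 h.2, by rw [Γ.label_bar, Γ.label_bar, h.2]⟩)
  bar_bar := by
    rintro ⟨e⟩
    exact congrArg (Quotient.mk Γ.foldE) (Γ.bar_bar e)
  bar_ne := by
    rintro ⟨e⟩ h
    have h' : Γ.label (Γ.bar e) = Γ.label e := (Quotient.exact h).2
    rw [Γ.label_bar] at h'
    exact Letter.bar_ne _ h'
  label := fun e => Quotient.liftOn' e Γ.label (fun _ _ h => h.2)
  label_bar := by
    rintro ⟨e⟩
    exact Γ.label_bar e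

/-- The folding morphism. -/
def LGraph.toFold {X : Type} (Γ : LGraph X) : LGraph.Hom Γ Γ.fold where
  onV := Quotient.mk Γ.foldV
  onE := Quotient.mk Γ.foldE
  map_ini := fun _ => rfl
  map_bar := fun _ => rfl
  map_label := fun _ => rfl

theorem LGraph.fold_isFolded {X : Type} (Γ : LGraph X) : Γ.fold.IsFolded := by
  rintro ⟨e⟩ ⟨f⟩ h1 h2
  exact Quotient.sound ⟨Quotient.exact h1, h2⟩

theorem LGraph.Hom.foldRel {X : Type} {Γ Δ : LGraph X} (f : LGraph.Hom Γ Δ) {v w : Γ.V}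
    (h : Γ.FoldRel v w) : Δ.FoldRel (f.onV v) (f.onV w) := by
  induction h with
  | refl v => exact .refl _
  | symm _ ih => exact ih.symm
  | trans _ _ ih1 ih2 => exact ih1.trans ih2
  | step e e' _ hl ih =>
    rw [f.map_ini, f.map_bar, f.map_ini, f.map_bar]
    rw [f.map_ini, f.map_ini] at ih
    exact .step _ _ ih (by rw [f.map_label, f.map_label, hl])

/-- Functoriality of folding. -/
def LGraph.Hom.fold {X : Type} {Γ Δ : LGraph X} (f : LGraph.Hom Γ Δ) :
    LGraph.Hom Γ.fold Δ.fold where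
  onV := Quotient.map' f.onV (fun _ _ h => f.foldRel h)
  onE := Quotient.map' f.onE (fun e e' h => ⟨by
    have := f.foldRel h.1
    rwa [f.map_ini, f.map_ini] at this, by rw [f.map_label, f.map_label, h.2]⟩)
  map_ini := by
    rintro ⟨e⟩
    exact congrArg (Quotient.mk Δ.foldV) (f.map_ini e)
  map_bar := by
    rintro ⟨e⟩
    exact congrArg (Quotient.mk Δ.foldE) (f.map_bar e)
  map_label := by
    rintro ⟨e⟩
    exact f.map_label e

/-! ### The functors attached to an automorphism -/

/-- The free group of rank `n`. -/
abbrev F (n : ℕ) : Type := FreeGroup (Fin n)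

/-- The reduced word representing the image of a letter. -/
def img {n : ℕ} (φ : MulAut (F n)) (a : Letter (Fin n)) : List (Letter (Fin n)) :=
  (φ (FreeGroup.mk [a])).toWord

theorem img_bar {n : ℕ} (φ : MulAut (F n)) (a : Letter (Fin n)) :
    img φ (Letter.bar a) = FreeGroup.invRev (img φ a) := by
  have h : (FreeGroup.mk [Letter.bar a] : F n) = (FreeGroup.mk [a])⁻¹ := by
    simp [FreeGroup.inv_mk, FreeGroup.invRev, Letter.bar]
  rw [img, img, h, map_inv, FreeGroup.toWord_inv]

theorem img_bar_length {n : ℕ} (φ : MulAut (F n)) (a : Letter (Fin n)) :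
    (img φ (Letter.bar a)).length = (img φ a).length := by
  rw [img_bar, FreeGroup.invRev_length]

theorem get_congr {X : Type} {L L' : List X} (h : L = L') (i : ℕ) (hi : i < L.length)
    (hi' : i < L'.length) : L.get ⟨i, hi⟩ = L'.get ⟨i, hi'⟩ := by
  subst h
  rfl

/-- Positions on the paths that replace the edges: `(e, j)` is the `j`-th vertex of the path
replacing `e`. -/
abbrev SubPos {n : ℕ} (φ : MulAut (F n)) (Γ : LGraph (Fin n)) : Type :=
  {p : Γ.E × ℕ // p.2 ≤ (img φ (Γ.label p.1)).length}

/-- Identification of the vertices of the paths that replace the edges: the path replacing `e`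
starts at the initial vertex of `e`, and the path replacing the reverse of `e` is the reverse of
the path replacing `e`. -/
inductive SubRel {n : ℕ} (φ : MulAut (F n)) (Γ : LGraph (Fin n)) :
    Γ.V ⊕ SubPos φ Γ → Γ.V ⊕ SubPos φ Γ → Prop
  | start (e : Γ.E) : SubRel φ Γ (.inr ⟨(e, 0), Nat.zero_le _⟩) (.inl (Γ.ini e))
  | rev (e : Γ.E) (i j : ℕ) (h : i + j = (img φ (Γ.label e)).length) :
      SubRel φ Γ (.inr ⟨(e, i), by simp only; omega⟩)
        (.inr ⟨(Γ.bar e, j), by simp only [Γ.label_bar, img_bar_length]; omega⟩)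

/-- The graph `𝓕_φ(Γ)`: every edge `e` is replaced by a path labeled by the reduced word
`φ (label e)`. The edge `(e, j)` is the `j`-th edge of the path replacing `e`. -/
def subdiv {n : ℕ} (φ : MulAut (F n)) (Γ : LGraph (Fin n)) : LGraph (Fin n) where
  V := Quot (SubRel φ Γ)
  E := {p : Γ.E × ℕ // p.2 < (img φ (Γ.label p.1)).length}
  ini := fun p => Quot.mk _ (.inr ⟨p.1, le_of_lt p.2⟩)
  bar := fun p => ⟨(Γ.bar p.1.1, (img φ (Γ.label p.1.1)).length - 1 - p.1.2), by
    have := p.2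
    simp only [Γ.label_bar, img_bar_length]
    omega⟩
  bar_bar := by
    rintro ⟨⟨e, j⟩, h⟩
    simp only at h
    apply Subtype.ext
    simp only [Γ.bar_bar, Γ.label_bar, img_bar_length, Prod.mk.injEq, true_and]
    omega
  bar_ne := by
    rintro ⟨⟨e, j⟩, h⟩ h'
    exact Γ.bar_ne e (congrArg (fun q => q.1.1) h')
  label := fun p => (img φ (Γ.label p.1.1)).get ⟨p.1.2, p.2⟩
  label_bar := by
    rintro ⟨⟨e, j⟩, h⟩
    simp only at h
    have h1 : img φ (Γ.label (Γ.bar e)) = FreeGroup.invRev (img φ (Γ.label e)) := by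
      rw [Γ.label_bar, img_bar]
    refine (get_congr h1 _ _ (by rw [FreeGroup.invRev_length]; simp only; omega)).trans ?_
    simp only [List.get_eq_getElem, FreeGroup.invRev,
      List.getElem_reverse, List.getElem_map, List.length_map, Letter.bar]
    have h2 : (img φ (Γ.label e)).length - 1 - ((img φ (Γ.label e)).length - 1 - j) = j := by
      omega
    simp only [h2]

/-- Functoriality of `𝓕_φ`. -/
def LGraph.Hom.subdiv {n : ℕ} (φ : MulAut (F n)) {Γ Δ : LGraph (Fin n)} (f : LGraph.Hom Γ Δ) :
    LGraph.Hom (subdiv φ Γ) (subdiv φ Δ) where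
  onV := Quot.map
    (Sum.map f.onV (fun p => ⟨(f.onE p.1.1, p.1.2), by
      have := p.2
      simpa only [f.map_label] using this⟩))
    (by
      intro a b h
      cases h with
      | start e =>
        simp only [Sum.map_inr, Sum.map_inl, f.map_ini]
        exact SubRel.start (f.onE e)
      | rev e i j h =>
        simp only [Sum.map_inr, f.map_bar]
        exact SubRel.rev (f.onE e) i j (by rw [f.map_label, h]))
  onE := fun p => ⟨(f.onE p.1.1, p.1.2), by
    have := p.2
    simpa only [f.map_label] using this⟩
  map_ini := fun _ => rfl
  map_bar := by
    rintro ⟨⟨e, j⟩, h⟩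
    apply Subtype.ext
    simp only [OutRep.subdiv, f.map_bar, f.map_label]
  map_label := by
    rintro ⟨⟨e, j⟩, h⟩
    exact get_congr (by rw [f.map_label]) _ _ _

/-- The folded graph `𝓕̃_φ(Γ)`. -/
def foldedSubdiv {n : ℕ} (φ : MulAut (F n)) (Γ : LGraph (Fin n)) : LGraph (Fin n) :=
  (subdiv φ Γ).fold

/-- Functoriality of `𝓕̃_φ`. -/
def LGraph.Hom.foldedSubdiv {n : ℕ} (φ : MulAut (F n)) {Γ Δ : LGraph (Fin n)}
    (f : LGraph.Hom Γ Δ) : LGraph.Hom (foldedSubdiv φ Γ) (foldedSubdiv φ Δ) :=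
  (f.subdiv φ).fold

/-- The vertex of `𝓕̃_φ(Γ)` that comes from a vertex of `Γ`. -/
def foldedVertex {n : ℕ} (φ : MulAut (F n)) {Γ : LGraph (Fin n)} (x : Γ.V) :
    (foldedSubdiv φ Γ).V :=
  (subdiv φ Γ).toFold.onV (Quot.mk _ (.inl x))

/-! ### u-words and cyclic words -/

/-- The segment of the reduced word of a group element. -/
abbrev wseg {n : ℕ} (g : F n) : LGraph (Fin n) := seg g.toWord

/-- A reduced word and its inverse are the two orientations of one u-word. -/
def uSetoid (n : ℕ) : Setoid {g : F n // g ≠ 1} where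
  r := fun g h => g.1 = h.1 ∨ g.1 = h.1⁻¹
  iseqv := by
    refine ⟨fun _ => Or.inl rfl, ?_, ?_⟩
    · rintro ⟨g, _⟩ ⟨h, _⟩ (rfl | rfl) <;> simp
    · rintro ⟨g, _⟩ ⟨h, _⟩ ⟨k, _⟩ (rfl | rfl) (rfl | rfl) <;> simp

/-- The unoriented words: the nontrivial reduced words up to inversion. -/
def UWord (n : ℕ) : Type := Quotient (uSetoid n)

/-- The u-word of a nontrivial reduced word. -/
def UWord.mk {n : ℕ} (g : {g : F n // g ≠ 1}) : UWord n := Quotient.mk (uSetoid n) g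

/-- The length of a u-word. -/
def UWord.length {n : ℕ} (u : UWord n) : ℕ :=
  Quotient.liftOn u (fun g => g.1.norm) (by
    rintro ⟨g, _⟩ ⟨h, _⟩ (rfl | rfl) <;> simp)

/-- A representing reduced word of a u-word. -/
noncomputable def UWord.rep {n : ℕ} (u : UWord n) : F n := (Quotient.out u).1

/-- The labeled graph of a u-word. Up to isomorphism it does not depend on the representative. -/
noncomputable abbrev UWord.graph {n : ℕ} (u : UWord n) : LGraph (Fin n) := wseg u.rep

/-- Nontrivial elements up to conjugation and inversion. -/
def cSetoid (n : ℕ) : Setoid {g : F n // g ≠ 1} where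
  r := fun g h => IsConj g.1 h.1 ∨ IsConj g.1 h.1⁻¹
  iseqv := by
    have inv : ∀ {a b : F n}, IsConj a b → IsConj a⁻¹ b⁻¹ := by
      intro a b h
      obtain ⟨c, rfl⟩ := isConj_iff.1 h
      exact isConj_iff.2 ⟨c, by group⟩
    refine ⟨fun _ => Or.inl (IsConj.refl _), ?_, ?_⟩
    · rintro ⟨g, _⟩ ⟨h, _⟩ (H | H)
      · exact Or.inl H.symm
      · exact Or.inr (by simpa using (inv H).symm)
    · rintro ⟨g, _⟩ ⟨h, _⟩ ⟨k, _⟩ (H | H) (K | K)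
      · exact Or.inl (H.trans K)
      · exact Or.inr (H.trans K)
      · exact Or.inr (H.trans (inv K))
      · exact Or.inl (H.trans (by simpa using inv K))

/-- The cyclic words: nontrivial elements of the free group up to conjugation and inversion,
that is, nonempty cyclically reduced words up to cyclic permutation and inversion. -/
def CWord (n : ℕ) : Type := Quotient (cSetoid n)

/-- The labeled graph of a cyclic word: the circle labeled by a cyclically reduced representative.
Up to isomorphism it does not depend on the representative. -/
noncomputable def CWord.graph {n : ℕ} (w : CWord n) : LGraph (Fin n) :=
  cyc (FreeGroup.reduceCyclically (Quotient.out w).1.toWord)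

/-- The action of automorphisms on cyclic words. -/
def CWord.map {n : ℕ} (φ : MulAut (F n)) : CWord n → CWord n :=
  Quotient.map (fun g => ⟨φ g.1, by simpa using g.2⟩) (by
    have key : ∀ {a b : F n}, IsConj a b → IsConj (φ a) (φ b) := by
      intro a b h
      obtain ⟨c, rfl⟩ := isConj_iff.1 h
      exact isConj_iff.2 ⟨φ c, by simp⟩
    rintro ⟨g, _⟩ ⟨h, _⟩ (H | H)
    · exact Or.inl (key H)
    · exact Or.inr (by simpa using key H))

/-- `|Hom(u, w)|`: the number of appearances of the u-word `u` in the cyclic word `w`. -/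
noncomputable def homCount {n : ℕ} (u : UWord n) (w : CWord n) : ℕ :=
  Nat.card (LGraph.Hom u.graph w.graph)

/-! ### Ideal preimages and the multisets `S_{u,φ}` -/

/-- `j` is the inclusion of the segment `φ(v)` in the tree `𝓕̃_φ(v)`, as the path that joins the
images of the two end points of `v`. -/
def IsIncl {n : ℕ} (φ : MulAut (F n)) (v : F n)
    (j : LGraph.Hom (wseg (φ v)) (foldedSubdiv φ (wseg v))) : Prop :=
  j.onV (0 : Fin (_ + 1)) = foldedVertex φ (Γ := wseg v) (0 : Fin (_ + 1)) ∧
  j.onV (Fin.last _) = foldedVertex φ (Γ := wseg v) (Fin.last _)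

/-- For `h : v → w`, the morphisms `f : u → φ(v)` and `f' : u → φ(w)` agree in `𝓕̃_φ(w)`. -/
def Commutes {n : ℕ} (φ : MulAut (F n)) {u v w : F n} (h : LGraph.Hom (wseg v) (wseg w))
    (f : LGraph.Hom (wseg u) (wseg (φ v))) (f' : LGraph.Hom (wseg u) (wseg (φ w))) : Prop :=
  ∃ jv jw, IsIncl φ v jv ∧ IsIncl φ w jw ∧
    (h.foldedSubdiv φ).comp (jv.comp f) = jw.comp f'

/-- `f : u → φ(v)` is an ideal preimage of `u` with base word `v`. -/
def IsIdeal {n : ℕ} (φ : MulAut (F n)) {u v : F n} (f : LGraph.Hom (wseg u) (wseg (φ v))) :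
    Prop :=
  ∀ w : F n, w ≠ 1 → ∀ h : LGraph.Hom (wseg v) (wseg w),
    ∃ f' : LGraph.Hom (wseg u) (wseg (φ w)), Commutes φ h f f'

/-- `f : u → φ(v)` is a minimal ideal preimage: every sub ideal preimage of it is trivial, that
is, its morphism of base words is an isomorphism. -/
def IsMinimalIdeal {n : ℕ} (φ : MulAut (F n)) {u v : F n}
    (f : LGraph.Hom (wseg u) (wseg (φ v))) : Prop :=
  IsIdeal φ f ∧
  ∀ v' : F n, v' ≠ 1 → ∀ (f' : LGraph.Hom (wseg u) (wseg (φ v')))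
    (h : LGraph.Hom (wseg v') (wseg v)), IsIdeal φ f' → Commutes φ h f' f →
      Function.Bijective h.onV ∧ Function.Bijective h.onE

/-- The minimal ideal preimages of the u-word `u`: pairs of a base u-word `v` and a morphism
`u → φ(v)`. -/
def minimalIdeals {n : ℕ} (φ : MulAut (F n)) (u : UWord n) :
    Set (Σ v : UWord n, LGraph.Hom u.graph (wseg (φ v.rep))) :=
  {p | IsMinimalIdeal φ p.2}

open Classical in
/-- The multiset `S_{u,φ}` of the base words of the minimal ideal preimages of `u` (of which
there are finitely many). -/
noncomputable def S {n : ℕ} (φ : MulAut (F n)) (u : UWord n) : Multiset (UWord n) :=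
  if h : (minimalIdeals φ u).Finite then h.toFinset.val.map Sigma.fst else 0

/-! ### The modules `M_k` and the inverse limit -/

/-- The u-words of length `k`. -/
abbrev W (n k : ℕ) : Type := {u : UWord n // u.length = k}

instance W.finite (n k : ℕ) : Finite (W n k) := by
  let A := {g : {g : F n // g ≠ 1} // g.1.norm = k}
  have : Finite {l : List (Letter (Fin n)) // l.length = k} :=
    inferInstanceAs (Finite (List.Vector (Letter (Fin n)) k))
  have : Finite A := by
    refine Finite.of_injective
      (fun g : A => (⟨g.1.1.toWord, g.2⟩ : {l : List (Letter (Fin n)) // l.length = k})) ?_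
    intro g h e
    have := congrArg Subtype.val e
    exact Subtype.ext (Subtype.ext (FreeGroup.toWord_injective this))
  refine Finite.of_surjective (fun g : A => (⟨UWord.mk g.1, g.2⟩ : W n k)) ?_
  rintro ⟨⟨g⟩, h⟩
  exact ⟨⟨g, h⟩, rfl⟩

noncomputable instance W.fintype (n k : ℕ) : Fintype (W n k) := Fintype.ofFinite _

/-- `M_k`, the free `ℤ`-module generated by the u-words of length `k`. -/
abbrev M (n k : ℕ) : Type := W n k →₀ ℤ

/-- `ℤ[C]`, the free `ℤ`-module generated by the cyclic words. -/
abbrev ZC (n : ℕ) : Type := CWord n →₀ ℤ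

/-- The linear extension to `ℤ[C]` of the action of an automorphism on cyclic words. -/
noncomputable def actZC {n : ℕ} (φ : MulAut (F n)) : ZC n →ₗ[ℤ] ZC n :=
  Finsupp.lmapDomain ℤ ℤ (CWord.map φ)

/-- `π_k : ℤ[C] → M_k`, counting the subwords of length `k`. -/
noncomputable def piMap (n k : ℕ) : ZC n →ₗ[ℤ] M n k :=
  Finsupp.linearCombination ℤ (fun w : CWord n =>
    Finsupp.equivFunOnFinite.symm (fun u : W n k => (homCount u.1 w : ℤ)))

/-- `M̃_k`, the image of `π_k`. -/
noncomputable def Mtilde (n k : ℕ) : Submodule ℤ (M n k) := LinearMap.range (piMap n k)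

/-- A u-word orientation: a choice of one of the two orientations of every u-word. -/
structure Orientation (n : ℕ) where
  word : UWord n → F n
  ne_one : ∀ u, word u ≠ 1
  mk_word : ∀ u, UWord.mk ⟨word u, ne_one u⟩ = u

/-- The affix `u` of `w` is pointing outward: `u⁻¹` is a prefix or `u` is a suffix of `w`. -/
def Outward {n : ℕ} (σ : Orientation n) (u w : UWord n) : Prop :=
  (σ.word u)⁻¹.toWord <+: (σ.word w).toWord ∨ (σ.word u).toWord <:+ (σ.word w).toWord

/-- The affix `u` of `w` is pointing inward: `u` is a prefix or `u⁻¹` is a suffix of `w`. -/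
def Inward {n : ℕ} (σ : Orientation n) (u w : UWord n) : Prop :=
  (σ.word u).toWord <+: (σ.word w).toWord ∨ (σ.word u)⁻¹.toWord <:+ (σ.word w).toWord

open Classical in
/-- The homomorphism `M_{k+1} → M_k` that sends a u-word to the sum of its `k`-affixes pointing
outward. -/
noncomputable def pOut {n : ℕ} (σ : Orientation n) (k : ℕ) : M n (k + 1) →ₗ[ℤ] M n k :=
  Finsupp.linearCombination ℤ (fun w : W n (k + 1) =>
    Finsupp.equivFunOnFinite.symm (fun u : W n k => if Outward σ u.1 w.1 then (1 : ℤ) else 0))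

open Classical in
/-- The homomorphism `M_{k+1} → M_k` that sends a u-word to the sum of its `k`-affixes pointing
inward. -/
noncomputable def pIn {n : ℕ} (σ : Orientation n) (k : ℕ) : M n (k + 1) →ₗ[ℤ] M n k :=
  Finsupp.linearCombination ℤ (fun w : W n (k + 1) =>
    Finsupp.equivFunOnFinite.symm (fun u : W n k => if Inward σ u.1 w.1 then (1 : ℤ) else 0))

/-- The composition `M_m → M_{m-1} → ⋯ → M_l` of the homomorphisms `pOut`. -/
noncomputable def pComp {n : ℕ} (σ : Orientation n) {l m : ℕ} (h : l ≤ m) :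
    M n m →ₗ[ℤ] M n l :=
  Nat.leRec (motive := fun m _ => M n m →ₗ[ℤ] M n l) LinearMap.id
    (fun k _ f => f ∘ₗ pOut σ k) h

/-- The inverse limit of the modules `M̃_k` along the homomorphisms `p_k`, the common restrictions
of `pOut` and `pIn`. As `W n 0` is empty, the module for `k = 0` is zero. -/
noncomputable def invLimit {n : ℕ} (σ : Orientation n) : Submodule ℤ (∀ k : ℕ, M n k) where
  carrier := {x | (∀ k, x k ∈ Mtilde n k) ∧ ∀ k, pOut σ k (x (k + 1)) = x k}
  add_mem' := by
    rintro x y ⟨hx, hx'⟩ ⟨hy, hy'⟩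
    exact ⟨fun k => add_mem (hx k) (hy k), fun k => by
      simp only [Pi.add_apply, map_add, hx', hy']⟩
  zero_mem' := ⟨fun k => zero_mem _, fun k => by simp⟩
  smul_mem' := by
    rintro c x ⟨hx, hx'⟩
    exact ⟨fun k => Submodule.smul_mem _ c (hx k), fun k => by
      simp only [Pi.smul_apply, map_smul, hx']⟩

/-! ### The homomorphisms `φ_k` -/

/-- `m_k^φ`: the maximal length of a word in `S_{u,φ}` for a u-word `u` of length `k`. -/
noncomputable def mBound {n : ℕ} (φ : MulAut (F n)) (k : ℕ) : ℕ :=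
  Finset.univ.sup (fun u : W n k => ((S φ u.1).map UWord.length).sup)

/-- The functional on `M_m` that sends `x` to the coefficient of `v` in the image of `x` in
`M_{l(v)}` (it is used only for u-words `v` of length at most `m`). -/
noncomputable def coeff {n : ℕ} (σ : Orientation n) (m : ℕ) (v : UWord n) : M n m →ₗ[ℤ] ℤ :=
  if h : v.length ≤ m then (Finsupp.lapply (⟨v, rfl⟩ : W n v.length)) ∘ₗ pComp σ h else 0

/-- `φ_k : M_{m_k} → M_k`; the coefficient of `φ_k(x)` at a u-word `u` of length `k` is the sum
over `v ∈ S_{u,φ}` of the coefficient of `v` in the image of `x` in `M_{l(v)}`. -/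
noncomputable def phiLevel {n : ℕ} (σ : Orientation n) (φ : MulAut (F n)) (k : ℕ) :
    M n (mBound φ k) →ₗ[ℤ] M n k :=
  (Finsupp.linearEquivFunOnFinite ℤ ℤ (W n k)).symm.toLinearMap ∘ₗ
    LinearMap.pi (fun u : W n k => ((S φ u.1).map (coeff σ (mBound φ k))).sum)

/-! ### Outer automorphisms -/

instance innNormal (G : Type) [Group G] : (MulAut.conj (G := G)).range.Normal where
  conj_mem := by
    rintro _ ⟨g, rfl⟩ ψ
    refine ⟨ψ g, ?_⟩
    ext x
    simp [MulAut.conj_apply]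

/-- `Out(F_n)`, the automorphisms modulo the inner ones. -/
abbrev Out (n : ℕ) : Type := MulAut (F n) ⧸ (MulAut.conj (G := F n)).range

end OutRep

/-! Everything is moved to the Cayley tree of $F_n$. A connected folded graph with a morphism to
this tree is a subtree (`hom_cayley_injective`). Hence $\tilde{\mathcal F}_\varphi(v)$ is a subtree,
a morphism between segments is a left translation, and the agreement of two composites is one
equation in $F_n$ (`commutes_iff`). An ideal preimage becomes a pair of segments $[a,b]$ and $[y,z]$
such that $[\varphi p,\varphi q]$ contains $[y,z]$ whenever $[p,q]$ contains $[a,b]$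
(`isIdeal_iff`).

Two facts about these ideal segments carry part 1. The first is bounded cancellation
(`exists_bounded_cancellation`). It shows that $[p,q]$ is ideal as soon as $[\varphi p,\varphi q]$
passes through $[y,z]$ far from its ends, so that minimal ideal segments exist. It also shows that
the ends of a minimal ideal segment have images close to $y$ or $z$, so that there are finitely
many. The second is that a geodesic contains at most one minimal ideal segment for a given $[y,z]$
(`MinIdealSeg.unique`). If two of them overlap in an edge, the overlap is itself ideal. If they do
not, a branch leaving the geodesic between them, which exists in rank at least two, would have to be
sent to both sides of $[y,z]$.

A morphism from $u$ to the circle of $x$ is a segment labeled $u$ on the axis of $x$, up to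
translation by $x$. The axis of $\varphi(x)$ contains $[y,z]$ exactly when the axis of $x$ contains
a minimal ideal segment for $[y,z]$, and then it contains only one. Counting gives `homCount_map`.

For the inverse system, an occurrence of a word on an axis extends by one letter, in exactly one
way, at a prescribed end; hence $p_k\circ\pi_k=\pi_{k-1}$. Every element of $\tilde M_k$ is some
$\pi_k(y)$, so the identities for $\varphi_k$, multiplicativity and the triviality of inner
automorphisms all follow from the action on $\mathbb Z[C]$. Only $m_{k-1}\le m_k$ needs geometry
(`MinIdealSeg.exists_extension`).

For injectivity, the families $(\pi_k(w))_k$ lie in the limit, so an automorphism that acts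
trivially preserves all subword counts and fixes every cyclic word (`CWord.ext_homCount`). It then
sends each $g$ to a conjugate of $g^{\pm1}$. Testing the products $x_ix_j$ shows that all generators
are conjugated by one element and have the same sign. A word that is not conjugate to its reversal
excludes the negative sign (`exists_conj_of_isConj`). -/

namespace OutRep

/-! ### The Cayley tree of the free group -/

section Tree

variable {n : ℕ}

/-- The distance in the Cayley tree. -/
def tdist (a b : F n) : ℕ := (a⁻¹ * b).norm

/-- The vertex `x` lies on the geodesic from `a` to `b`. -/
def Btw (a x b : F n) : Prop := tdist a x + tdist x b = tdist a b

@[simp] theorem tdist_self (a : F n) : tdist a a = 0 := by simp [tdist]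

theorem tdist_comm (a b : F n) : tdist a b = tdist b a := by
  rw [tdist, tdist, ← FreeGroup.norm_inv_eq]; simp

theorem tdist_triangle (a b c : F n) : tdist a c ≤ tdist a b + tdist b c := by
  have := FreeGroup.norm_mul_le (a⁻¹ * b) (b⁻¹ * c)
  rwa [show a⁻¹ * b * (b⁻¹ * c) = a⁻¹ * c by group] at this

theorem tdist_eq_zero {a b : F n} : tdist a b = 0 ↔ a = b := by
  rw [tdist, FreeGroup.norm_eq_zero, inv_mul_eq_one]

theorem tdist_pos {a b : F n} (h : a ≠ b) : 0 < tdist a b :=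
  Nat.pos_of_ne_zero fun h0 => h (tdist_eq_zero.1 h0)

@[simp] theorem tdist_mul_left (g a b : F n) : tdist (g * a) (g * b) = tdist a b := by
  simp [tdist, mul_assoc]

@[simp] theorem tdist_one_left (a : F n) : tdist 1 a = a.norm := by simp [tdist]

@[simp] theorem tdist_mul_right_self (a g : F n) : tdist a (a * g) = g.norm := by simp [tdist]

theorem Btw.symm {a x b : F n} (h : Btw a x b) : Btw b x a := by
  have h1 := tdist_comm a x
  have h2 := tdist_comm x b
  have h3 := tdist_comm a b
  unfold Btw at *
  omega

theorem btw_comm {a x b : F n} : Btw a x b ↔ Btw b x a := ⟨Btw.symm, Btw.symm⟩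

@[simp] theorem btw_left (a b : F n) : Btw a a b := by simp [Btw]

@[simp] theorem btw_right (a b : F n) : Btw a b b := by simp [Btw]

@[simp] theorem btw_mul_left (g a x b : F n) : Btw (g * a) (g * x) (g * b) ↔ Btw a x b := by
  simp [Btw]

theorem Btw.eq_of_eq {a x : F n} (h : Btw a x a) : x = a := by
  have h1 := tdist_comm a x
  simp only [Btw, tdist_self] at h
  exact (tdist_eq_zero.1 (by omega)).symm

/-- Cancellation in the product of the reduced words of `p⁻¹` and `r` can only start at the
junction, where the inverse of the first letter of `p` meets the first letter of `r`. -/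
theorem norm_inv_mul_eq_iff (p r : F n) :
    (p⁻¹ * r).norm = p.norm + r.norm ↔ ∀ x ∈ p.toWord.head?, x ∉ r.toWord.head? := by
  constructor
  · intro h x hp hr
    obtain ⟨P, hP⟩ : ∃ P, p.toWord = x :: P := by
      cases hw : p.toWord with
      | nil => simp [hw] at hp
      | cons y P => simp [hw] at hp; exact ⟨P, by rw [hp]⟩
    obtain ⟨R, hR⟩ : ∃ R, r.toWord = x :: R := by
      cases hw : r.toWord with
      | nil => simp [hw] at hr
      | cons y P => simp [hw] at hr; exact ⟨P, by rw [hr]⟩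
    have hp' : p = FreeGroup.mk [x] * FreeGroup.mk P := by
      rw [FreeGroup.mul_mk, ← FreeGroup.mk_toWord (x := p), hP]; rfl
    have hr' : r = FreeGroup.mk [x] * FreeGroup.mk R := by
      rw [FreeGroup.mul_mk, ← FreeGroup.mk_toWord (x := r), hR]; rfl
    have e : p⁻¹ * r = (FreeGroup.mk P)⁻¹ * FreeGroup.mk R := by
      rw [hp', hr']; group
    have h1 := FreeGroup.norm_mul_le (FreeGroup.mk P)⁻¹ (FreeGroup.mk R)
    rw [FreeGroup.norm_inv_eq] at h1
    have h2 := FreeGroup.norm_mk_le (L₁ := P)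
    have h3 := FreeGroup.norm_mk_le (L₁ := R)
    rw [e] at h
    simp only [FreeGroup.norm, hP, hR, List.length_cons] at h h1 h2 h3
    omega
  · intro h
    have hred : FreeGroup.IsReduced (FreeGroup.invRev p.toWord ++ r.toWord) := by
      rw [FreeGroup.IsReduced, List.isChain_append]
      refine ⟨?_, FreeGroup.isReduced_toWord, ?_⟩
      · rw [← FreeGroup.toWord_inv]; exact FreeGroup.isReduced_toWord
      · intro x hx y hy h1
        simp only [FreeGroup.invRev, List.getLast?_reverse, List.head?_map, Option.mem_def,
          Option.map_eq_some_iff] at hx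
        obtain ⟨z, hz, rfl⟩ := hx
        by_contra h2
        apply h z hz
        have : z = y := Prod.ext h1 (by revert h2; cases z.2 <;> cases y.2 <;> simp)
        rwa [this]
    rw [FreeGroup.norm, FreeGroup.toWord_mul, FreeGroup.toWord_inv, hred.reduce_eq,
      List.length_append, FreeGroup.invRev_length]
    rfl

/-- The link between words and metric: lying on a geodesic is a local condition at `x`, namely that
the directions from `x` to the two ends differ. -/
theorem btw_iff_head (a x b : F n) :
    Btw a x b ↔ ∀ l ∈ (x⁻¹ * a).toWord.head?, l ∉ (x⁻¹ * b).toWord.head? := by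
  rw [← norm_inv_mul_eq_iff, Btw, tdist_comm a x]
  simp only [tdist]
  rw [show (x⁻¹ * a)⁻¹ * (x⁻¹ * b) = a⁻¹ * b by group, eq_comm]

/-- A vertex on a geodesic separates every vertex from one of the two ends. -/
theorem Btw.split {p m r : F n} (h : Btw p m r) (q : F n) : Btw p m q ∨ Btw q m r := by
  by_contra hc
  rw [not_or] at hc
  simp only [btw_iff_head] at h hc
  push Not at hc
  obtain ⟨⟨x, hx, hx'⟩, ⟨y, hy, hy'⟩⟩ := hc
  -- There is only one direction from `m` towards `q`; it would point towards both `p` and `r`.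
  have : x = y := Option.mem_unique hx' hy
  subst this
  exact h x hx hy'

theorem Btw.trans_left {a x y b : F n} (h : Btw a x b) (h' : Btw a y x) :
    Btw a y b ∧ Btw y x b := by
  have h1 := tdist_triangle y x b
  have h2 := tdist_triangle a y b
  unfold Btw at *
  omega

theorem Btw.trans_right {a x y b : F n} (h : Btw a x b) (h' : Btw x y b) :
    Btw a y b ∧ Btw a x y :=
  ⟨(h.symm.trans_left h'.symm).1.symm, (h.symm.trans_left h'.symm).2.symm⟩

/-- Geodesics that overlap in a nondegenerate segment glue to a geodesic. Otherwise `c` would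
separate `a` from `b`, against the order `a`, `b`, `c`. -/
theorem Btw.concat {a b c d : F n} (h : Btw a b c) (h' : Btw b c d) (hne : b ≠ c) :
    Btw a b d ∧ Btw a c d := by
  have h0 := tdist_pos hne
  have key : Btw a c d := by
    rcases h'.split a with h1 | h1
    · have h2 := tdist_comm b c
      have h3 := tdist_comm a c
      have h4 := tdist_comm a b
      unfold Btw at *
      omega
    · exact h1
  exact ⟨(key.trans_left h).1, key⟩

theorem Btw.total {a x y b : F n} (h : Btw a x b) (h' : Btw a y b) :
    (Btw a x y ∧ Btw x y b) ∨ (Btw a y x ∧ Btw y x b) := by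
  rcases h.split y with h1 | h1
  · exact .inl ⟨h1, (h'.trans_left h1).2⟩
  · exact .inr ⟨(h'.trans_right h1).2, h1⟩

/-- Geodesics are convex. -/
theorem Btw.convex {a x y b m : F n} (h : Btw a x b) (h' : Btw a y b) (hm : Btw x m y) :
    Btw a m b := by
  rcases h.total h' with ⟨h1, h2⟩ | ⟨h1, h2⟩
  · exact (h.trans_right (h2.trans_left hm).1).1
  · exact (h'.trans_right (h2.trans_left hm.symm).1).1

/-- Two vertices of a geodesic at the same distance from one of its ends agree. -/
theorem Btw.eq_of_tdist {a x y b : F n} (h : Btw a x b) (h' : Btw a y b)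
    (hd : tdist a x = tdist a y) : x = y := by
  rcases h.total h' with ⟨h1, -⟩ | ⟨h1, -⟩
  · exact tdist_eq_zero.1 (by unfold Btw at h1; omega)
  · exact (tdist_eq_zero.1 (by unfold Btw at h1; omega)).symm

/-- The order of two vertices on a geodesic is the order of their distances to the initial
vertex. -/
theorem Btw.of_le {a x y b : F n} (h : Btw a x b) (h' : Btw a y b)
    (hd : tdist a x ≤ tdist a y) : Btw a x y ∧ Btw x y b := by
  rcases h.total h' with h1 | ⟨h1, h2⟩
  · exact h1
  · have : y = x := tdist_eq_zero.1 (by unfold Btw at h1; omega)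
    subst this
    exact ⟨h1, h2⟩

/-! ### Letters, neighbours and branching in the tree. -/

theorem toWord_mk_singleton (l : Letter (Fin n)) : (FreeGroup.mk [l] : F n).toWord = [l] := by
  rw [FreeGroup.toWord_mk, FreeGroup.reduce_singleton]

@[simp] theorem norm_mk_singleton (l : Letter (Fin n)) : (FreeGroup.mk [l] : F n).norm = 1 := by
  rw [FreeGroup.norm, toWord_mk_singleton]; rfl

theorem mk_singleton_inv (l : Letter (Fin n)) :
    (FreeGroup.mk [l] : F n)⁻¹ = FreeGroup.mk [Letter.bar l] := by
  simp [FreeGroup.inv_mk, FreeGroup.invRev, Letter.bar]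

theorem eq_mk_singleton_of_norm {g : F n} (h : g.norm = 1) : ∃ l, g = FreeGroup.mk [l] := by
  obtain ⟨l, hl⟩ := List.length_eq_one_iff.1 h
  exact ⟨l, by rw [← FreeGroup.mk_toWord (x := g), hl]⟩

theorem exists_step {a b : F n} (h : a ≠ b) : ∃ c, tdist a c = 1 ∧ Btw a c b := by
  cases hw : (a⁻¹ * b).toWord with
  | nil =>
    rw [FreeGroup.toWord_eq_nil_iff, inv_mul_eq_one] at hw
    exact absurd hw h
  | cons l L =>
    refine ⟨a * FreeGroup.mk [l], by simp, ?_⟩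
    have e : (a * FreeGroup.mk [l])⁻¹ * b = FreeGroup.mk L := by
      have : a⁻¹ * b = FreeGroup.mk [l] * FreeGroup.mk L := by
        rw [FreeGroup.mul_mk, ← FreeGroup.mk_toWord (x := a⁻¹ * b), hw]; rfl
      rw [mul_inv_rev, mul_assoc, this]; group
    have h1 := tdist_triangle a (a * FreeGroup.mk [l]) b
    have h2 := FreeGroup.norm_mk_le (L₁ := L)
    have h3 : tdist a b = L.length + 1 := by rw [tdist, FreeGroup.norm, hw]; rfl
    have h4 : tdist (a * FreeGroup.mk [l]) b ≤ L.length := by rw [tdist, e]; exact h2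
    have h5 : tdist a (a * FreeGroup.mk [l]) = 1 := by simp
    unfold Btw
    omega

/-- At `b` there are `2 * n ≥ 4` directions, and at most two of them lead to `c₁` and `c₂`. This is
where rank at least two enters. -/
theorem exists_branch (hn : 2 ≤ n) (b c₁ c₂ : F n) :
    ∃ r, tdist b r = 1 ∧ Btw c₁ b r ∧ Btw c₂ b r := by
  obtain ⟨l, h1, h2⟩ : ∃ l : Letter (Fin n), l ∉ (b⁻¹ * c₁).toWord.head? ∧
      l ∉ (b⁻¹ * c₂).toWord.head? := by
    by_contra hcon
    push Not at hcon
    have hsub : (Finset.univ : Finset (Letter (Fin n))) ⊆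
        (b⁻¹ * c₁).toWord.head?.toFinset ∪ (b⁻¹ * c₂).toWord.head?.toFinset := by
      intro l _
      rw [Finset.mem_union, Option.mem_toFinset, Option.mem_toFinset]
      by_cases h : l ∈ (b⁻¹ * c₁).toWord.head?
      · exact .inl h
      · exact .inr (hcon l h)
    have hc : ∀ o : Option (Letter (Fin n)), o.toFinset.card ≤ 1 := by
      rintro (_ | _) <;> simp
    have h1 := Finset.card_le_card hsub
    have h2 := Finset.card_union_le
      (b⁻¹ * c₁).toWord.head?.toFinset (b⁻¹ * c₂).toWord.head?.toFinset
    have h3 := hc (b⁻¹ * c₁).toWord.head?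
    have h4 := hc (b⁻¹ * c₂).toWord.head?
    simp only [Finset.card_univ, Fintype.card_prod, Fintype.card_fin, Fintype.card_bool] at h1
    omega
  have e : b⁻¹ * (b * FreeGroup.mk [l]) = FreeGroup.mk [l] := by group
  refine ⟨b * FreeGroup.mk [l], by simp, ?_, ?_⟩ <;>
  · rw [btw_iff_head, e, toWord_mk_singleton]
    simp only [List.head?_cons, Option.mem_def, Option.some.injEq]
    rintro x hx rfl
    first | exact h1 hx | exact h2 hx

theorem exists_far (hn : 2 ≤ n) (a b : F n) (m : ℕ) : ∃ q, tdist b q = m ∧ Btw a b q := by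
  induction m with
  | zero => exact ⟨b, by simp⟩
  | succ m ih =>
    obtain ⟨q, hq, hb⟩ := ih
    -- Leaving `q` away from both `a` and `b` keeps the geodesic and increases the distance from
    -- `b`.
    obtain ⟨r, hr, h1, h2⟩ := exists_branch hn q a b
    refine ⟨r, ?_, (h1.trans_left hb).1⟩
    unfold Btw at h2
    omega

theorem finite_ball (a : F n) (m : ℕ) : {x : F n | tdist a x ≤ m}.Finite := by
  have h : {L : List (Letter (Fin n)) | L.length ≤ m}.Finite := List.finite_length_le _ m
  refine Set.Finite.subset (h.image fun L => a * FreeGroup.mk L) ?_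
  intro x hx
  exact ⟨(a⁻¹ * x).toWord, hx, by simp [FreeGroup.mk_toWord]⟩

end Tree

/-! ### Bounded cancellation and ideal segments -/

section Ideal

variable {n : ℕ} (φ : MulAut (F n))

theorem exists_lipschitz : ∃ K, ∀ a b, tdist (φ a) (φ b) ≤ K * tdist a b := by
  obtain ⟨K, hK⟩ : ∃ K, ∀ l : Letter (Fin n), (φ (FreeGroup.mk [l])).norm ≤ K := by
    refine ⟨Finset.univ.sup fun l : Letter (Fin n) => (φ (FreeGroup.mk [l])).norm, fun l => ?_⟩
    exact Finset.le_sup (f := fun l : Letter (Fin n) => (φ (FreeGroup.mk [l])).norm)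
      (Finset.mem_univ l)
  refine ⟨K, fun a b => ?_⟩
  have key : ∀ L : List (Letter (Fin n)), (φ (FreeGroup.mk L)).norm ≤ K * L.length := by
    intro L
    induction L with
    | nil => simp [← FreeGroup.one_eq_mk]
    | cons l L ih =>
      have e : (FreeGroup.mk (l :: L) : F n) = FreeGroup.mk [l] * FreeGroup.mk L := by simp
      rw [e, map_mul, List.length_cons, mul_add, mul_one]
      have h1 := FreeGroup.norm_mul_le (φ (FreeGroup.mk [l])) (φ (FreeGroup.mk L))
      have h2 := hK l
      omega
  have := key (a⁻¹ * b).toWord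
  rwa [FreeGroup.mk_toWord, map_mul, map_inv] at this

/-- A discrete intermediate value argument: along `[x, a]` the images jump by at most `K`, and one
of the jumps passes `m`. -/
theorem exists_btw_near {K : ℕ} (hK : ∀ a b, tdist (φ a) (φ b) ≤ K * tdist a b) {x a m : F n}
    (h : Btw (φ x) m (φ a)) : ∃ z, Btw x z a ∧ tdist (φ z) m ≤ K := by
  induction hd : tdist x a generalizing x with
  | zero =>
    obtain rfl := tdist_eq_zero.1 hd
    rw [h.eq_of_eq]
    exact ⟨x, by simp, by simp⟩
  | succ d ih =>
    have hne : x ≠ a := by rintro rfl; simp at hd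
    obtain ⟨c, hc, hb⟩ := exists_step hne
    rcases h.split (φ c) with h1 | h1
    · refine ⟨x, by simp, ?_⟩
      have := hK x c
      rw [hc] at this
      unfold Btw at h1
      omega
    · obtain ⟨z, hz, hz'⟩ := ih h1 (by unfold Btw at hb; omega)
      exact ⟨z, (hb.trans_right hz).1, hz'⟩

/-- If `y` is not on `[φ x, φ b]`, it is on both `[φ a, φ x]` and `[φ a, φ b]`. It is then close to
the images of some `z₁` on `[a, x]` and `z₂` on `[a, b]`. As the inverse of `φ` is Lipschitz, `z₁`
and `z₂` are close to each other, hence to `a` between them, so `y` is close to `φ a`. -/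
theorem exists_bounded_cancellation : ∃ C, ∀ a b x y : F n, Btw x a b → Btw (φ a) y (φ b) →
    C < tdist (φ a) y → Btw (φ x) y (φ b) := by
  obtain ⟨K, hK⟩ := exists_lipschitz φ
  obtain ⟨K', hK'⟩ := exists_lipschitz φ⁻¹
  -- The images of `z₁` and `z₂` are within `2 * K`, so `z₁` is within `K' * (2 * K)` of `a`; the
  -- last `K` is the distance from the image of `z₁` to `y`.
  refine ⟨K * (K' * (2 * K)) + K, fun a b x y hx hy hd => ?_⟩
  rcases hy.split (φ x) with h | h
  · exfalso
    obtain ⟨z₁, h1, h1'⟩ := exists_btw_near φ hK h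
    obtain ⟨z₂, h2, h2'⟩ := exists_btw_near φ hK hy
    have h3 : Btw z₁ a z₂ := ((hx.trans_right h2).2.trans_left h1.symm).2
    have h4 : tdist a z₁ ≤ tdist z₁ z₂ := by
      have := tdist_comm a z₁
      unfold Btw at h3
      omega
    have h5 : tdist (φ z₁) (φ z₂) ≤ 2 * K := by
      have := tdist_triangle (φ z₁) y (φ z₂)
      have := tdist_comm y (φ z₂)
      omega
    have h6 : tdist z₁ z₂ ≤ K' * (2 * K) := by
      have := hK' (φ z₁) (φ z₂)
      simp only [MulAut.inv_apply_self] at this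
      exact this.trans (Nat.mul_le_mul_left _ h5)
    have h7 : tdist (φ a) (φ z₁) ≤ K * (K' * (2 * K)) :=
      (hK a z₁).trans (Nat.mul_le_mul_left _ (h4.trans h6))
    have := tdist_triangle (φ a) (φ z₁) y
    omega
  · exact h

/-- The segment `[a, b]` is ideal for the segment `[y, z]`: whenever a geodesic contains `[a, b]`,
the geodesic between the images of its ends contains `[y, z]`. -/
def IdealSeg (y z a b : F n) : Prop :=
  ∀ p q, Btw p a q → Btw p b q → Btw (φ p) y (φ q) ∧ Btw (φ p) z (φ q)

/-- The vertices beyond `a`, seen from `b`, are mapped to vertices beyond `y`, seen from `z`. -/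
def HalfIn (a b y z : F n) : Prop := ∀ p, Btw p a b → Btw (φ p) y z

variable {φ}

theorem IdealSeg.swap_target {y z a b : F n} (h : IdealSeg φ y z a b) : IdealSeg φ z y a b :=
  fun p q hp hq => (h p q hp hq).symm

theorem IdealSeg.swap {y z a b : F n} (h : IdealSeg φ y z a b) : IdealSeg φ y z b a :=
  fun p q hp hq => h p q hq hp

theorem IdealSeg.mul_left {y z a b : F n} (h : IdealSeg φ y z a b) (g : F n) :
    IdealSeg φ (φ g * y) (φ g * z) (g * a) (g * b) := by
  intro p q hp hq
  rw [← mul_inv_cancel_left g p, ← mul_inv_cancel_left g q, btw_mul_left] at hp hq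
  have := h _ _ hp hq
  rwa [← btw_mul_left (φ g), ← btw_mul_left (φ g) _ z, ← map_mul, ← map_mul,
    mul_inv_cancel_left, mul_inv_cancel_left] at this

/-- Extending `[a, b]` beyond one end only leaves the image of the other end fixed, and this fixed
end determines the order in which the geodesic meets `y` and `z`. -/
theorem IdealSeg.halfIn {y z a b : F n} (h : IdealSeg φ y z a b) (hyz : y ≠ z)
    (h1 : Btw (φ a) y z) (h2 : Btw y z (φ b)) : HalfIn φ a b y z ∧ HalfIn φ b a z y := by
  have hyz' := tdist_pos hyz
  have hc := tdist_comm y z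
  constructor
  · intro p hp
    obtain ⟨h3, h4⟩ := h p b hp (by simp)
    rcases h3.total h4 with ⟨h5, -⟩ | ⟨-, h6⟩
    · exact h5
    · unfold Btw at *; omega
  · intro p hp
    obtain ⟨h3, h4⟩ := h a p (by simp) hp.symm
    rcases h3.total h4 with ⟨-, h5⟩ | ⟨h6, -⟩
    · exact h5.symm
    · have := tdist_comm (φ a) y
      have := tdist_comm (φ a) z
      unfold Btw at *; omega

theorem IdealSeg.halfIn_or {y z a b : F n} (h : IdealSeg φ y z a b) (hyz : y ≠ z) :
    (HalfIn φ a b y z ∧ HalfIn φ b a z y) ∨ (HalfIn φ a b z y ∧ HalfIn φ b a y z) := by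
  obtain ⟨h1, h2⟩ := h a b (by simp) (by simp)
  rcases h1.total h2 with ⟨h3, h4⟩ | ⟨h3, h4⟩
  · exact .inl (h.halfIn hyz h3 h4)
  · exact .inr (h.swap_target.halfIn hyz.symm h3 h4)

/-- The two half conditions give geodesics that overlap exactly in `[y, z]`, and `Btw.concat` glues
them. So the two ends of an ideal segment can be treated separately. -/
theorem HalfIn.idealSeg {y z a b : F n} (h1 : HalfIn φ a b y z) (h2 : HalfIn φ b a z y)
    (hyz : y ≠ z) : IdealSeg φ y z a b := by
  intro p q hp hq
  rcases hp.total hq with ⟨h3, h4⟩ | ⟨h3, h4⟩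
  · have h5 := h1 p h3
    have h6 := h2 q h4.symm
    exact h5.concat h6.symm hyz
  · have h5 := h2 p h3
    have h6 := h1 q h4.symm
    exact (h5.concat h6.symm hyz.symm).symm

variable (φ) in
/-- Segments whose images reach far beyond `[y, z]` on both sides are ideal. -/
theorem exists_idealSeg_of_far : ∃ C,
    (∀ a b y z : F n, Btw (φ a) y z → Btw y z (φ b) → y ≠ z → C < tdist (φ a) y →
      HalfIn φ a b y z) ∧
    ∀ y z a b : F n, y ≠ z → Btw (φ a) y (φ b) → Btw (φ a) z (φ b) →
      C < tdist (φ a) y → C < tdist (φ a) z → C < tdist (φ b) y → C < tdist (φ b) z →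
      IdealSeg φ y z a b := by
  obtain ⟨C, hC⟩ := exists_bounded_cancellation φ
  have key : ∀ a b y z : F n, Btw (φ a) y z → Btw y z (φ b) → y ≠ z → C < tdist (φ a) y →
      HalfIn φ a b y z := by
    intro a b y z h1 h2 hyz hd p hp
    exact ((hC a b p y hp (h1.concat h2 hyz).1 hd).symm.trans_left h2.symm).2.symm
  refine ⟨C, key, fun y z a b hyz h1 h2 h3 h4 h5 h6 => ?_⟩
  rcases h1.total h2 with ⟨h7, h8⟩ | ⟨h7, h8⟩
  · exact (key a b y z h7 h8 hyz h3).idealSeg (key b a z y h8.symm h7.symm hyz.symm h6) hyz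
  · exact ((key a b z y h7 h8 hyz.symm h4).idealSeg
      (key b a y z h8.symm h7.symm hyz h5) hyz.symm).swap_target

/-! ### Minimal ideal segments: existence, uniqueness on a geodesic, finiteness. -/

variable (φ) in
/-- The segment `[a, b]` is a minimal ideal segment for `[y, z]`. -/
def MinIdealSeg (y z a b : F n) : Prop :=
  a ≠ b ∧ IdealSeg φ y z a b ∧ ∀ c d, c ≠ d → Btw a c b → Btw a d b → IdealSeg φ y z c d →
    tdist c d = tdist a b

theorem MinIdealSeg.swap_target {y z a b : F n} (h : MinIdealSeg φ y z a b) :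
    MinIdealSeg φ z y a b :=
  ⟨h.1, h.2.1.swap_target, fun c d hne hc hd hi => h.2.2 c d hne hc hd hi.swap_target⟩

theorem MinIdealSeg.swap {y z a b : F n} (h : MinIdealSeg φ y z a b) : MinIdealSeg φ y z b a :=
  ⟨h.1.symm, h.2.1.swap, fun c d hne hc hd hi => by
    rw [tdist_comm b a]; exact h.2.2 c d hne hc.symm hd.symm hi⟩

theorem MinIdealSeg.mul_left {y z a b : F n} (h : MinIdealSeg φ y z a b) (g : F n) :
    MinIdealSeg φ (φ g * y) (φ g * z) (g * a) (g * b) := by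
  refine ⟨by simpa using h.1, h.2.1.mul_left g, fun c d hne hc hd hi => ?_⟩
  rw [← mul_inv_cancel_left g c, btw_mul_left] at hc
  rw [← mul_inv_cancel_left g d, btw_mul_left] at hd
  have h1 := hi.mul_left g⁻¹
  simp only [map_inv, inv_mul_cancel_left] at h1
  have h2 := h.2.2 _ _ (by simpa using hne) hc hd h1
  simpa using h2

theorem IdealSeg.exists_min {y z a b : F n} (h : IdealSeg φ y z a b) (hab : a ≠ b) :
    ∃ c d, Btw a c b ∧ Btw a d b ∧ MinIdealSeg φ y z c d := by
  induction hd : tdist a b using Nat.strong_induction_on generalizing a b with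
  | _ m ih =>
    by_cases hm : MinIdealSeg φ y z a b
    · exact ⟨a, b, by simp, by simp, hm⟩
    · rw [MinIdealSeg] at hm
      push Not at hm
      obtain ⟨c, d, hne, hc, hd', hi, hlt⟩ := hm hab h
      have hle : tdist c d ≤ tdist a b := by
        rcases hc.total hd' with ⟨h1, h2⟩ | ⟨h1, h2⟩
        · have := tdist_comm c d
          unfold Btw at *; omega
        · have := tdist_comm c d
          unfold Btw at *; omega
      obtain ⟨c', d', h1, h2, h3⟩ := ih _ (by omega) hi hne rfl
      exact ⟨c', d', hc.convex hd' h1, hc.convex hd' h2, h3⟩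

/-- With `a` before `a'` along `[p, q]` there are three cases. Nested segments agree by minimality,
overlapping ones agree because the overlap is ideal, and segments without a common edge are
impossible by branching. -/
theorem MinIdealSeg.unique_aux (hn : 2 ≤ n) {y z a b a' b' p q : F n} (hyz : y ≠ z)
    (h : MinIdealSeg φ y z a b) (h' : MinIdealSeg φ y z a' b')
    (ha : Btw p a q) (hb : Btw p b q) (ha' : Btw p a' q) (hb' : Btw p b' q)
    (hab : tdist p a < tdist p b) (hab' : tdist p a' < tdist p b')
    (h1 : HalfIn φ a b y z) (h2 : HalfIn φ b a z y)
    (h1' : HalfIn φ a' b' y z)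
    (hle : tdist p a ≤ tdist p a') : a = a' ∧ b = b' := by
  have o1 := ha.of_le hb hab.le
  have o2 := ha'.of_le hb' hab'.le
  have o3 := ha.of_le ha' hle
  rcases le_total (tdist p b') (tdist p b) with hle' | hle'
  · have o4 := hb'.of_le hb hle'
    have hd := h.2.2 a' b' h'.1 ((o4.1.trans_left o2.1).1.trans_left o3.1).2
      (o4.1.trans_left (o2.1.trans_left o3.1).1).2 h'.2.1
    have e : tdist p a = tdist p a' ∧ tdist p b = tdist p b' := by
      have := o1.1
      have := o2.1
      unfold Btw at *
      omega
    exact ⟨ha.eq_of_tdist ha' e.1, hb.eq_of_tdist hb' e.2⟩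
  · have o4 := hb.of_le hb' hle'
    rcases lt_or_ge (tdist p a') (tdist p b) with hlt | hge
    · have o5 := ha'.of_le hb hlt.le
      have hne : a' ≠ b := by rintro rfl; exact lt_irrefl _ hlt
      -- The overlap inherits its condition at `a'` from the second segment and its condition at `b`
      -- from the first.
      have hi : IdealSeg φ y z a' b := by
        refine HalfIn.idealSeg (fun r hr => ?_) (fun r hr => ?_) hyz
        · exact h1' r (hr.concat ((o4.1.trans_left o5.1).2) hne).1
        · exact h2 r (hr.concat ((o5.1.trans_left o3.1).2.symm) hne.symm).1
      have d1 := h.2.2 a' b hne ((o5.1.trans_left o3.1).2) (by simp) hi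
      have d2 := h'.2.2 a' b hne (by simp) ((o4.1.trans_left o5.1).2) hi
      have e : tdist p a = tdist p a' ∧ tdist p b = tdist p b' := by
        have := o1.1
        have := o2.1
        have := o5.1
        unfold Btw at *
        omega
      exact ⟨ha.eq_of_tdist ha' e.1, hb.eq_of_tdist hb' e.2⟩
    · exfalso
      -- The branch point `r` is beyond `b` seen from `a` and beyond `a'` seen from `b'`, so its
      -- image would be beyond both ends of `[y, z]`.
      obtain ⟨r, -, hr1, hr2⟩ := exists_branch hn b a b'
      have o5 := hb.of_le ha' hge
      have hr3 : Btw r a' b' := (hr2.symm.trans_right ((o2.1.trans_left o5.1).2)).1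
      have h3 := h1' r hr3
      have h4 := h2 r hr1.symm
      have := tdist_pos hyz
      have := tdist_comm y z
      unfold Btw at h3 h4
      omega

/-- A geodesic contains at most one minimal ideal segment. -/
theorem MinIdealSeg.unique (hn : 2 ≤ n) {y z a b a' b' p q : F n} (hyz : y ≠ z)
    (h : MinIdealSeg φ y z a b) (h' : MinIdealSeg φ y z a' b')
    (ha : Btw p a q) (hb : Btw p b q) (ha' : Btw p a' q) (hb' : Btw p b' q) :
    (a = a' ∧ b = b') ∨ (a = b' ∧ b = a') := by
  wlog hab : tdist p a ≤ tdist p b generalizing a b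
  · have := this h.swap hb ha (le_of_not_ge hab)
    tauto
  wlog hab' : tdist p a' ≤ tdist p b' generalizing a' b'
  · have := this h'.swap hb' ha' (le_of_not_ge hab')
    tauto
  have hlt : tdist p a < tdist p b := lt_of_le_of_ne hab fun e => h.1 (ha.eq_of_tdist hb e)
  have hlt' : tdist p a' < tdist p b' := lt_of_le_of_ne hab' fun e => h'.1 (ha'.eq_of_tdist hb' e)
  left
  wlog h1 : HalfIn φ a b y z ∧ HalfIn φ b a z y generalizing y z
  · exact this hyz.symm h.swap_target h'.swap_target
      ((h.2.1.halfIn_or hyz).resolve_left h1)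
  -- The two segments have the same orientation relative to `[y, z]`: the image of the common end
  -- `p` cannot be beyond `y` and also beyond `z`.
  have h1' : HalfIn φ a' b' y z ∧ HalfIn φ b' a' z y := by
    refine (h'.2.1.halfIn_or hyz).resolve_right fun h2 => ?_
    have h3 := h1.1 p (ha.of_le hb hab).1
    have h4 := h2.1 p (ha'.of_le hb' hab').1
    have := tdist_pos hyz
    have := tdist_comm y z
    unfold Btw at h3 h4
    omega
  rcases le_total (tdist p a) (tdist p a') with hle | hle
  · exact h.unique_aux hn hyz h' ha hb ha' hb' hlt hlt' h1.1 h1.2 h1'.1 hle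
  · have := h'.unique_aux hn hyz h ha' hb' ha hb hlt' hlt h1'.1 h1'.2 h1.1 hle
    exact ⟨this.1.symm, this.2.symm⟩

variable (φ) in
-- If the image of `a` were far from the target, moving `a` one step towards `b` would change the
-- image by at most `K`. By bounded cancellation the shorter segment would still be ideal, against
-- minimality.
theorem exists_minIdealSeg_near : ∃ D, ∀ y z a b : F n, y ≠ z → MinIdealSeg φ y z a b →
    (tdist (φ a) y ≤ D ∨ tdist (φ a) z ≤ D) := by
  obtain ⟨K, hK⟩ := exists_lipschitz φ
  obtain ⟨C, hC, -⟩ := exists_idealSeg_of_far φ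
  have key : ∀ y z a b : F n, y ≠ z → MinIdealSeg φ y z a b → HalfIn φ a b y z →
      HalfIn φ b a z y → tdist (φ a) y ≤ C + K := by
    intro y z a b hyz h h1 h2
    obtain ⟨c, hc, hb⟩ := exists_step h.1
    have hKc := hK a c
    rw [hc, mul_one] at hKc
    have ha := h1 a (by simp)
    have hb' := h2 b (by simp)
    by_cases hcb : c = b
    · subst hcb
      have := (ha.concat hb'.symm hyz).1
      unfold Btw at this
      omega
    · by_contra hlt
      have hcy : Btw (φ c) y z := by
        rcases ha.split (φ c) with h3 | h3
        · unfold Btw at h3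
          omega
        · exact h3
      have hd : C < tdist (φ c) y := by
        have := tdist_triangle (φ a) (φ c) y
        omega
      have hi : IdealSeg φ y z c b := by
        refine (hC c b y z hcy hb'.symm hyz hd).idealSeg (fun r hr => h2 r ?_) hyz
        exact (hr.concat hb.symm (Ne.symm hcb)).1
      have := h.2.2 c b hcb hb (by simp) hi
      unfold Btw at hb
      omega
  refine ⟨C + K, fun y z a b hyz h => ?_⟩
  rcases h.2.1.halfIn_or hyz with ⟨h1, h2⟩ | ⟨h1, h2⟩
  · exact .inl (key y z a b hyz h h1 h2)
  · exact .inr (key z y a b hyz.symm h.swap_target h1 h2)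

variable (φ) in
theorem finite_minIdealSeg {y z : F n} (hyz : y ≠ z) :
    {s : F n × F n | MinIdealSeg φ y z s.1 s.2}.Finite := by
  obtain ⟨D, hD⟩ := exists_minIdealSeg_near φ
  set B : Set (F n) := φ ⁻¹' ({x | tdist y x ≤ D} ∪ {x | tdist z x ≤ D}) with hB
  have hfin : B.Finite :=
    ((finite_ball y D).union (finite_ball z D)).preimage φ.injective.injOn
  refine (hfin.prod hfin).subset ?_
  rintro ⟨a, b⟩ h
  have h1 := hD y z a b hyz h
  have h2 := hD y z b a hyz h.swap
  rw [tdist_comm _ y, tdist_comm _ z] at h1 h2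
  exact ⟨h1, h2⟩

end Ideal

/-! ### Reading words in labeled graphs -/

section Reads

variable {X : Type} {Γ Δ : LGraph X}

/-- There is a path from `v` to `w` labeled by the given word. -/
def LGraph.Reads (Γ : LGraph X) : Γ.V → List (Letter X) → Γ.V → Prop
  | v, [], w => v = w
  | v, l :: L, w => ∃ e, Γ.ini e = v ∧ Γ.label e = l ∧ LGraph.Reads Γ (Γ.ini (Γ.bar e)) L w

/-- Any two vertices are joined by a path. -/
def LGraph.IsConn (Γ : LGraph X) : Prop := ∀ v w, ∃ L, Γ.Reads v L w

theorem LGraph.reads_append {v w : Γ.V} {L L' : List (Letter X)} :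
    Γ.Reads v (L ++ L') w ↔ ∃ z, Γ.Reads v L z ∧ Γ.Reads z L' w := by
  induction L generalizing v with
  | nil => simp [LGraph.Reads]
  | cons l L ih =>
    simp only [List.cons_append, LGraph.Reads, ih]
    constructor
    · rintro ⟨e, h1, h2, z, h3, h4⟩
      exact ⟨z, ⟨e, h1, h2, h3⟩, h4⟩
    · rintro ⟨z, ⟨e, h1, h2, h3⟩, h4⟩
      exact ⟨e, h1, h2, z, h3, h4⟩

theorem LGraph.reads_edge (e : Γ.E) : Γ.Reads (Γ.ini e) [Γ.label e] (Γ.ini (Γ.bar e)) :=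
  ⟨e, rfl, rfl, rfl⟩

theorem LGraph.Reads.map (f : LGraph.Hom Γ Δ) {v w : Γ.V} {L : List (Letter X)}
    (h : Γ.Reads v L w) : Δ.Reads (f.onV v) L (f.onV w) := by
  induction L generalizing v with
  | nil => exact congrArg f.onV h
  | cons l L ih =>
    obtain ⟨e, rfl, rfl, h3⟩ := h
    refine ⟨f.onE e, (f.map_ini e).symm, f.map_label e, ?_⟩
    rw [← f.map_bar, ← f.map_ini]
    exact ih h3

theorem LGraph.Reads.symm {v w : Γ.V} {L : List (Letter X)} (h : Γ.Reads v L w) :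
    Γ.Reads w (FreeGroup.invRev L) v := by
  induction L generalizing v with
  | nil => exact Eq.symm h
  | cons l L ih =>
    obtain ⟨e, rfl, rfl, h3⟩ := h
    rw [FreeGroup.invRev_cons, LGraph.reads_append]
    refine ⟨_, ih h3, Γ.bar e, rfl, ?_, ?_⟩
    · rw [Γ.label_bar]; rfl
    · rw [Γ.bar_bar]; rfl

theorem LGraph.Reads.det (hΓ : Γ.IsFolded) {v w w' : Γ.V} {L : List (Letter X)}
    (h : Γ.Reads v L w) (h' : Γ.Reads v L w') : w = w' := by
  induction L generalizing v with
  | nil => exact (Eq.symm h).trans h'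
  | cons l L ih =>
    obtain ⟨e, h1, h2, h3⟩ := h
    obtain ⟨e', h1', h2', h3'⟩ := h'
    obtain rfl := hΓ e e' (h1.trans h1'.symm) (h2.trans h2'.symm)
    exact ih h3 h3'

/-- In a folded graph a subpath labeled by a letter and its inverse runs back along the same edge,
so cancelling it keeps the ends of the path. -/
theorem LGraph.Reads.of_red (hΓ : Γ.IsFolded) {v w : Γ.V} {L L' : List (Letter X)}
    (hr : FreeGroup.Red L L') (h : Γ.Reads v L w) : Γ.Reads v L' w := by
  induction hr with
  | refl => exact h
  | tail _ hs ih =>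
    cases hs with
    | @not L₁ L₂ x b =>
      obtain ⟨z, h1, e, h2, h3, e', h4, h5, h6⟩ := LGraph.reads_append.1 ih
      rw [LGraph.reads_append]
      refine ⟨z, h1, ?_⟩
      have : e' = Γ.bar e := hΓ _ _ h4 (by rw [h5, Γ.label_bar, h3]; rfl)
      rw [this, Γ.bar_bar, h2] at h6
      exact h6

theorem LGraph.Reads.reduce [DecidableEq X] (hΓ : Γ.IsFolded) {v w : Γ.V} {L : List (Letter X)}
    (h : Γ.Reads v L w) : Γ.Reads v (FreeGroup.reduce L) w :=
  h.of_red hΓ FreeGroup.reduce.red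

theorem seg_reads_take (L : List (Letter X)) (i : ℕ) (hi : i < L.length + 1) :
    (seg L).Reads (0 : Fin (L.length + 1)) (L.take i) (⟨i, hi⟩ : Fin (L.length + 1)) := by
  induction i with
  | zero => exact rfl
  | succ i ih =>
    rw [List.take_succ_eq_append_getElem (by omega : i < L.length)]
    refine LGraph.reads_append.2 ⟨_, ih (by omega), ((⟨i, by omega⟩, true) : Fin L.length × Bool), ?_, ?_, ?_⟩
    · simp [seg]
    · simp [seg]
    · simp [seg, LGraph.Reads]

theorem seg_isConn (L : List (Letter X)) : (seg L).IsConn := by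
  intro v w
  have h1 := seg_reads_take L v.1 v.2
  have h2 := seg_reads_take L w.1 w.2
  exact ⟨_, LGraph.reads_append.2 ⟨_, h1.symm, h2⟩⟩

theorem seg_hom_reads {L : List (Letter X)} (f : LGraph.Hom (seg L) Γ)
    (i : Fin (L.length + 1)) :
    Γ.Reads (f.onV (0 : Fin (L.length + 1))) (L.take i) (f.onV i) :=
  (seg_reads_take L i.1 i.2).map f

theorem seg_hom_reads_last {L : List (Letter X)} (f : LGraph.Hom (seg L) Γ) :
    Γ.Reads (f.onV (0 : Fin (L.length + 1))) L (f.onV (Fin.last L.length)) := by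
  simpa using seg_hom_reads f (Fin.last _)

/-- Morphisms of a segment to a folded graph are determined by the initial vertex. -/
theorem seg_hom_ext (hΓ : Γ.IsFolded) {L : List (Letter X)} {f g : LGraph.Hom (seg L) Γ}
    (h : f.onV (0 : Fin (L.length + 1)) = g.onV (0 : Fin (L.length + 1))) : f = g := by
  have hV : f.onV = g.onV := by
    funext i
    have h1 := seg_hom_reads f i
    rw [h] at h1
    exact h1.det hΓ (seg_hom_reads g i)
  refine LGraph.Hom.ext hV ?_
  funext e
  refine hΓ _ _ ?_ ?_
  · rw [← f.map_ini, ← g.map_ini, hV]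
  · rw [f.map_label, g.map_label]

theorem LGraph.Reads.exists_path {v w : Γ.V} {L : List (Letter X)} (h : Γ.Reads v L w) :
    ∃ (p : ℕ → Γ.V) (e : Fin L.length → Γ.E), p 0 = v ∧ p L.length = w ∧
      ∀ i : Fin L.length, Γ.ini (e i) = p i ∧ Γ.ini (Γ.bar (e i)) = p (i + 1) ∧
        Γ.label (e i) = L.get i := by
  induction L generalizing v with
  | nil => exact ⟨fun _ => v, Fin.elim0, rfl, h, fun i => i.elim0⟩
  | cons l L ih =>
    obtain ⟨a, rfl, rfl, h3⟩ := h
    obtain ⟨p, e, hp, hp', he⟩ := ih h3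
    refine ⟨fun i => Nat.casesOn i (Γ.ini a) p, Fin.cons a e, rfl, hp', fun i => ?_⟩
    refine Fin.cases ?_ (fun j => ?_) i
    · exact ⟨rfl, hp.symm, rfl⟩
    · exact he j

theorem LGraph.Reads.exists_hom {v w : Γ.V} {L : List (Letter X)} (h : Γ.Reads v L w) :
    ∃ f : LGraph.Hom (seg L) Γ, f.onV (0 : Fin (L.length + 1)) = v ∧
      f.onV (Fin.last L.length) = w := by
  obtain ⟨p, e, hp, hp', he⟩ := h.exists_path
  refine ⟨{ onV := fun i => p i.1
            onE := fun x => if x.2 then e x.1 else Γ.bar (e x.1)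
            map_ini := ?_
            map_bar := ?_
            map_label := ?_ }, hp, hp'⟩
  · rintro ⟨i, b⟩
    cases b
    · simp [seg, (he i).2.1]
    · simp [seg, (he i).1]
  · rintro ⟨i, b⟩
    cases b <;> simp [seg, Γ.bar_bar]
  · rintro ⟨i, b⟩
    cases b
    · simp [seg, Γ.label_bar, (he i).2.2]
    · simp [seg, (he i).2.2]

/-- The two edges leaving an inner vertex carry the next letter and the inverse of the previous one;
they have the same label only if the word is not reduced there. -/
theorem seg_isFolded {L : List (Letter X)} (hL : FreeGroup.IsReduced L) : (seg L).IsFolded := by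
  have key : ∀ (i j : Fin L.length), i.castSucc = j.succ → L.get i ≠ Letter.bar (L.get j) := by
    intro i j hij he
    have h1 : (i : ℕ) = j + 1 := by simpa using congrArg Fin.val hij
    have h2 := List.isChain_iff_getElem.1 hL j.1 (by omega)
    have h3 : L.get i = L[j.1 + 1] := by simp [h1]
    rw [h3] at he
    rw [he] at h2
    simp [Letter.bar] at h2
  rintro ⟨i, b⟩ ⟨j, c⟩ h1 h2
  cases b <;> cases c <;> simp only [seg, if_true, if_false, Bool.false_eq_true] at h1 h2
  · rw [Fin.succ_injective _ h1]
  · exact absurd h2.symm (key j i h1.symm)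
  · exact absurd h2 (key i j h1)
  · rw [Fin.castSucc_injective _ h1]

theorem wseg_isFolded {n : ℕ} (g : F n) : (wseg g).IsFolded := seg_isFolded FreeGroup.isReduced_toWord

/-- Folded graphs receive morphisms from the folding of the source. -/
def LGraph.Hom.foldLift (hΔ : Δ.IsFolded) (f : LGraph.Hom Γ Δ) : LGraph.Hom Γ.fold Δ :=
  have key : ∀ {v w : Γ.V}, Γ.FoldRel v w → f.onV v = f.onV w := by
    intro v w h
    induction h with
    | refl v => rfl
    | symm _ ih => exact ih.symm
    | trans _ _ ih1 ih2 => exact ih1.trans ih2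
    | step e e' _ hl ih =>
      rw [f.map_ini, f.map_ini] at ih
      rw [f.map_ini, f.map_bar, f.map_ini, f.map_bar,
        hΔ _ _ ih (by rw [f.map_label, f.map_label, hl])]
  { onV := fun v => Quotient.liftOn' v f.onV (fun _ _ h => key h)
    onE := fun e => Quotient.liftOn' e f.onE (fun e e' h => hΔ _ _
      (by rw [← f.map_ini, ← f.map_ini]; exact key h.1) (by rw [f.map_label, f.map_label, h.2]))
    map_ini := by rintro ⟨e⟩; exact f.map_ini e
    map_bar := by rintro ⟨e⟩; exact f.map_bar e
    map_label := by rintro ⟨e⟩; exact f.map_label e }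

theorem LGraph.IsConn.fold (h : Γ.IsConn) : Γ.fold.IsConn := by
  rintro ⟨v⟩ ⟨w⟩
  obtain ⟨L, hL⟩ := h v w
  exact ⟨L, hL.map Γ.toFold⟩

end Reads

/-! ### The Cayley graph and the developing maps -/

section Cayley

variable {n : ℕ}

/-- The Cayley graph of the free group. -/
def cayley (n : ℕ) : LGraph (Fin n) where
  V := F n
  E := F n × Letter (Fin n)
  ini := fun e => e.1
  bar := fun e => (e.1 * FreeGroup.mk [e.2], Letter.bar e.2)
  bar_bar := fun e => by
    simp only [Letter.bar_bar]
    rw [← mk_singleton_inv, mul_inv_cancel_right]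
  bar_ne := fun e h => Letter.bar_ne _ (congrArg Prod.snd h)
  label := fun e => e.2
  label_bar := fun _ => rfl

/-- The vertices of a labeled graph over the Cayley graph, as elements of the free group. -/
def LGraph.Hom.val {Γ : LGraph (Fin n)} (f : LGraph.Hom Γ (cayley n)) (v : Γ.V) : F n := f.onV v

theorem cayley_isFolded : (cayley n).IsFolded := fun _ _ h1 h2 => Prod.ext h1 h2

theorem cayley_reads {a b : F n} {L : List (Letter (Fin n))}
    (h : (cayley n).Reads a L b) : b = a * FreeGroup.mk L := by
  induction L generalizing a with
  | nil =>
    rw [← FreeGroup.one_eq_mk, mul_one]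
    exact Eq.symm h
  | cons l L ih =>
    obtain ⟨e, rfl, rfl, h3⟩ := h
    have := ih h3
    rw [this]
    change e.1 * FreeGroup.mk [e.2] * _ = e.1 * FreeGroup.mk (e.2 :: L)
    rw [mul_assoc, FreeGroup.mul_mk]
    rfl

/-- A labeled map to the Cayley graph is determined by a compatible map of vertices. -/
def toCayley {Γ : LGraph (Fin n)} (τ : Γ.V → F n)
    (h : ∀ e, τ (Γ.ini (Γ.bar e)) = τ (Γ.ini e) * FreeGroup.mk [Γ.label e]) :
    LGraph.Hom Γ (cayley n) where
  onV := τ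
  onE := fun e => (τ (Γ.ini e), Γ.label e)
  map_ini := fun _ => rfl
  map_bar := fun e => Prod.ext (h e) (Γ.label_bar e)
  map_label := fun _ => rfl

theorem LGraph.Reads.val {Γ : LGraph (Fin n)} {v w : Γ.V} {L : List (Letter (Fin n))}
    (h : Γ.Reads v L w) (f : LGraph.Hom Γ (cayley n)) :
    f.val w = f.val v * FreeGroup.mk L :=
  cayley_reads (h.map f)

theorem hom_cayley_edge {Γ : LGraph (Fin n)} (f : LGraph.Hom Γ (cayley n)) (e : Γ.E) :
    f.val (Γ.ini (Γ.bar e)) = f.val (Γ.ini e) * FreeGroup.mk [Γ.label e] :=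
  (Γ.reads_edge e).val f

/-- Connected folded graphs that map to the Cayley graph are subgraphs of it. -/
theorem hom_cayley_injective {Γ : LGraph (Fin n)} (hΓ : Γ.IsFolded) (hc : Γ.IsConn)
    (f : LGraph.Hom Γ (cayley n)) : Function.Injective f.val := by
  intro v w h
  obtain ⟨L, hL⟩ := hc v w
  have h1 := hL.val f
  have h2 : (FreeGroup.mk L : F n) = 1 := by
    rw [← h] at h1
    exact (mul_eq_left.1 h1.symm)
  -- The label of a path from `v` to `w` is trivial in the group. In a folded graph it can be
  -- reduced to the empty word, so the path ends where it starts.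
  have h3 := hL.reduce hΓ
  rw [← FreeGroup.toWord_mk, h2, FreeGroup.toWord_one] at h3
  exact h3

theorem mk_take_succ (L : List (Letter (Fin n))) (i : ℕ) (hi : i < L.length) :
    (FreeGroup.mk (L.take (i + 1)) : F n) = FreeGroup.mk (L.take i) * FreeGroup.mk [L[i]] := by
  rw [List.take_succ_eq_append_getElem hi, FreeGroup.mul_mk]

theorem mk_take_mul_mk_drop (L : List (Letter (Fin n))) (i : ℕ) :
    (FreeGroup.mk (L.take i) * FreeGroup.mk (L.drop i) : F n) = FreeGroup.mk L := by
  rw [FreeGroup.mul_mk, List.take_append_drop]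

/-- The development of a segment in the Cayley graph. -/
def segDev (L : List (Letter (Fin n))) : LGraph.Hom (seg L) (cayley n) :=
  toCayley (fun i : Fin (L.length + 1) => FreeGroup.mk (L.take i)) (by
    rintro ⟨i, b⟩
    have h := mk_take_succ L i.1 i.2
    cases b
    · simp only [seg, Bool.not_false, if_true, Bool.false_eq_true, if_false, Fin.val_castSucc,
        Fin.val_succ]
      rw [h, ← mk_singleton_inv]
      exact (mul_inv_cancel_right _ _).symm
    · simp only [seg, Bool.not_true, if_true, Bool.false_eq_true, if_false, Fin.val_castSucc,
        Fin.val_succ]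
      exact h)

@[simp] theorem segDev_zero (L : List (Letter (Fin n))) :
    (segDev L).val (0 : Fin (L.length + 1)) = (1 : F n) := by
  change FreeGroup.mk (L.take 0) = _
  simp [← FreeGroup.one_eq_mk]

theorem segDev_apply (L : List (Letter (Fin n))) (i : Fin (L.length + 1)) :
    (segDev L).val i = (FreeGroup.mk (L.take i) : F n) := rfl

theorem segDev_last (g : F n) : (segDev g.toWord).val (Fin.last _) = g := by
  change FreeGroup.mk (g.toWord.take g.toWord.length) = g
  simp [FreeGroup.mk_toWord]

theorem segDev_injective (g : F n) : Function.Injective (segDev g.toWord).val :=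
  hom_cayley_injective (wseg_isFolded g) (seg_isConn _) _

/-! ### Positions of one reduced word inside another. -/

theorem btw_iff_toWord_append (c h : F n) :
    Btw 1 c h ↔ h.toWord = c.toWord ++ (c⁻¹ * h).toWord := by
  constructor
  · intro hb
    -- The reduced word of a product is a sublist of the concatenation, so equality of lengths
    -- suffices.
    have h1 := FreeGroup.toWord_mul_sublist c (c⁻¹ * h)
    rw [mul_inv_cancel_left] at h1
    refine h1.eq_of_length ?_
    rw [List.length_append]
    simpa [Btw, tdist, FreeGroup.norm] using Eq.symm hb
  · intro he
    have := congrArg List.length he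
    rw [List.length_append] at this
    simpa [Btw, tdist, FreeGroup.norm] using Eq.symm this

theorem btw_one_mk_take (h : F n) (i : ℕ) : Btw 1 (FreeGroup.mk (h.toWord.take i)) h := by
  have h1 : FreeGroup.IsReduced (h.toWord.take i) :=
    FreeGroup.isReduced_toWord.infix (List.take_prefix _ _).isInfix
  have h2 : FreeGroup.IsReduced (h.toWord.drop i) :=
    FreeGroup.isReduced_toWord.infix (List.drop_suffix _ _).isInfix
  have e : (FreeGroup.mk (h.toWord.take i))⁻¹ * h = FreeGroup.mk (h.toWord.drop i) := by
    rw [inv_mul_eq_iff_eq_mul, mk_take_mul_mk_drop, FreeGroup.mk_toWord]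
  rw [btw_iff_toWord_append, e, FreeGroup.toWord_mk, FreeGroup.toWord_mk, h1.reduce_eq,
    h2.reduce_eq, List.take_append_drop]

theorem exists_segDev_eq {c h : F n} (hb : Btw 1 c h) :
    ∃ i, (segDev h.toWord).val i = c := by
  have h1 := (btw_iff_toWord_append c h).1 hb
  have h2 := congrArg List.length h1
  rw [List.length_append] at h2
  refine ⟨(⟨c.toWord.length, by omega⟩ : Fin (h.toWord.length + 1)), ?_⟩
  rw [segDev_apply]
  simp only
  conv_lhs => rw [h1]
  rw [List.take_left, FreeGroup.mk_toWord]

/-- The position of a segment in another one, as a vertex of the Cayley graph. -/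
def pos {g h : F n} (f : LGraph.Hom (wseg g) (wseg h)) : F n :=
  (segDev h.toWord).val (f.onV (0 : Fin (g.toWord.length + 1)))

/-- After development, a morphism of segments is the left translation by its position. -/
theorem segDev_hom {g h : F n} (f : LGraph.Hom (wseg g) (wseg h))
    (i : Fin (g.toWord.length + 1)) :
    (segDev h.toWord).val (f.onV i) = pos f * (segDev g.toWord).val i :=
  cayley_reads (seg_hom_reads ((segDev h.toWord).comp f) i)

theorem btw_pos {g h : F n} (f : LGraph.Hom (wseg g) (wseg h)) : Btw 1 (pos f) h :=
  btw_one_mk_take h _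

theorem btw_pos_mul {g h : F n} (f : LGraph.Hom (wseg g) (wseg h)) : Btw 1 (pos f * g) h := by
  have := segDev_hom f (Fin.last _)
  rw [segDev_last] at this
  rw [← this]
  exact btw_one_mk_take h _

theorem pos_injective {g h : F n} :
    Function.Injective (pos : LGraph.Hom (wseg g) (wseg h) → F n) :=
  fun _ _ e => seg_hom_ext (wseg_isFolded h) (segDev_injective h e)

/-- The segment of `h` is connected, so it has a path from `c` to `c * g`. The label of this path
represents `g`, and foldedness allows it to be replaced by the reduced word. -/
theorem exists_pos_eq {c g h : F n} (h1 : Btw 1 c h) (h2 : Btw 1 (c * g) h) :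
    ∃ f : LGraph.Hom (wseg g) (wseg h), pos f = c := by
  obtain ⟨i, hi⟩ := exists_segDev_eq h1
  obtain ⟨j, hj⟩ := exists_segDev_eq h2
  obtain ⟨L, hL⟩ := seg_isConn h.toWord i j
  have h3 := hL.val (segDev h.toWord)
  rw [hi, hj] at h3
  have h4 := hL.reduce (wseg_isFolded h)
  rw [← FreeGroup.toWord_mk, ← mul_left_cancel h3] at h4
  obtain ⟨f, hf, -⟩ := h4.exists_hom
  exact ⟨f, by rw [pos, hf, hi]⟩

end Cayley

/-! ### Developing the folded subdivisions -/

section Subdivision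

variable {n : ℕ} (φ : MulAut (F n)) {Γ Δ : LGraph (Fin n)}

theorem mk_img (l : Letter (Fin n)) : (FreeGroup.mk (img φ l) : F n) = φ (FreeGroup.mk [l]) :=
  FreeGroup.mk_toWord

/-- The map from the vertices of the subdivision to the free group. -/
def subdivDevV (f : LGraph.Hom Γ (cayley n)) : (subdiv φ Γ).V → F n :=
  Quot.lift (Sum.elim (fun v => φ (f.val v))
    (fun p => φ (f.val (Γ.ini p.1.1)) * FreeGroup.mk ((img φ (Γ.label p.1.1)).take p.1.2))) (by
    intro a b h
    cases h with
    | start e => simp [← FreeGroup.one_eq_mk]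
    | rev e i j h =>
      simp only [Sum.elim_inr]
      have h1 := hom_cayley_edge f e
      rw [h1, map_mul, mul_assoc]
      congr 1
      rw [Γ.label_bar, img_bar, ← mk_img, ← mk_take_mul_mk_drop (img φ (Γ.label e)) i]
      -- As `i + j` is the length of the path, the first `j` letters of the reversed path are the
      -- inverse of what follows position `i`.
      have h2 : (FreeGroup.invRev (img φ (Γ.label e))).take j =
          FreeGroup.invRev ((img φ (Γ.label e)).drop i) := by
        rw [← List.take_append_drop i (img φ (Γ.label e)), FreeGroup.invRev_append,
          List.take_append_of_le_length, List.take_of_length_le, List.take_append_drop]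
        all_goals simp; omega
      rw [h2, ← FreeGroup.inv_mk]
      group)

theorem subdiv_ini_bar (p : (subdiv φ Γ).E) :
    (subdiv φ Γ).ini ((subdiv φ Γ).bar p) =
      Quot.mk _ (.inr ⟨(p.1.1, p.1.2 + 1), p.2⟩) := by
  obtain ⟨⟨e, j⟩, h⟩ := p
  simp only at h
  exact (Quot.sound (SubRel.rev e (j + 1) ((img φ (Γ.label e)).length - 1 - j) (by omega))).symm

/-- The development of the folded subdivision. -/
def subdivDev (f : LGraph.Hom Γ (cayley n)) : LGraph.Hom (foldedSubdiv φ Γ) (cayley n) :=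
  LGraph.Hom.foldLift cayley_isFolded (toCayley (subdivDevV φ f) (by
    intro p
    rw [subdiv_ini_bar]
    obtain ⟨⟨e, j⟩, h⟩ := p
    simp only at h
    change φ (f.val (Γ.ini e)) * FreeGroup.mk ((img φ (Γ.label e)).take (j + 1)) =
      φ (f.val (Γ.ini e)) * FreeGroup.mk ((img φ (Γ.label e)).take j) * FreeGroup.mk [_]
    rw [mk_take_succ _ _ h, mul_assoc]
    rfl))

theorem subdivDev_foldedVertex (f : LGraph.Hom Γ (cayley n)) (v : Γ.V) :
    (subdivDev φ f).val (foldedVertex φ v) = φ (f.val v) := rfl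

/-- Naturality of the development: the functor turns translation by `c` into translation by `φ c`.
-/
theorem subdivDev_hom (f : LGraph.Hom Γ (cayley n)) (f' : LGraph.Hom Δ (cayley n))
    (h : LGraph.Hom Γ Δ) (c : F n) (hc : ∀ v, f'.val (h.onV v) = c * f.val v)
    (x : (foldedSubdiv φ Γ).V) :
    (subdivDev φ f').val ((h.foldedSubdiv φ).onV x) = φ c * (subdivDev φ f).val x := by
  rcases x with ⟨⟨v | ⟨⟨e, j⟩, hj⟩⟩⟩
  · change φ (f'.val (h.onV v)) = φ c * φ (f.val v)
    rw [hc, map_mul]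
  · change φ (f'.val (Δ.ini (h.onE e))) * FreeGroup.mk ((img φ (Δ.label (h.onE e))).take j) =
      φ c * (φ (f.val (Γ.ini e)) * FreeGroup.mk ((img φ (Γ.label e)).take j))
    rw [← h.map_ini, hc, map_mul, h.map_label, mul_assoc]

theorem subdiv_reads_take (e : Γ.E) (j : ℕ) (hj : j ≤ (img φ (Γ.label e)).length) :
    (subdiv φ Γ).Reads (Quot.mk _ (.inl (Γ.ini e))) ((img φ (Γ.label e)).take j)
      (Quot.mk _ (.inr ⟨(e, j), hj⟩)) := by
  induction j with
  | zero => exact (Quot.sound (SubRel.start e)).symm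
  | succ j ih =>
    rw [List.take_succ_eq_append_getElem hj]
    exact LGraph.reads_append.2 ⟨_, ih (Nat.le_of_succ_le hj), ⟨(e, j), hj⟩, rfl, rfl, subdiv_ini_bar φ _⟩

theorem subdiv_reads_edge (e : Γ.E) :
    (subdiv φ Γ).Reads (Quot.mk _ (.inl (Γ.ini e))) (img φ (Γ.label e))
      (Quot.mk _ (.inl (Γ.ini (Γ.bar e)))) := by
  have h := subdiv_reads_take φ e _ le_rfl
  rw [List.take_length] at h
  have h1 : (Quot.mk (SubRel φ Γ) (.inr ⟨(e, (img φ (Γ.label e)).length), le_rfl⟩)) =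
      Quot.mk _ (.inl (Γ.ini (Γ.bar e))) :=
    (Quot.sound (SubRel.rev e _ 0 (by omega))).trans (Quot.sound (SubRel.start (Γ.bar e)))
  rwa [h1] at h

theorem subdiv_reads {v w : Γ.V} {L : List (Letter (Fin n))} (h : Γ.Reads v L w) :
    (subdiv φ Γ).Reads (Quot.mk _ (.inl v)) (L.flatMap (img φ)) (Quot.mk _ (.inl w)) := by
  induction L generalizing v with
  | nil => exact congrArg _ (congrArg _ h)
  | cons l L ih =>
    obtain ⟨e, rfl, rfl, h3⟩ := h
    rw [List.flatMap_cons]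
    exact LGraph.reads_append.2 ⟨_, subdiv_reads_edge φ e, ih h3⟩

theorem mk_flatMap_img (L : List (Letter (Fin n))) :
    (FreeGroup.mk (L.flatMap (img φ)) : F n) = φ (FreeGroup.mk L) := by
  induction L with
  | nil => simp [← FreeGroup.one_eq_mk]
  | cons l L ih =>
    rw [List.flatMap_cons, ← FreeGroup.mul_mk, ih, mk_img, ← map_mul, FreeGroup.mul_mk]
    rfl

theorem subdiv_isConn (h : Γ.IsConn) : (subdiv φ Γ).IsConn := by
  have key : ∀ x : (subdiv φ Γ).V, ∃ v L, (subdiv φ Γ).Reads (Quot.mk _ (.inl v)) L x := by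
    rintro ⟨v | ⟨⟨e, j⟩, hj⟩⟩
    · exact ⟨v, [], rfl⟩
    · exact ⟨_, _, subdiv_reads_take φ e j hj⟩
  intro x y
  obtain ⟨v, L, hL⟩ := key x
  obtain ⟨w, L', hL'⟩ := key y
  obtain ⟨K, hK⟩ := h v w
  exact ⟨_, LGraph.reads_append.2 ⟨_, hL.symm, LGraph.reads_append.2 ⟨_, subdiv_reads φ hK, hL'⟩⟩⟩

theorem foldedSubdiv_isFolded : (foldedSubdiv φ Γ).IsFolded := LGraph.fold_isFolded _

theorem subdivDev_injective (h : Γ.IsConn) (f : LGraph.Hom Γ (cayley n)) :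
    Function.Injective (subdivDev φ f).val :=
  hom_cayley_injective (foldedSubdiv_isFolded φ) (subdiv_isConn φ h).fold _

/-- The subdivided segment reads the unreduced concatenation of the images of the letters; after
folding, the reduced word is read between the same vertices. -/
theorem exists_isIncl (v : F n) : ∃ j, IsIncl φ v j := by
  have h := (subdiv_reads φ (seg_hom_reads_last
    (⟨id, id, fun _ => rfl, fun _ => rfl, fun _ => rfl⟩ : LGraph.Hom (wseg v) (wseg v)))).map
      (subdiv φ (wseg v)).toFold
  have h' := h.reduce (foldedSubdiv_isFolded φ)
  rw [← FreeGroup.toWord_mk, mk_flatMap_img, FreeGroup.mk_toWord] at h'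
  obtain ⟨j, h1, h2⟩ := h'.exists_hom
  exact ⟨j, h1, h2⟩

theorem subdivDev_isIncl {v : F n} {j : LGraph.Hom (wseg (φ v)) (foldedSubdiv φ (wseg v))}
    (hj : IsIncl φ v j) (i : Fin ((φ v).toWord.length + 1)) :
    (subdivDev φ (segDev v.toWord)).val (j.onV i) = (segDev (φ v).toWord).val i := by
  have h : ((subdivDev φ (segDev v.toWord)).comp j).val i = _ :=
    cayley_reads (seg_hom_reads ((subdivDev φ (segDev v.toWord)).comp j) i)
  have h0 : ((subdivDev φ (segDev v.toWord)).comp j).val (0 : Fin ((φ v).toWord.length + 1)) =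
      (1 : F n) := by
    refine (congrArg (subdivDev φ (segDev v.toWord)).val hj.1).trans ?_
    refine (subdivDev_foldedVertex φ (segDev v.toWord) _).trans ?_
    rw [segDev_zero, map_one]
  refine h.trans ?_
  refine (congrArg (· * _) h0).trans ?_
  exact one_mul _

/-- Both composites map a segment to a folded graph, so they agree if they agree at the initial
vertex. That comparison can be made in the Cayley tree, into which the folded graph embeds. -/
theorem commutes_iff {u v w : F n} (h : LGraph.Hom (wseg v) (wseg w))
    (f : LGraph.Hom (wseg u) (wseg (φ v))) (f' : LGraph.Hom (wseg u) (wseg (φ w))) :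
    Commutes φ h f f' ↔ pos f' = φ (pos h) * pos f := by
  have key : ∀ {jv jw}, IsIncl φ v jv → IsIncl φ w jw →
      ((h.foldedSubdiv φ).comp (jv.comp f) = jw.comp f' ↔ pos f' = φ (pos h) * pos f) := by
    intro jv jw hv hw
    have e1 : (subdivDev φ (segDev w.toWord)).val
        (((h.foldedSubdiv φ).comp (jv.comp f)).onV (0 : Fin (u.toWord.length + 1))) =
        φ (pos h) * pos f := by
      change (subdivDev φ (segDev w.toWord)).val ((h.foldedSubdiv φ).onV (jv.onV (f.onV _))) = _
      rw [subdivDev_hom φ (segDev v.toWord) (segDev w.toWord) h (pos h) (segDev_hom h)]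
      exact congrArg (φ (pos h) * ·) (subdivDev_isIncl φ hv _)
    have e2 : (subdivDev φ (segDev w.toWord)).val
        ((jw.comp f').onV (0 : Fin (u.toWord.length + 1))) = pos f' :=
      subdivDev_isIncl φ hw _
    rw [← e1, ← e2]
    constructor
    · intro e; rw [e]
    · intro e
      exact seg_hom_ext (foldedSubdiv_isFolded φ)
        (subdivDev_injective φ (seg_isConn _) _ e.symm)
  constructor
  · rintro ⟨jv, jw, hv, hw, e⟩
    exact (key hv hw).1 e
  · intro e
    obtain ⟨jv, hv⟩ := exists_isIncl φ v
    obtain ⟨jw, hw⟩ := exists_isIncl φ w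
    exact ⟨jv, jw, hv, hw, (key hv hw).2 e⟩

end Subdivision

/-! ### Ideal preimages as ideal segments -/

section IdealPreimages

variable {n : ℕ} {φ : MulAut (F n)}

/-- A morphism from `v` to a word at position `c` is, after translation by `c⁻¹`, a geodesic
containing `[1, v]`. Conversely the geodesic `[p, q]` gives the word `p⁻¹ * q` with `v` at position
`p⁻¹`. -/
theorem isIdeal_iff {u v : F n} (hv : v ≠ 1) (f : LGraph.Hom (wseg u) (wseg (φ v))) :
    IsIdeal φ f ↔ IdealSeg φ (pos f) (pos f * u) 1 v := by
  constructor
  · intro hf p q hp hq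
    have hw : p⁻¹ * q ≠ 1 := by
      intro e
      obtain rfl := inv_mul_eq_one.1 e
      exact hv (hq.eq_of_eq.trans hp.eq_of_eq.symm)
    have h1 : Btw 1 p⁻¹ (p⁻¹ * q) := by
      rw [← btw_mul_left p⁻¹] at hp
      simpa using hp
    have h2 : Btw 1 (p⁻¹ * v) (p⁻¹ * q) := by
      rw [← btw_mul_left p⁻¹] at hq
      simpa using hq
    obtain ⟨h, hh⟩ := exists_pos_eq h1 h2
    obtain ⟨f', hf'⟩ := hf _ hw h
    rw [commutes_iff, hh] at hf'
    have h3 := btw_pos f'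
    have h4 := btw_pos_mul f'
    rw [hf', ← btw_mul_left (φ p)] at h3 h4
    simp only [map_mul, map_inv, mul_one, mul_assoc, mul_inv_cancel_left] at h3 h4
    exact ⟨h3, h4⟩
  · intro hf w _ h
    have h1 := btw_pos h
    have h2 := btw_pos_mul h
    rw [← btw_mul_left (pos h)⁻¹] at h1 h2
    simp only [mul_one, inv_mul_cancel, inv_mul_cancel_left] at h1 h2
    obtain ⟨h3, h4⟩ := hf _ _ h1 h2
    rw [← btw_mul_left (φ (pos h))] at h3 h4
    simp only [map_mul, map_inv, mul_inv_cancel, ← mul_assoc, one_mul] at h3 h4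
    obtain ⟨f', hf'⟩ := exists_pos_eq h3 h4
    exact ⟨f', (commutes_iff φ h f f').2 hf'⟩

/-- Morphisms between reduced segments are injective, so only the sizes matter. -/
theorem bijective_iff_norm_eq {v w : F n} (h : LGraph.Hom (wseg v) (wseg w)) :
    (Function.Bijective h.onV ∧ Function.Bijective h.onE) ↔ v.norm = w.norm := by
  have hV : Function.Injective h.onV := by
    intro i j e
    have h1 := segDev_hom h i
    have h2 := segDev_hom h j
    rw [e, h2] at h1
    exact segDev_injective v (mul_left_cancel h1).symm
  have hE : Function.Injective h.onE := by
    intro e e' he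
    refine wseg_isFolded v e e' (hV ?_) ?_
    · rw [h.map_ini, h.map_ini, he]
    · rw [← h.map_label, ← h.map_label, he]
  constructor
  · rintro ⟨h1, -⟩
    have h2 : Fintype.card (Fin (v.toWord.length + 1)) = Fintype.card (Fin (w.toWord.length + 1)) :=
      Fintype.card_of_bijective h1
    simpa [FreeGroup.norm] using h2
  · intro e
    simp only [FreeGroup.norm] at e
    constructor
    · exact (Fintype.bijective_iff_injective_and_card (α := Fin (v.toWord.length + 1))
        (β := Fin (w.toWord.length + 1)) h.onV).2 ⟨hV, by simp [e]⟩
    · exact (Fintype.bijective_iff_injective_and_card (α := Fin v.toWord.length × Bool)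
        (β := Fin w.toWord.length × Bool) h.onE).2 ⟨hE, by simp [e]⟩

/-- A subsegment `[c, d]` of `[1, v]` is the base word `c⁻¹ * d` placed at `c`; equivariance moves
its ideal condition to `[1, c⁻¹ * d]`. -/
theorem isMinimalIdeal_iff {u v : F n} (hv : v ≠ 1) (f : LGraph.Hom (wseg u) (wseg (φ v))) :
    IsMinimalIdeal φ f ↔ MinIdealSeg φ (pos f) (pos f * u) 1 v := by
  rw [IsMinimalIdeal, MinIdealSeg, isIdeal_iff hv]
  simp only [bijective_iff_norm_eq, commutes_iff, tdist_one_left]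
  constructor
  · rintro ⟨h1, h2⟩
    refine ⟨hv.symm, h1, fun c d hne hc hd hi => ?_⟩
    have hne' : c⁻¹ * d ≠ 1 := by rwa [Ne, inv_mul_eq_one]
    obtain ⟨h, hh⟩ := exists_pos_eq (g := c⁻¹ * d) hc (by simpa using hd)
    obtain ⟨h3, h4⟩ := hi c d (by simp) (by simp)
    rw [← btw_mul_left (φ c)⁻¹] at h3 h4
    obtain ⟨f', hf'⟩ := exists_pos_eq (c := (φ c)⁻¹ * pos f) (g := u) (h := φ (c⁻¹ * d))
      (by simpa using h3) (by simpa [mul_assoc] using h4)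
    refine h2 _ hne' f' h ?_ ?_
    · rw [isIdeal_iff hne', hf']
      have := hi.mul_left c⁻¹
      simpa [mul_assoc] using this
    · rw [hf', hh, mul_inv_cancel_left]
  · rintro ⟨-, h1, h2⟩
    refine ⟨h1, fun v' hv' f' h hf' hc => ?_⟩
    rw [isIdeal_iff hv'] at hf'
    have := h2 (pos h) (pos h * v') (fun e => hv' (by simpa using e)) (btw_pos h) (btw_pos_mul h) (by
      have := hf'.mul_left (pos h)
      rwa [mul_one, ← mul_assoc, ← hc] at this)
    simpa using this

/-! ### The multiset of base words as a finite set of segments. -/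

theorem UWord.rep_ne_one (u : UWord n) : u.rep ≠ 1 := (Quotient.out u).2

theorem UWord.mk_rep (u : UWord n) : UWord.mk ⟨u.rep, u.rep_ne_one⟩ = u := Quotient.out_eq u

theorem UWord.mk_eq_mk {g h : F n} (hg : g ≠ 1) (hh : h ≠ 1) :
    UWord.mk ⟨g, hg⟩ = UWord.mk ⟨h, hh⟩ ↔ g = h ∨ g = h⁻¹ :=
  Quotient.eq (r := uSetoid n)

theorem UWord.rep_mk (g : F n) (hg : g ≠ 1) :
    (UWord.mk ⟨g, hg⟩).rep = g ∨ (UWord.mk ⟨g, hg⟩).rep = g⁻¹ :=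
  (UWord.mk_eq_mk (UWord.rep_ne_one _) hg).1 (UWord.mk_rep _)

theorem UWord.length_eq_norm_rep (u : UWord n) : u.length = u.rep.norm := by
  conv_lhs => rw [← UWord.mk_rep u]
  rfl

variable (φ) in
/-- The minimal ideal segments for `[1, u]`, given by their u-words and their initial vertices. -/
def idealPairs (u : UWord n) : Set (UWord n × F n) :=
  {p | MinIdealSeg φ 1 u.rep p.2 (p.2 * p.1.rep)}

/-- An ideal preimage has its base fixed at `[1, v]` and its target moving. Translating the target
to `[1, u]` makes the initial vertex of the base move instead. -/
theorem bijOn_minimalIdeals (u : UWord n) :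
    Set.BijOn (fun p => (p.1, φ.symm (pos p.2)⁻¹)) (minimalIdeals φ u) (idealPairs φ u) := by
  refine ⟨?_, ?_, ?_⟩
  · rintro ⟨v, f⟩ h
    have h1 := (isMinimalIdeal_iff v.rep_ne_one f).1 h
    have h2 := h1.mul_left (φ.symm (pos f)⁻¹)
    simpa [idealPairs] using h2
  · rintro ⟨v, f⟩ - ⟨v', f'⟩ - e
    obtain ⟨rfl, e2⟩ := Prod.mk.inj e
    have e3 := φ.symm.injective e2
    exact congrArg (Sigma.mk v) (pos_injective (inv_injective e3))
  · rintro ⟨v, g⟩ h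
    have h1 : MinIdealSeg φ 1 u.rep g (g * v.rep) := h
    have h2 := h1.mul_left g⁻¹
    simp only [inv_mul_cancel, inv_mul_cancel_left, mul_one] at h2
    obtain ⟨h3, h4⟩ := h2.2.1 1 v.rep (by simp) (by simp)
    rw [map_one] at h3 h4
    obtain ⟨f, hf⟩ := exists_pos_eq h3 h4
    refine ⟨⟨v, f⟩, (isMinimalIdeal_iff v.rep_ne_one f).2 (by rwa [hf]), ?_⟩
    simp [hf]

theorem finite_idealPairs (u : UWord n) : (idealPairs φ u).Finite := by
  have h := finite_minIdealSeg φ u.rep_ne_one.symm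
  refine Set.Finite.of_injOn (f := fun p : UWord n × F n => (p.2, p.2 * p.1.rep)) ?_ ?_ h
  · intro p hp
    exact hp
  · rintro ⟨v, g⟩ - ⟨v', g'⟩ - e
    obtain ⟨rfl, e2⟩ := Prod.mk.inj e
    have e3 : v.rep = v'.rep := mul_left_cancel e2
    have : v = v' := by
      rw [← v.mk_rep, ← v'.mk_rep, UWord.mk_eq_mk]
      exact .inl e3
    rw [this]

theorem finite_minimalIdeals (φ : MulAut (F n)) (u : UWord n) : (minimalIdeals φ u).Finite :=
  (bijOn_minimalIdeals u).finite_iff_finite.2 (finite_idealPairs u)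

theorem mem_S_iff {u v : UWord n} :
    v ∈ S φ u ↔ ∃ g, MinIdealSeg φ 1 u.rep g (g * v.rep) := by
  rw [S, dif_pos (finite_minimalIdeals φ u)]
  simp only [Multiset.mem_map, Finset.mem_val, Set.Finite.mem_toFinset]
  constructor
  · rintro ⟨p, hp, rfl⟩
    exact ⟨_, (bijOn_minimalIdeals u).mapsTo hp⟩
  · rintro ⟨g, hg⟩
    obtain ⟨p, hp, e⟩ := (bijOn_minimalIdeals u).surjOn (show (v, g) ∈ idealPairs φ u from hg)
    exact ⟨p, hp, congrArg Prod.fst e⟩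

theorem sum_map_S {A : Type*} [AddCommMonoid A] (u : UWord n) (f : UWord n → A) :
    ((S φ u).map f).sum = ∑ p ∈ (finite_idealPairs (φ := φ) u).toFinset, f p.1 := by
  rw [S, dif_pos (finite_minimalIdeals φ u), Multiset.map_map]
  change ∑ p ∈ (finite_minimalIdeals φ u).toFinset, f p.1 = _
  refine Finset.sum_bij (fun p _ => (p.1, φ.symm (pos p.2)⁻¹)) ?_ ?_ ?_ ?_
  · intro p hp
    rw [Set.Finite.mem_toFinset] at hp ⊢
    exact (bijOn_minimalIdeals u).mapsTo hp
  · intro p hp q hq e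
    rw [Set.Finite.mem_toFinset] at hp hq
    exact (bijOn_minimalIdeals u).injOn hp hq e
  · intro p hp
    rw [Set.Finite.mem_toFinset] at hp
    obtain ⟨q, hq, e⟩ := (bijOn_minimalIdeals u).surjOn hp
    exact ⟨q, (Set.Finite.mem_toFinset _).2 hq, e⟩
  · intro p _
    rfl

end IdealPreimages

/-! ### Axes -/

section Axis

variable {n : ℕ}

/-- The vertex `c` lies on the axis of `w`. -/
def Ax (w c : F n) : Prop := ∀ p, ∃ N₀, ∀ N : ℕ, N₀ ≤ N → Btw ((w ^ N)⁻¹ * p) c (w ^ N * p)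

theorem ax_conj (h w c : F n) : Ax (h * w * h⁻¹) (h * c) ↔ Ax w c := by
  have key : ∀ N p, Btw (((h * w * h⁻¹) ^ N)⁻¹ * p) (h * c) ((h * w * h⁻¹) ^ N * p) ↔
      Btw ((w ^ N)⁻¹ * (h⁻¹ * p)) c (w ^ N * (h⁻¹ * p)) := by
    intro N p
    rw [conj_pow, ← btw_mul_left h ((w ^ N)⁻¹ * (h⁻¹ * p)) c]
    simp only [mul_inv_rev, inv_inv, mul_assoc]
  constructor
  · intro hA p
    obtain ⟨N₀, hN⟩ := hA (h * p)
    refine ⟨N₀, fun N hle => ?_⟩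
    have := (key N _).1 (hN N hle)
    rwa [inv_mul_cancel_left] at this
  · intro hA p
    obtain ⟨N₀, hN⟩ := hA (h⁻¹ * p)
    exact ⟨N₀, fun N hle => (key N p).2 (hN N hle)⟩

theorem ax_inv (w c : F n) : Ax w⁻¹ c ↔ Ax w c := by
  have key : ∀ N p, Btw ((w⁻¹ ^ N)⁻¹ * p) c (w⁻¹ ^ N * p) ↔ Btw ((w ^ N)⁻¹ * p) c (w ^ N * p) := by
    intro N p
    rw [inv_pow, inv_inv, btw_comm]
  simp only [Ax, key]

theorem ax_zpow_mul (w c : F n) (k : ℤ) : Ax w (w ^ k * c) ↔ Ax w c := by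
  have := ax_conj (w ^ k) w c
  rwa [show w ^ k * w * (w ^ k)⁻¹ = w by group] at this

theorem Ax.convex {w x y m : F n} (hx : Ax w x) (hy : Ax w y) (hm : Btw x m y) : Ax w m := by
  intro p
  obtain ⟨N₁, h1⟩ := hx p
  obtain ⟨N₂, h2⟩ := hy p
  refine ⟨max N₁ N₂, fun N hN => ?_⟩
  exact (h1 N (le_trans (le_max_left _ _) hN)).convex (h2 N (le_trans (le_max_right _ _) hN)) hm

/-- The group is torsion free, so the translates by powers are distinct, and a ball contains
finitely many of them. -/
theorem exists_pow_far {w : F n} (hw : w ≠ 1) (p c : F n) (D : ℕ) :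
    ∃ N₀, ∀ N : ℕ, N₀ ≤ N → D < tdist (w ^ N * p) c ∧ D < tdist ((w ^ N)⁻¹ * p) c := by
  have key : ∀ x : F n, x ≠ 1 → ∃ N₀, ∀ N : ℕ, N₀ ≤ N → D < tdist (x ^ N * p) c := by
    intro x hx
    have hinj : Function.Injective fun N : ℕ => x ^ N * p := fun a b e => by
      have h1 : x ^ a = x ^ b := mul_right_cancel e
      have h2 : x ^ ((a : ℤ) - b) = 1 := by
        rw [zpow_sub, zpow_natCast, zpow_natCast, h1, mul_inv_cancel]
      have h3 := (IsMulTorsionFree.zpow_eq_one_iff_right hx).1 h2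
      omega
    have hfin := (finite_ball c D).preimage hinj.injOn
    obtain ⟨B, hB⟩ := hfin.bddAbove
    refine ⟨B + 1, fun N hN => ?_⟩
    by_contra hlt
    have : N ≤ B := hB (show tdist c (x ^ N * p) ≤ D by rw [tdist_comm]; omega)
    omega
  obtain ⟨N₁, h1⟩ := key w hw
  obtain ⟨N₂, h2⟩ := key w⁻¹ (by simpa using hw)
  refine ⟨max N₁ N₂, fun N hN => ⟨h1 N (le_trans (le_max_left _ _) hN), ?_⟩⟩
  rw [← inv_pow]
  exact h2 N (le_trans (le_max_right _ _) hN)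

theorem Btw.of_near {p c q q' : F n} (h : Btw p c q) (hd : tdist q q' < tdist q c) :
    Btw p c q' := by
  refine (h.split q').resolve_right fun h1 => ?_
  have := tdist_comm q q'
  have := tdist_comm q c
  unfold Btw at h1
  omega

/-- It suffices to test membership in an axis with one base point. -/
theorem ax_of_base {w : F n} (hw : w ≠ 1) {c p : F n}
    (h : ∃ N₀, ∀ N : ℕ, N₀ ≤ N → Btw ((w ^ N)⁻¹ * p) c (w ^ N * p)) : Ax w c := by
  intro q
  obtain ⟨N₁, h1⟩ := h
  obtain ⟨N₂, h2⟩ := exists_pow_far hw p c (tdist p q)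
  refine ⟨max N₁ N₂, fun N hN => ?_⟩
  have h3 := h1 N (le_trans (le_max_left _ _) hN)
  have h4 := h2 N (le_trans (le_max_right _ _) hN)
  refine ((h3.of_near (q' := w ^ N * q) ?_).symm.of_near (q' := (w ^ N)⁻¹ * q) ?_).symm
  · rw [tdist_mul_left]; exact h4.1
  · rw [tdist_mul_left]; exact h4.2

/-- This reduces questions on an axis, in particular the uniqueness of minimal ideal segments, to a
geodesic. -/
theorem exists_common_segment {w a b c d : F n} (ha : Ax w a) (hb : Ax w b) (hc : Ax w c)
    (hd : Ax w d) : ∃ p q, Btw p a q ∧ Btw p b q ∧ Btw p c q ∧ Btw p d q := by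
  obtain ⟨N₁, h1⟩ := ha 1
  obtain ⟨N₂, h2⟩ := hb 1
  obtain ⟨N₃, h3⟩ := hc 1
  obtain ⟨N₄, h4⟩ := hd 1
  let N := max (max N₁ N₂) (max N₃ N₄)
  exact ⟨_, _, h1 N (by simp [N]), h2 N (by simp [N]), h3 N (by simp [N]), h4 N (by simp [N])⟩

variable {φ : MulAut (F n)}

/-- Membership in an axis is tested with all base points, so the base point `φ.symm p` for `w`
serves the base point `p` for `φ w`. -/
theorem IdealSeg.ax {y z a b w : F n} (h : IdealSeg φ y z a b) (ha : Ax w a) (hb : Ax w b) :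
    Ax (φ w) y ∧ Ax (φ w) z := by
  have key : ∀ p, ∃ N₀, ∀ N : ℕ, N₀ ≤ N → Btw ((φ w ^ N)⁻¹ * p) y (φ w ^ N * p) ∧
      Btw ((φ w ^ N)⁻¹ * p) z (φ w ^ N * p) := by
    intro p
    obtain ⟨N₁, h1⟩ := ha (φ.symm p)
    obtain ⟨N₂, h2⟩ := hb (φ.symm p)
    refine ⟨max N₁ N₂, fun N hN => ?_⟩
    have := h _ _ (h1 N (le_trans (le_max_left _ _) hN)) (h2 N (le_trans (le_max_right _ _) hN))
    simpa using this
  exact ⟨fun p => (key p).imp fun _ h N hN => (h N hN).1,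
    fun p => (key p).imp fun _ h N hN => (h N hN).2⟩

/-- If the axis of `φ w` contains `[y, z]` then the axis of `w` contains a minimal ideal segment
for `[y, z]`. -/
theorem exists_minIdealSeg_of_ax {y z w p : F n} (hw : w ≠ 1) (hyz : y ≠ z) (hp : Ax w p)
    (hy : Ax (φ w) y) (hz : Ax (φ w) z) :
    ∃ a b, MinIdealSeg φ y z a b ∧ Ax w a ∧ Ax w b := by
  obtain ⟨C, -, hC⟩ := exists_idealSeg_of_far φ
  have hw' : φ w ≠ 1 := by simpa using hw
  obtain ⟨N₁, h1⟩ := hy (φ p)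
  obtain ⟨N₂, h2⟩ := hz (φ p)
  obtain ⟨N₃, h3⟩ := exists_pow_far hw' (φ p) y C
  obtain ⟨N₄, h4⟩ := exists_pow_far hw' (φ p) z C
  -- For this `N` the geodesic between the images of the translates of `p` contains `y` and `z`,
  -- both farther than `C` from its ends.
  let N := max (max (max N₁ N₂) (max N₃ N₄)) 1
  have g1 := h1 N (by simp [N])
  have g2 := h2 N (by simp [N])
  have g3 := h3 N (by simp [N])
  have g4 := h4 N (by simp [N])
  have hN1 : 1 ≤ N := by simp [N]
  have e1 : (φ w ^ N)⁻¹ * φ p = φ ((w ^ N)⁻¹ * p) := by simp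
  have e2 : φ w ^ N * φ p = φ (w ^ N * p) := by simp
  rw [e1, e2] at g1 g2 g3 g4
  have hi := hC y z _ _ hyz g1 g2 g3.2 g4.2 g3.1 g4.1
  have hne : (w ^ N)⁻¹ * p ≠ w ^ N * p := by
    intro e
    rw [e] at g1 g2
    exact hyz (g1.eq_of_eq.trans g2.eq_of_eq.symm)
  obtain ⟨a, b, ha, hb, hm⟩ := hi.exists_min hne
  have hA1 : Ax w ((w ^ N)⁻¹ * p) := by
    have := (ax_zpow_mul w p (-N)).2 hp
    rwa [zpow_neg, zpow_natCast] at this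
  have hA2 : Ax w (w ^ N * p) := by
    have := (ax_zpow_mul w p N).2 hp
    rwa [zpow_natCast] at this
  exact ⟨a, b, hm, hA1.convex hA2 ha, hA1.convex hA2 hb⟩

end Axis

/-! ### Circles -/

section Circle

theorem cyc_reads_take {X : Type} (L : List (Letter X)) (i : ℕ) (hi : i < L.length) :
    (cyc L).Reads (⟨0, Nat.zero_lt_of_lt hi⟩ : Fin L.length) (L.take i)
      (⟨i, hi⟩ : Fin L.length) := by
  induction i with
  | zero => exact rfl
  | succ i ih =>
    rw [List.take_succ_eq_append_getElem (by omega : i < L.length)]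
    refine LGraph.reads_append.2
      ⟨_, ih (by omega), ((⟨i, by omega⟩, true) : Fin L.length × Bool), ?_, ?_, ?_⟩
    · simp [cyc]
    · simp [cyc]
    · simp [cyc, LGraph.Reads, Nat.mod_eq_of_lt hi]

theorem cyc_reads_all {X : Type} (L : List (Letter X)) (h : 0 < L.length) :
    (cyc L).Reads (⟨0, h⟩ : Fin L.length) L (⟨0, h⟩ : Fin L.length) := by
  have h1 := cyc_reads_take L (L.length - 1) (by omega)
  have h2 : L = L.take (L.length - 1) ++ [L[L.length - 1]] := by
    rw [← List.take_succ_eq_append_getElem, Nat.sub_add_cancel h, List.take_length]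
  have h3 : (cyc L).Reads (⟨L.length - 1, by omega⟩ : Fin L.length) [L[L.length - 1]]
      (⟨0, h⟩ : Fin L.length) := by
    refine ⟨((⟨L.length - 1, by omega⟩, true) : Fin L.length × Bool), ?_, ?_, ?_⟩
    · simp [cyc]
    · simp [cyc]
    · simp [cyc, LGraph.Reads, Nat.sub_add_cancel h]
  have := LGraph.reads_append.2 ⟨_, h1, h3⟩
  rwa [← h2] at this

theorem cyc_isFolded {X : Type} {L : List (Letter X)} (hL : FreeGroup.IsCyclicallyReduced L) :
    (cyc L).IsFolded := by
  have key : ∀ (i j : Fin L.length), (i : ℕ) = (j + 1) % L.length →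
      L.get i ≠ Letter.bar (L.get j) := by
    intro i j hij he
    rcases Nat.lt_or_ge (j + 1) L.length with hlt | hge
    · rw [Nat.mod_eq_of_lt hlt] at hij
      have h2 := List.isChain_iff_getElem.1 hL.1 j.1 (by omega)
      have h3 : L.get i = L[j.1 + 1] := by simp [hij]
      rw [h3] at he
      rw [he] at h2
      simp [Letter.bar] at h2
    -- At the closing vertex the last letter meets the first one, and cyclic reducedness is needed.
    · have hj : (j : ℕ) + 1 = L.length := by omega
      rw [hj, Nat.mod_self] at hij
      have h1 : L.get j ∈ L.getLast? := by
        rw [List.getLast?_eq_getElem?, ← hj]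
        simp
      have h2 : L.get i ∈ L.head? := by
        rw [List.head?_eq_getElem?, ← hij]
        simp
      have h3 := hL.2 _ h1 _ h2
      rw [he] at h3
      simp [Letter.bar] at h3
  have key2 : ∀ (i j : Fin L.length), ((i : ℕ) + 1) % L.length = (j + 1) % L.length → i = j := by
    intro i j h
    apply Fin.ext
    rcases Nat.lt_or_ge (i + 1) L.length with h1 | h1 <;>
    rcases Nat.lt_or_ge (j + 1) L.length with h2 | h2
    · rw [Nat.mod_eq_of_lt h1, Nat.mod_eq_of_lt h2] at h
      omega
    · rw [Nat.mod_eq_of_lt h1, show (j : ℕ) + 1 = L.length by omega, Nat.mod_self] at h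
      omega
    · rw [Nat.mod_eq_of_lt h2, show (i : ℕ) + 1 = L.length by omega, Nat.mod_self] at h
      omega
    · omega
  rintro ⟨i, b⟩ ⟨j, c⟩ h1 h2
  cases b <;> cases c <;> simp only [cyc, if_true, if_false, Bool.false_eq_true] at h1 h2
  · rw [key2 i j (congrArg Fin.val h1)]
  · exact absurd h2.symm (key j i (congrArg Fin.val h1).symm)
  · exact absurd h2 (key i j (congrArg Fin.val h1))
  · rw [h1]

variable {n : ℕ}

theorem toWord_pow_of_isCyclicallyReduced {L : List (Letter (Fin n))}
    (hL : FreeGroup.IsCyclicallyReduced L) (N : ℕ) :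
    ((FreeGroup.mk L : F n) ^ N).toWord = (List.replicate N L).flatten := by
  rw [FreeGroup.pow_mk, FreeGroup.toWord_mk, (hL.flatten_replicate N).isReduced.reduce_eq]

theorem norm_pow_of_isCyclicallyReduced {L : List (Letter (Fin n))}
    (hL : FreeGroup.IsCyclicallyReduced L) (N : ℕ) :
    ((FreeGroup.mk L : F n) ^ N).norm = N * L.length := by
  rw [FreeGroup.norm, toWord_pow_of_isCyclicallyReduced hL]
  simp

theorem norm_pow_mul_take {L : List (Letter (Fin n))}
    (hL : FreeGroup.IsCyclicallyReduced L) (N i : ℕ) (hi : i ≤ L.length) :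
    ((FreeGroup.mk L : F n) ^ N * FreeGroup.mk (L.take i)).norm = N * L.length + i := by
  rw [FreeGroup.pow_mk, FreeGroup.mul_mk, FreeGroup.norm, FreeGroup.toWord_mk]
  have h1 := (hL.flatten_replicate (N + 1)).isReduced
  rw [List.replicate_succ', List.flatten_concat] at h1
  have h2 : FreeGroup.IsReduced ((List.replicate N L).flatten ++ L.take i) := by
    refine h1.infix (List.IsPrefix.isInfix ?_)
    rw [List.prefix_append_right_inj]
    exact List.take_prefix _ _
  rw [h2.reduce_eq]
  simp [hi]

theorem mk_take_flatten_replicate (L : List (Letter (Fin n))) (hL : 0 < L.length) (M m : ℕ)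
    (hm : m ≤ M * L.length) : ∃ q : ℕ, ∃ r < L.length,
      (FreeGroup.mk ((List.replicate M L).flatten.take m) : F n) =
        FreeGroup.mk L ^ q * FreeGroup.mk (L.take r) := by
  induction M generalizing m with
  | zero => exact ⟨0, 0, hL, by simp [← FreeGroup.one_eq_mk]⟩
  | succ M ih =>
    rw [List.replicate_succ, List.flatten_cons]
    rcases Nat.lt_or_ge m L.length with h | h
    · exact ⟨0, m, h, by rw [List.take_append_of_le_length h.le]; simp⟩
    · obtain ⟨q, r, hr, e⟩ := ih (m - L.length) (by rw [Nat.succ_mul] at hm; omega)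
      refine ⟨q + 1, r, hr, ?_⟩
      rw [List.take_append, List.take_of_length_le h, ← FreeGroup.mul_mk, e, pow_succ', mul_assoc]

theorem mk_ne_one_of_isReduced {L : List (Letter (Fin n))} (hL : FreeGroup.IsReduced L)
    (h : 0 < L.length) : (FreeGroup.mk L : F n) ≠ 1 := by
  intro e
  have := congrArg FreeGroup.norm e
  rw [FreeGroup.norm, FreeGroup.toWord_mk, hL.reduce_eq] at this
  simp at this
  simp [this] at h

/-- Powers of a cyclically reduced word are reduced, so the geodesic from $w^{-N}$ to $w^N$ spells
the word `2 * N` times; its vertices are powers of $w$ followed by prefixes. -/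
theorem ax_mk_iff {L : List (Letter (Fin n))} (hL : FreeGroup.IsCyclicallyReduced L)
    (h0 : 0 < L.length) (c : F n) :
    Ax (FreeGroup.mk L) c ↔
      ∃ k : ℤ, ∃ i < L.length, c = FreeGroup.mk L ^ k * FreeGroup.mk (L.take i) := by
  constructor
  · intro h
    obtain ⟨N, hN⟩ := h 1
    have h1 := hN N le_rfl
    rw [← btw_mul_left (FreeGroup.mk L ^ N)] at h1
    simp only [mul_one, mul_inv_cancel, ← pow_add] at h1
    obtain ⟨⟨i, h3⟩, hi⟩ := exists_segDev_eq h1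
    have h2 : FreeGroup.mk (((FreeGroup.mk L : F n) ^ (N + N)).toWord.take i) =
        FreeGroup.mk L ^ N * c := hi
    rw [toWord_pow_of_isCyclicallyReduced hL] at h2
    have h4 := norm_pow_of_isCyclicallyReduced hL (N + N)
    rw [FreeGroup.norm] at h4
    obtain ⟨q, r, hr, e⟩ := mk_take_flatten_replicate L h0 (N + N) i (by omega)
    refine ⟨-(N : ℤ) + q, r, hr, ?_⟩
    rw [zpow_add, zpow_neg, zpow_natCast, zpow_natCast, mul_assoc, ← e, h2, inv_mul_cancel_left]
  · rintro ⟨k, i, hi, rfl⟩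
    rw [ax_zpow_mul]
    refine ax_of_base (p := 1) (mk_ne_one_of_isReduced hL.1 h0) ⟨1, fun N hN => ?_⟩
    have hw : (FreeGroup.mk L : F n).toWord = L := by
      rw [FreeGroup.toWord_mk, hL.1.reduce_eq]
    have h1 := btw_one_mk_take (FreeGroup.mk L) i
    rw [hw] at h1
    obtain ⟨M, rfl⟩ := Nat.exists_eq_add_of_le hN
    have h2 : Btw 1 (FreeGroup.mk L) ((FreeGroup.mk L : F n) ^ (1 + M)) := by
      have a1 := norm_pow_of_isCyclicallyReduced hL (1 + M)
      have a2 := norm_pow_of_isCyclicallyReduced hL M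
      have a3 := norm_pow_of_isCyclicallyReduced hL 1
      rw [pow_one] at a3
      rw [Btw, tdist_one_left, tdist_one_left, tdist, a1, a3, pow_add, pow_one,
        inv_mul_cancel_left, a2]
      ring
    have h3 : Btw ((FreeGroup.mk L : F n) ^ (1 + M))⁻¹ 1 ((FreeGroup.mk L : F n) ^ (1 + M)) := by
      have a1 := norm_pow_of_isCyclicallyReduced hL (1 + M)
      have a2 := norm_pow_of_isCyclicallyReduced hL ((1 + M) + (1 + M))
      rw [Btw, tdist_one_left, tdist, tdist, inv_inv, mul_one, ← pow_add, a1, a2]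
      ring
    rw [mul_one, mul_one]
    exact (h3.trans_right (h2.trans_left h1).1).1

theorem mk_take_eq_of_zpow {L : List (Letter (Fin n))} (hL : FreeGroup.IsCyclicallyReduced L)
    {i j : ℕ} (hi : i < L.length) (hj : j < L.length) {k : ℤ}
    (h : (FreeGroup.mk (L.take i) : F n) = FreeGroup.mk L ^ k * FreeGroup.mk (L.take j)) :
    i = j := by
  have key : ∀ {i j : ℕ}, i < L.length → j < L.length → ∀ m : ℕ,
      (FreeGroup.mk (L.take i) : F n) = FreeGroup.mk L ^ m * FreeGroup.mk (L.take j) → i = j := by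
    intro i j hi hj m h
    have h1 := norm_pow_mul_take hL 0 i hi.le
    have h2 := norm_pow_mul_take hL m j hj.le
    rw [pow_zero, one_mul, h, h2] at h1
    rcases m with _ | m
    · omega
    · rw [Nat.succ_mul] at h1
      omega
  obtain ⟨m, rfl | rfl⟩ := Int.eq_nat_or_neg k
  · exact key hi hj m (by rwa [zpow_natCast] at h)
  · refine (key hj hi m ?_).symm
    rw [h, zpow_neg, zpow_natCast, mul_inv_cancel_left]

end Circle

/-! ### Counting occurrences on axes -/

section Counting

variable {n : ℕ}

/-- The initial vertices of the segments labeled by `g` on the axis of `w`. -/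
abbrev AxSeg (w g : F n) : Type := {c : F n // Ax w c ∧ Ax w (c * g)}

/-- Equality up to translation along the axis. -/
def occSetoid (w g : F n) : Setoid (AxSeg w g) where
  r := fun c d => ∃ k : ℤ, d.1 = w ^ k * c.1
  iseqv := by
    refine ⟨fun _ => ⟨0, by simp⟩, ?_, ?_⟩
    · rintro c d ⟨k, h⟩
      exact ⟨-k, by rw [h, zpow_neg, inv_mul_cancel_left]⟩
    · rintro c d e ⟨k, h⟩ ⟨l, h'⟩
      exact ⟨l + k, by rw [h', h, zpow_add, mul_assoc]⟩

/-- The occurrences of `g` along the axis of `w` modulo translation. -/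
def Occ (w g : F n) : Type := Quotient (occSetoid w g)

theorem occ_conj (h w g : F n) : Nonempty (Occ w g ≃ Occ (h * w * h⁻¹) g) := by
  refine ⟨Quotient.congr (Equiv.subtypeEquiv (Equiv.mulLeft h) fun c => ?_) ?_⟩
  · rw [Equiv.coe_mulLeft, ax_conj, mul_assoc h c g, ax_conj]
  · rintro ⟨c, hc⟩ ⟨d, hd⟩
    refine exists_congr fun k => ?_
    simp only [Equiv.subtypeEquiv_apply, Equiv.coe_mulLeft, conj_zpow]
    simp only [mul_assoc, mul_right_inj, inv_mul_cancel_left]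

theorem occ_inv_left (w g : F n) : Nonempty (Occ w g ≃ Occ w⁻¹ g) := by
  refine ⟨Quotient.congr (Equiv.subtypeEquiv (Equiv.refl _) fun c => ?_) ?_⟩
  · simp only [Equiv.refl_apply, ax_inv]
  · rintro ⟨c, hc⟩ ⟨d, hd⟩
    constructor
    · rintro ⟨k, hk⟩
      exact ⟨-k, by rw [inv_zpow, zpow_neg, inv_inv]; exact hk⟩
    · rintro ⟨k, hk⟩
      rw [inv_zpow, ← zpow_neg] at hk
      exact ⟨-k, hk⟩

theorem occ_inv_right (w g : F n) : Nonempty (Occ w g ≃ Occ w g⁻¹) := by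
  refine ⟨Quotient.congr (Equiv.subtypeEquiv (Equiv.mulRight g) fun c => ?_) ?_⟩
  · simp only [Equiv.coe_mulRight, mul_inv_cancel_right, and_comm]
  · rintro ⟨c, hc⟩ ⟨d, hd⟩
    refine exists_congr fun k => ?_
    simp only [Equiv.subtypeEquiv_apply, Equiv.coe_mulRight, ← mul_assoc, mul_left_inj]

theorem card_occ_of_mk_eq {w g g' : F n} (hg : g ≠ 1) (hg' : g' ≠ 1)
    (h : UWord.mk ⟨g, hg⟩ = UWord.mk ⟨g', hg'⟩) : Nat.card (Occ w g) = Nat.card (Occ w g') := by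
  rcases (UWord.mk_eq_mk hg hg').1 h with rfl | rfl
  · rfl
  · exact (Nat.card_congr (occ_inv_right w g').some).symm

/-- The circle is the axis modulo translation: a path lifts to the axis, and each passage through
the base vertex contributes a power of the word. -/
theorem cyc_reads_val {L : List (Letter (Fin n))} {i j : Fin L.length}
    {M : List (Letter (Fin n))} (h : (cyc L).Reads i M j) :
    ∃ k : ℤ, FreeGroup.mk (L.take i) * FreeGroup.mk M =
      (FreeGroup.mk L ^ k * FreeGroup.mk (L.take j) : F n) := by
  have edge : ∀ i : Fin L.length, ∃ k : ℤ,
      FreeGroup.mk (L.take i) * FreeGroup.mk [L.get i] =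
        (FreeGroup.mk L ^ k * FreeGroup.mk (L.take ((i + 1) % L.length)) : F n) := by
    intro i
    have h1 := mk_take_succ L i.1 i.2
    rcases Nat.lt_or_ge (i + 1) L.length with hlt | hge
    · exact ⟨0, by rw [Nat.mod_eq_of_lt hlt, h1]; simp⟩
    · have e : (i : ℕ) + 1 = L.length := by omega
      refine ⟨1, ?_⟩
      rw [e, List.take_length] at h1
      rw [e, Nat.mod_self, zpow_one, List.take_zero, ← FreeGroup.one_eq_mk, mul_one, h1]
      rfl
  induction M generalizing i with
  | nil =>
    obtain rfl : i = j := h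
    exact ⟨0, by simp [← FreeGroup.one_eq_mk]⟩
  | cons l M ih =>
    obtain ⟨⟨e, b⟩, h1, h2, h3⟩ := h
    obtain ⟨k, hk⟩ := ih h3
    obtain ⟨k', hk'⟩ := edge e
    rw [show (FreeGroup.mk (l :: M) : F n) = FreeGroup.mk [l] * FreeGroup.mk M by simp]
    cases b
    · simp only [cyc, if_false, Bool.false_eq_true] at h1 h2
      simp only [cyc, if_true, Bool.not_false] at hk
      have h1' : ((e : ℕ) + 1) % L.length = i := congrArg Fin.val h1
      rw [h1'] at hk'
      refine ⟨-k' + k, ?_⟩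
      rw [zpow_add, mul_assoc, ← hk, zpow_neg, eq_inv_mul_iff_mul_eq, ← mul_assoc, ← mul_assoc,
        ← hk', ← h2, ← mk_singleton_inv, mul_inv_cancel_right]
    · simp only [cyc, if_true] at h1 h2
      simp only [cyc, if_false, Bool.not_true, Bool.false_eq_true] at hk
      obtain rfl := h1
      refine ⟨k' + k, ?_⟩
      rw [← mul_assoc, ← h2, hk', mul_assoc, hk, zpow_add, mul_assoc]

/-- Going back to the base vertex, `k` times around and out to `j` gives a path whose label
represents `g`; reduce it. -/
theorem cyc_reads_of_eq {L : List (Letter (Fin n))} (hL : FreeGroup.IsCyclicallyReduced L)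
    {i j : Fin L.length} {g : F n} {k : ℤ}
    (h : FreeGroup.mk (L.take i) * g = FreeGroup.mk L ^ k * FreeGroup.mk (L.take j)) :
    (cyc L).Reads i g.toWord j := by
  have h0 : 0 < L.length := Nat.zero_lt_of_lt i.2
  have hpow : ∀ m : ℕ, (cyc L).Reads (⟨0, h0⟩ : Fin L.length) (List.replicate m L).flatten
      (⟨0, h0⟩ : Fin L.length) := by
    intro m
    induction m with
    | zero => exact rfl
    | succ m ih =>
      rw [List.replicate_succ, List.flatten_cons]
      exact LGraph.reads_append.2 ⟨_, cyc_reads_all L h0, ih⟩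
  have hz : ∃ M, (cyc L).Reads (⟨0, h0⟩ : Fin L.length) M (⟨0, h0⟩ : Fin L.length) ∧
      (FreeGroup.mk M : F n) = FreeGroup.mk L ^ k := by
    obtain ⟨m, rfl | rfl⟩ := Int.eq_nat_or_neg k
    · exact ⟨_, hpow m, by rw [zpow_natCast, FreeGroup.pow_mk]⟩
    · exact ⟨_, (hpow m).symm, by
        rw [zpow_neg, zpow_natCast, FreeGroup.pow_mk, FreeGroup.inv_mk]⟩
  obtain ⟨M, hM, hM'⟩ := hz
  have h1 := LGraph.reads_append.2 ⟨_, (cyc_reads_take L i.1 i.2).symm,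
    LGraph.reads_append.2 ⟨_, hM, cyc_reads_take L j.1 j.2⟩⟩
  have h2 := h1.reduce (cyc_isFolded hL)
  rw [← FreeGroup.toWord_mk, ← FreeGroup.mul_mk, ← FreeGroup.mul_mk, ← FreeGroup.inv_mk, hM',
    ← h, inv_mul_cancel_left] at h2
  exact h2

/-- Morphisms from a segment to a circle are occurrences along the axis. -/
theorem exists_hom_cyc_equiv_occ {L : List (Letter (Fin n))}
    (hL : FreeGroup.IsCyclicallyReduced L) (h0 : 0 < L.length) (g : F n) :
    Nonempty (LGraph.Hom (wseg g) (cyc L) ≃ Occ (FreeGroup.mk L) g) := by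
  have hax : ∀ (i : Fin L.length) (k : ℤ),
      Ax (FreeGroup.mk L) (FreeGroup.mk L ^ k * FreeGroup.mk (L.take i)) :=
    fun i k => (ax_mk_iff hL h0 _).2 ⟨k, i.1, i.2, rfl⟩
  let at0 : LGraph.Hom (wseg g) (cyc L) → Fin L.length :=
    fun f => f.onV (0 : Fin (g.toWord.length + 1))
  have hmem : ∀ f, Ax (FreeGroup.mk L) (FreeGroup.mk (L.take (at0 f)) : F n) ∧
      Ax (FreeGroup.mk L) (FreeGroup.mk (L.take (at0 f)) * g) := by
    intro f
    constructor
    · simpa using hax (at0 f) 0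
    · have hr : (cyc L).Reads (at0 f) g.toWord _ := seg_hom_reads_last f
      obtain ⟨k, hk⟩ := cyc_reads_val hr
      rw [FreeGroup.mk_toWord] at hk
      rw [hk]
      exact hax _ k
  refine ⟨Equiv.ofBijective
    (fun f => Quotient.mk (occSetoid (FreeGroup.mk L) g) ⟨_, hmem f⟩) ⟨?_, ?_⟩⟩
  · intro f f' e
    obtain ⟨k, hk⟩ := Quotient.exact e
    have := mk_take_eq_of_zpow hL (at0 f').2 (at0 f).2 hk
    exact seg_hom_ext (cyc_isFolded hL) (Fin.ext this.symm)
  · rintro ⟨c, hc, hcg⟩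
    obtain ⟨k, i, hi, rfl⟩ := (ax_mk_iff hL h0 _).1 hc
    rw [mul_assoc, ax_zpow_mul] at hcg
    obtain ⟨l, j, hj, e⟩ := (ax_mk_iff hL h0 _).1 hcg
    have h1 := cyc_reads_of_eq hL (i := ⟨i, hi⟩) (j := ⟨j, hj⟩) e
    obtain ⟨f, hf, -⟩ := h1.exists_hom
    refine ⟨f, Quotient.sound ⟨k, ?_⟩⟩
    have : at0 f = ⟨i, hi⟩ := hf
    simp only [this]

instance LGraph.Hom.finite {X : Type} (Γ Δ : LGraph X) [Finite Γ.V] [Finite Γ.E] [Finite Δ.V]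
    [Finite Δ.E] : Finite (LGraph.Hom Γ Δ) :=
  Finite.of_injective (fun f => (f.onV, f.onE)) fun _ _ e =>
    LGraph.Hom.ext (congrArg Prod.fst e) (congrArg Prod.snd e)

instance seg_hom_cyc_finite {X : Type} (L M : List (Letter X)) :
    Finite (LGraph.Hom (seg L) (cyc M)) := by
  have : Finite (seg L).V := inferInstanceAs (Finite (Fin _))
  have : Finite (seg L).E := inferInstanceAs (Finite (Fin _ × Bool))
  have : Finite (cyc M).V := inferInstanceAs (Finite (Fin _))
  have : Finite (cyc M).E := inferInstanceAs (Finite (Fin _ × Bool))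
  infer_instance

/-- The cyclic word of a nontrivial group element. -/
def CWord.mk (x : {x : F n // x ≠ 1}) : CWord n := Quotient.mk (cSetoid n) x

theorem exists_cyclicallyReduced {x : F n} (hx : x ≠ 1) :
    FreeGroup.IsCyclicallyReduced (FreeGroup.reduceCyclically x.toWord) ∧
    0 < (FreeGroup.reduceCyclically x.toWord).length ∧
    ∃ h, x = h * FreeGroup.mk (FreeGroup.reduceCyclically x.toWord) * h⁻¹ := by
  have h1 := FreeGroup.reduceCyclically.conj_conjugator_reduceCyclically x.toWord
  have h2 := congrArg FreeGroup.mk h1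
  rw [FreeGroup.mk_toWord, ← FreeGroup.mul_mk, ← FreeGroup.mul_mk, ← FreeGroup.inv_mk] at h2
  refine ⟨FreeGroup.reduceCyclically.isCyclicallyReduced FreeGroup.isReduced_toWord, ?_,
    _, h2.symm⟩
  rw [List.length_pos_iff]
  intro e
  rw [e, ← FreeGroup.one_eq_mk, mul_one, mul_inv_cancel] at h2
  exact hx h2.symm

theorem exists_ax {x : F n} (hx : x ≠ 1) : ∃ c, Ax x c := by
  obtain ⟨h1, h2, h, e⟩ := exists_cyclicallyReduced hx
  have h3 : Ax (FreeGroup.mk (FreeGroup.reduceCyclically x.toWord)) (1 : F n) :=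
    (ax_mk_iff h1 h2 1).2 ⟨0, 0, h2, by simp [← FreeGroup.one_eq_mk]⟩
  rw [← ax_conj h, ← e] at h3
  exact ⟨_, h3⟩

theorem occ_of_cSetoid {x y : {x : F n // x ≠ 1}} (h : cSetoid n x y) (g : F n) :
    Nonempty (Occ x.1 g ≃ Occ y.1 g) := by
  rcases h with h | h
  · obtain ⟨c, hc⟩ := isConj_iff.1 h
    rw [← hc]
    exact occ_conj c _ g
  · obtain ⟨c, hc⟩ := isConj_iff.1 h
    obtain ⟨E⟩ := occ_inv_left y.1 g
    obtain ⟨E'⟩ := occ_conj c x.1 g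
    rw [hc] at E'
    exact ⟨E'.trans E.symm⟩

/-- Morphisms to the circle of a cyclic word are occurrences along an axis. -/
theorem hom_cword_equiv_occ (x : {x : F n // x ≠ 1}) (g : F n) :
    Nonempty (LGraph.Hom (wseg g) (CWord.mk x).graph ≃ Occ x.1 g) := by
  obtain ⟨h1, h2, h, e⟩ := exists_cyclicallyReduced (Quotient.out (CWord.mk x)).2
  obtain ⟨E₁⟩ := exists_hom_cyc_equiv_occ h1 h2 g
  obtain ⟨E₂⟩ := occ_conj h
    (FreeGroup.mk (FreeGroup.reduceCyclically (Quotient.out (CWord.mk x)).1.toWord)) g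
  obtain ⟨E₃⟩ := occ_of_cSetoid (Quotient.exact (Quotient.out_eq (CWord.mk x)) :
    cSetoid n (Quotient.out (CWord.mk x)) x) g
  rw [← e] at E₂
  exact ⟨(E₁.trans E₂).trans E₃⟩

theorem finite_occ {x : F n} (hx : x ≠ 1) (g : F n) : Finite (Occ x g) :=
  have : Finite (LGraph.Hom (wseg g) (CWord.mk ⟨x, hx⟩).graph) := seg_hom_cyc_finite _ _
  Finite.of_equiv _ (hom_cword_equiv_occ ⟨x, hx⟩ g).some

theorem homCount_mk (u : UWord n) (x : {x : F n // x ≠ 1}) :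
    homCount u (CWord.mk x) = Nat.card (Occ x.1 u.rep) :=
  Nat.card_congr (hom_cword_equiv_occ x u.rep).some

theorem CWord.ind {p : CWord n → Prop} (h : ∀ x, p (CWord.mk x)) (w : CWord n) : p w :=
  Quotient.ind h w

variable {φ : MulAut (F n)}

/-- Occurrences of `u` in the image of `x` correspond to occurrences of the base words of the
minimal ideal preimages of `u` in `x`. -/
theorem card_occ_map (hn : 2 ≤ n) (u : UWord n) {x : F n} (hx : x ≠ 1) :
    Nat.card (Occ (φ x) u.rep) =
      Nat.card (Σ p : (finite_idealPairs (φ := φ) u).toFinset, Occ x p.1.1.rep) := by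
  have hu := u.rep_ne_one
  have hmin : ∀ p : (finite_idealPairs (φ := φ) u).toFinset, ∀ t : F n,
      MinIdealSeg φ (φ (t * p.1.2⁻¹)) (φ (t * p.1.2⁻¹) * u.rep) t (t * p.1.1.rep) := by
    intro p t
    have h0 : p.1 ∈ idealPairs φ u := (Set.Finite.mem_toFinset _).1 p.2
    have h1 : MinIdealSeg φ 1 u.rep p.1.2 (p.1.2 * p.1.1.rep) := h0
    have h2 := h1.mul_left (t * p.1.2⁻¹)
    rwa [mul_one, ← mul_assoc, inv_mul_cancel_right] at h2
  -- The translation by `t * p.1.2⁻¹` moves the base segment of the pair to the occurrence `t`, and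
  -- its image under `φ` moves `[1, u]` to the corresponding occurrence of `u`.
  let f : (p : (finite_idealPairs (φ := φ) u).toFinset) → AxSeg x p.1.1.rep →
      AxSeg (φ x) u.rep := fun p t => ⟨φ (t.1 * p.1.2⁻¹), (hmin p t.1).2.1.ax t.2.1 t.2.2⟩
  let g : (Σ p : (finite_idealPairs (φ := φ) u).toFinset, Occ x p.1.1.rep) →
      Occ (φ x) u.rep := fun q => Quotient.map (sa := occSetoid x q.1.1.1.rep)
        (sb := occSetoid (φ x) u.rep) (f q.1) (by
          rintro t t' ⟨k, hk⟩
          exact ⟨k, by simp only [f, hk, map_mul, map_zpow, mul_assoc]⟩) q.2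
  refine (Nat.card_congr (Equiv.ofBijective g ⟨?_, ?_⟩)).symm
  · rintro ⟨p, ⟨t⟩⟩ ⟨p', ⟨t'⟩⟩ e
    obtain ⟨k, hk⟩ := Quotient.exact e
    simp only [f] at hk
    rw [← map_zpow, ← map_mul] at hk
    have hk' := φ.injective hk
    have h1 := hmin p (x ^ k * t.1)
    have h2 := hmin p' t'.1
    rw [hk', ← mul_assoc] at h2
    have ax1 : Ax x (x ^ k * t.1) := (ax_zpow_mul _ _ _).2 t.2.1
    have ax2 : Ax x (x ^ k * t.1 * p.1.1.rep) := by
      rw [mul_assoc, ax_zpow_mul]; exact t.2.2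
    obtain ⟨a, b, b1, b2, b3, b4⟩ := exists_common_segment ax1 ax2 t'.2.1 t'.2.2
    have hrep : t'.1 = x ^ k * t.1 ∧ p'.1.1.rep = p.1.1.rep := by
      rcases h1.unique hn (fun e => hu (by simpa using e)) h2 b1 b2 b3 b4 with ⟨e1, e2⟩ | ⟨e1, e2⟩
      · rw [← e1] at e2
        exact ⟨e1.symm, (mul_left_cancel e2).symm⟩
      -- If the two segments matched with opposite orientations, a nontrivial word would be its own
      -- inverse.
      · exfalso
        have e3 : p.1.1.rep = p'.1.1.rep⁻¹ := by
          rw [e1, mul_assoc] at e2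
          exact eq_inv_of_mul_eq_one_right (mul_eq_left.1 e2)
        have e4 : p.1.1 = p'.1.1 := by
          rw [← p.1.1.mk_rep, ← p'.1.1.mk_rep, UWord.mk_eq_mk]
          exact .inr e3
        rw [e4] at e3
        have e5 : p'.1.1.rep ^ 2 = 1 := by
          rw [pow_two]
          nth_rewrite 1 [e3]
          exact inv_mul_cancel _
        exact p'.1.1.rep_ne_one ((pow_eq_one_iff_left (by norm_num)).1 e5)
    have hv : p.1.1 = p'.1.1 := by
      rw [← p.1.1.mk_rep, ← p'.1.1.mk_rep, UWord.mk_eq_mk]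
      exact .inl hrep.2.symm
    have hg : p.1.2 = p'.1.2 := by
      rw [hrep.1, ← mul_assoc] at hk'
      exact (inv_injective (mul_left_cancel hk')).symm
    have hp : p = p' := Subtype.ext (Prod.ext hv hg)
    subst hp
    exact congrArg (Sigma.mk p) (Quotient.sound ⟨k, hrep.1⟩)
  · rintro ⟨c, hc, hcu⟩
    obtain ⟨p₀, hp₀⟩ := exists_ax hx
    obtain ⟨a, b, hm, ha, hb⟩ := exists_minIdealSeg_of_ax hx (fun e => hu (by simpa using e)) hp₀ hc hcu
    -- The representative of the u-word may be the inverse of the label read from `a` to `b`; the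
    -- segment is then read from `b`.
    obtain ⟨v, t, hm, ha, hb⟩ : ∃ (v : UWord n) (t : F n),
        MinIdealSeg φ c (c * u.rep) t (t * v.rep) ∧ Ax x t ∧ Ax x (t * v.rep) := by
      have hne : a⁻¹ * b ≠ 1 := by
        rw [Ne, inv_mul_eq_one]; exact hm.1
      rcases UWord.rep_mk _ hne with e | e
      · exact ⟨UWord.mk ⟨_, hne⟩, a, by rw [e, mul_inv_cancel_left]; exact ⟨hm, ha, hb⟩⟩
      · refine ⟨UWord.mk ⟨_, hne⟩, b, ?_⟩
        rw [e, mul_inv_rev, inv_inv, mul_inv_cancel_left]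
        exact ⟨hm.swap, hb, ha⟩
    have h1 := hm.mul_left (φ.symm c)⁻¹
    rw [map_inv, MulEquiv.apply_symm_apply, inv_mul_cancel, inv_mul_cancel_left, ← mul_assoc] at h1
    refine ⟨⟨⟨(v, (φ.symm c)⁻¹ * t), (Set.Finite.mem_toFinset _).2 h1⟩,
      Quotient.mk (occSetoid x v.rep) ⟨t, ha, hb⟩⟩, Quotient.sound ⟨0, ?_⟩⟩
    simp [f]

theorem two_le_of_uWord (hn : n ≠ 1) (u : UWord n) : 2 ≤ n := by
  have : n ≠ 0 := by
    rintro rfl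
    exact u.rep_ne_one (Subsingleton.elim _ _)
  omega

theorem homCount_map (hn : n ≠ 1) (φ : MulAut (F n)) (u : UWord n) (w : CWord n) :
    homCount u (CWord.map φ w) = ((S φ u).map (fun v => homCount v w)).sum := by
  induction w using CWord.ind with
  | h x =>
  have hφ : φ x.1 ≠ 1 := by simpa using x.2
  have h1 : CWord.map φ (CWord.mk x) = CWord.mk ⟨φ x.1, hφ⟩ := rfl
  have := fun g => finite_occ x.2 g
  rw [h1, homCount_mk, sum_map_S, card_occ_map (two_le_of_uWord hn u) u x.2, Nat.card_sigma]
  simp only [homCount_mk]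
  exact Finset.sum_coe_sort _ (fun p : UWord n × F n => Nat.card (Occ x.1 p.1.rep))

end Counting

/-! ### Affixes -/

section Affix

variable {n : ℕ}

theorem prefix_iff_btw (a b : F n) : a.toWord <+: b.toWord ↔ Btw 1 a b := by
  rw [btw_iff_toWord_append]
  constructor
  · rintro ⟨t, ht⟩
    have h1 : b = a * FreeGroup.mk t := by
      rw [← FreeGroup.mk_toWord (x := b), ← ht, ← FreeGroup.mul_mk, FreeGroup.mk_toWord]
    have h2 : FreeGroup.IsReduced t :=
      (FreeGroup.isReduced_toWord (x := b)).infix ⟨a.toWord, [], by simpa using ht⟩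
    rw [h1, inv_mul_cancel_left, FreeGroup.toWord_mk (L₁ := t), h2.reduce_eq, ht, ← h1]
  · intro h
    exact ⟨_, h.symm⟩

theorem suffix_iff_btw (a b : F n) : a⁻¹.toWord <:+ b.toWord ↔ Btw 1 a b⁻¹ := by
  rw [← prefix_iff_btw, FreeGroup.toWord_inv, FreeGroup.toWord_inv]
  constructor
  · rintro ⟨t, ht⟩
    exact ⟨FreeGroup.invRev t, by
      rw [← ht, FreeGroup.invRev_append, FreeGroup.invRev_invRev]⟩
  · rintro ⟨t, ht⟩
    refine ⟨FreeGroup.invRev t, ?_⟩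
    rw [← FreeGroup.invRev_invRev (L₁ := b.toWord), ← ht, FreeGroup.invRev_append]

/-- A word is not an initial segment of both a word with one more letter and its inverse. -/
theorem not_btw_and_btw_inv {a d : F n} (ha : a ≠ 1) (hd : d.norm = a.norm + 1)
    (h1 : Btw 1 a d) (h2 : Btw 1 a d⁻¹) : False := by
  obtain ⟨y, hy, hya⟩ := exists_step ha.symm
  have h3 : Btw d (d * a) 1 := by
    rw [← btw_mul_left d] at h2
    simpa using h2
  have h4 : Btw d (d * y) (d * a) := by
    rw [← btw_mul_left d] at hya
    simpa using hya
  have h5 := (h3.trans_left h4).1.symm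
  have h6 := (h1.trans_left hya).1
  have hyn : y.norm = 1 := by simpa using hy
  have e1 : d * y = a := by
    refine h5.eq_of_tdist h1 ?_
    have hc := tdist_comm (d * y) d
    rw [tdist_mul_right_self] at hc
    unfold Btw at h5
    simp only [tdist_one_left] at h5 ⊢
    omega
  have e2 : d * a = y := by
    refine h3.symm.eq_of_tdist h6 ?_
    have h7 := h3.symm
    have hc := tdist_comm (d * a) d
    rw [tdist_mul_right_self] at hc
    unfold Btw at h7
    simp only [tdist_one_left] at h7 ⊢
    omega
  -- The element `d` exchanges `a` and the first vertex `y` of `[1, a]`, so its square is trivial.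
  have e3 : d ^ 2 = 1 := by
    rw [← e1, ← mul_assoc, mul_eq_right] at e2
    rw [pow_two, e2]
  have e4 := (pow_eq_one_iff_left (by norm_num)).1 e3
  rw [e4, FreeGroup.norm_one] at hd
  omega

/-- An axis is unbounded in both directions: a far translate of `c` on the side of `c * a` lies
beyond `c * a`, and the next vertex towards it is taken. -/
theorem exists_ax_extension {x a c : F n} (hx : x ≠ 1) (hc : Ax x c)
    (hca : Ax x (c * a)) : ∃ d, d.norm = a.norm + 1 ∧ Btw 1 a d ∧ Ax x (c * d) := by
  have key : ∃ e, Ax x e ∧ e ≠ c * a ∧ Btw c (c * a) e := by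
    obtain ⟨N₁, h1⟩ := hc c
    obtain ⟨N₂, h2⟩ := hca c
    obtain ⟨N₃, h3⟩ := exists_pow_far hx c (c * a) 0
    let N := max (max N₁ N₂) N₃
    have g1 := h1 N (by simp [N])
    have g2 := h2 N (by simp [N])
    have g3 := h3 N (by simp [N])
    rcases g1.total g2 with ⟨-, h⟩ | ⟨h, -⟩
    · refine ⟨x ^ N * c, ?_, ?_, h⟩
      · have := (ax_zpow_mul x c N).2 hc
        rwa [zpow_natCast] at this
      · intro e
        rw [e, tdist_self] at g3
        exact lt_irrefl _ g3.1
    · refine ⟨(x ^ N)⁻¹ * c, ?_, ?_, h.symm⟩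
      · have := (ax_zpow_mul x c (-N)).2 hc
        rwa [zpow_neg, zpow_natCast] at this
      · intro e
        rw [e, tdist_self] at g3
        exact lt_irrefl _ g3.2
  obtain ⟨e, he, hne, hb⟩ := key
  obtain ⟨r, hr, hrb⟩ := exists_step hne.symm
  have h1 : Btw c (c * a) r := (hb.trans_right hrb).2
  refine ⟨c⁻¹ * r, ?_, ?_, ?_⟩
  · have := h1
    unfold Btw at this
    rw [hr, tdist_mul_right_self] at this
    exact this.symm
  · rw [← btw_mul_left c]
    simpa using h1
  · rw [mul_inv_cancel_left]
    exact hca.convex he hrb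

/-- Two vertices of a geodesic on the same side of `x` and at the same distance from `x` agree. -/
theorem Btw.eq_of_common {p q x m d d' : F n} (hx : Btw p x q) (hd : Btw p d q)
    (hd' : Btw p d' q) (h : Btw x m d) (h' : Btw x m d') (hm : m ≠ x)
    (he : tdist x d = tdist x d') : d = d' := by
  have opposite : ∀ {e e' : F n}, Btw x m e → Btw x m e' → Btw e x e' → False := by
    intro e e' h1 h2 h3
    have h4 := tdist_triangle e m e'
    have h5 := tdist_comm e x
    have h6 := tdist_comm e m
    have h7 := tdist_pos hm.symm
    unfold Btw at h1 h2 h3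
    omega
  rcases hx.total hd with ⟨h1, h2⟩ | ⟨h1, h2⟩ <;> rcases hx.total hd' with ⟨h3, h4⟩ | ⟨h3, h4⟩
  · exact h2.eq_of_tdist h4 he
  · exact (opposite h' h (h4.trans_right h2).2).elim
  · exact (opposite h h' (h2.trans_right h4).2).elim
  · exact h1.symm.eq_of_tdist h3.symm he

/-- The occurrences of `a` are the occurrences of its extensions by a letter. -/
theorem card_occ_eq_sum (k : ℕ) {x a : F n} (hx : x ≠ 1) (ha : a ≠ 1) (hk : a.norm = k)
    (σ : Orientation n) (P : W n (k + 1) → Prop) [DecidablePred P]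
    (hP : ∀ v, P v ↔ (a.toWord <+: (σ.word v.1).toWord ∨ a⁻¹.toWord <:+ (σ.word v.1).toWord)) :
    Nat.card (Occ x a) = ∑ v : W n (k + 1), if P v then Nat.card (Occ x v.1.rep) else 0 := by
  classical
  have hfin := fun g => finite_occ hx g
  simp only [prefix_iff_btw, suffix_iff_btw] at hP
  have hσ : ∀ v : W n (k + 1), (σ.word v.1).norm = k + 1 := fun v => by
    have := v.2
    rw [← σ.mk_word v.1] at this
    exact this
  have hd : ∀ v : {v // P v}, ∃ d, d.norm = k + 1 ∧ Btw 1 a d ∧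
      ∃ h : d ≠ 1, UWord.mk ⟨d, h⟩ = v.1.1 := by
    rintro ⟨v, hv⟩
    rcases (hP v).1 hv with h | h
    · exact ⟨_, hσ v, h, σ.ne_one _, σ.mk_word _⟩
    · refine ⟨_, by rw [FreeGroup.norm_inv_eq, hσ v], h, inv_ne_one.2 (σ.ne_one _), ?_⟩
      conv_rhs => rw [← σ.mk_word v.1]
      rw [UWord.mk_eq_mk]
      exact .inr rfl
  choose d hdn hdb hd1 hdv using hd
  rw [← Finset.sum_filter, ← Finset.sum_subtype_eq_sum_filter, Finset.subtype_univ]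
  have e1 : ∀ v : {v // P v}, Nat.card (Occ x v.1.1.rep) = Nat.card (Occ x (d v)) := fun v =>
    card_occ_of_mk_eq v.1.1.rep_ne_one (hd1 v) (by rw [UWord.mk_rep, hdv])
  simp only [e1]
  rw [← Nat.card_sigma]
  let g : (Σ v : {v // P v}, Occ x (d v)) → Occ x a := fun q =>
    Quotient.map (sa := occSetoid x (d q.1)) (sb := occSetoid x a)
      (fun c => ⟨c.1, c.2.1, c.2.1.convex c.2.2 (by
        have := hdb q.1
        rw [← btw_mul_left c.1] at this
        simpa using this)⟩) (fun c c' h => h) q.2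
  refine (Nat.card_congr (Equiv.ofBijective g ⟨?_, ?_⟩)).symm
  · rintro ⟨v, ⟨c, hc, hcd⟩⟩ ⟨v', ⟨c', hc', hcd'⟩⟩ e
    obtain ⟨l, hl⟩ := Quotient.exact e
    simp only at hl
    subst hl
    have ax1 : Ax x (x ^ l * c * d v) := by rw [mul_assoc, ax_zpow_mul]; exact hcd
    obtain ⟨p, q, b1, b2, b3, -⟩ := exists_common_segment hc' ax1 hcd' hcd'
    have h1 : Btw (x ^ l * c) (x ^ l * c * a) (x ^ l * c * d v) := by
      have := hdb v
      rw [← btw_mul_left (x ^ l * c)] at this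
      simpa using this
    have h2 : Btw (x ^ l * c) (x ^ l * c * a) (x ^ l * c * d v') := by
      have := hdb v'
      rw [← btw_mul_left (x ^ l * c)] at this
      simpa using this
    -- Both extensions follow the same axis from the same vertex, in the direction given by `a`, and
    -- have the same length.
    have e2 : x ^ l * c * d v = x ^ l * c * d v' := by
      refine Btw.eq_of_common b1 b2 b3 h1 h2 ?_ ?_
      · simpa using ha
      · simp [hdn]
    have e3 : v = v' := by
      refine Subtype.ext (Subtype.ext ?_)
      rw [← hdv v, ← hdv v', UWord.mk_eq_mk]
      exact .inl (mul_left_cancel e2)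
    subst e3
    exact congrArg (Sigma.mk v) (Quotient.sound ⟨l, rfl⟩)
  · rintro ⟨c, hc, hca⟩
    obtain ⟨b, hbn, hb, hcb⟩ := exists_ax_extension hx hc hca
    have hb1 : b ≠ 1 := by rintro rfl; simp at hbn
    rw [hk] at hbn
    let v : W n (k + 1) := ⟨UWord.mk ⟨b, hb1⟩, hbn⟩
    have hv : P v := by
      rw [hP]
      rcases (UWord.mk_eq_mk (σ.ne_one v.1) hb1).1 (σ.mk_word v.1) with h | h
      · exact .inl (by rwa [h])
      · exact .inr (by rwa [h, inv_inv])
    have hdv' : d ⟨v, hv⟩ = b := by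
      refine ((UWord.mk_eq_mk (hd1 _) hb1).1 (hdv ⟨v, hv⟩)).resolve_right fun h => ?_
      exact not_btw_and_btw_inv ha (by rw [hbn, hk]) hb (by rw [← h]; exact hdb _)
    exact ⟨⟨⟨v, hv⟩, Quotient.mk (occSetoid x (d ⟨v, hv⟩)) ⟨c, hc, by rwa [hdv']⟩⟩, rfl⟩

end Affix

/-! ### The inverse system -/

section System

variable {n : ℕ}

theorem piMap_single (k : ℕ) (w : CWord n) (u : W n k) :
    piMap n k (Finsupp.single w 1) u = homCount u.1 w := by
  simp [piMap]

theorem linearCombination_equivFunOnFinite_apply {α β : Type*} [Fintype α] [Finite β]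
    (f : α → β → ℤ) (x : α →₀ ℤ) (b : β) :
    Finsupp.linearCombination ℤ (fun a => Finsupp.equivFunOnFinite.symm (f a)) x b =
      ∑ a, x a * f a b := by
  rw [Finsupp.linearCombination_apply, Finsupp.sum_fintype _ _ (fun a => by simp),
    Finsupp.finsetSum_apply]
  simp

/-- Here `a` is either orientation of the u-word, so that both the inward and the outward affixes
are covered. -/
theorem sum_affix_piMap (k : ℕ) (σ : Orientation n) (w : CWord n) (u : W n k) {a : F n}
    (ha : a ≠ 1) (hau : UWord.mk ⟨a, ha⟩ = u.1) (P : W n (k + 1) → Prop) [DecidablePred P]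
    (hP : ∀ v, P v ↔ (a.toWord <+: (σ.word v.1).toWord ∨ a⁻¹.toWord <:+ (σ.word v.1).toWord)) :
    ∑ v, piMap n (k + 1) (Finsupp.single w 1) v * (if P v then (1 : ℤ) else 0) =
      piMap n k (Finsupp.single w 1) u := by
  induction w using CWord.ind with
  | h x =>
  have hk : a.norm = k := by
    have := u.2
    rwa [← hau] at this
  simp only [piMap_single, homCount_mk]
  rw [card_occ_of_mk_eq u.1.rep_ne_one ha (by rw [UWord.mk_rep, hau]),
    card_occ_eq_sum k x.2 ha hk σ P hP]
  push_cast
  refine Finset.sum_congr rfl fun v _ => ?_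
  split_ifs <;> simp

theorem pOut_comp_piMap (σ : Orientation n) (k : ℕ) :
    pOut σ k ∘ₗ piMap n (k + 1) = piMap n k := by
  refine Finsupp.lhom_ext' fun w => LinearMap.ext_ring (Finsupp.ext fun u => ?_)
  simp only [LinearMap.comp_apply, Finsupp.lsingle_apply]
  rw [pOut, linearCombination_equivFunOnFinite_apply]
  classical
  refine sum_affix_piMap k σ w u (inv_ne_one.2 (σ.ne_one u.1)) ?_ _ fun v => ?_
  · conv_rhs => rw [← σ.mk_word u.1]
    rw [UWord.mk_eq_mk]
    exact .inr rfl
  · rw [inv_inv]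
    rfl

theorem pIn_comp_piMap (σ : Orientation n) (k : ℕ) :
    pIn σ k ∘ₗ piMap n (k + 1) = piMap n k := by
  refine Finsupp.lhom_ext' fun w => LinearMap.ext_ring (Finsupp.ext fun u => ?_)
  simp only [LinearMap.comp_apply, Finsupp.lsingle_apply]
  rw [pIn, linearCombination_equivFunOnFinite_apply]
  classical
  exact sum_affix_piMap k σ w u (σ.ne_one u.1) (σ.mk_word u.1) _ fun v => Iff.rfl

theorem pOut_piMap (σ : Orientation n) (k : ℕ) (y : ZC n) :
    pOut σ k (piMap n (k + 1) y) = piMap n k y :=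
  LinearMap.congr_fun (pOut_comp_piMap σ k) y

theorem pIn_piMap (σ : Orientation n) (k : ℕ) (y : ZC n) :
    pIn σ k (piMap n (k + 1) y) = piMap n k y :=
  LinearMap.congr_fun (pIn_comp_piMap σ k) y

theorem pComp_self (σ : Orientation n) (l : ℕ) : pComp σ (le_refl l) = LinearMap.id := by
  rw [pComp, Nat.leRec_self]

theorem pComp_succ (σ : Orientation n) {l m : ℕ} (h : l ≤ m) :
    pComp σ (Nat.le_succ_of_le h) = pComp σ h ∘ₗ pOut σ m := by
  rw [pComp, Nat.leRec_succ _ _ h]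
  rfl

/-- Compatible families are determined at each level by any higher level. -/
theorem pComp_eq_of_compatible (σ : Orientation n) {x : ∀ k : ℕ, M n k}
    (hx : ∀ k, pOut σ k (x (k + 1)) = x k) {l m : ℕ} (h : l ≤ m) : pComp σ h (x m) = x l := by
  induction m, h using Nat.le_induction with
  | base => rw [pComp_self]; rfl
  | succ m h ih => rw [pComp_succ σ h, LinearMap.comp_apply, hx, ih]

theorem pComp_piMap (σ : Orientation n) {l m : ℕ} (h : l ≤ m) (y : ZC n) :
    pComp σ h (piMap n m y) = piMap n l y :=
  pComp_eq_of_compatible σ (x := fun k => piMap n k y) (fun k => pOut_piMap σ k y) h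

variable (φ : MulAut (F n))

theorem length_le_mBound {k : ℕ} (u : W n k) {v : UWord n} (hv : v ∈ S φ u.1) :
    v.length ≤ mBound φ k :=
  (Multiset.le_sup (Multiset.mem_map_of_mem _ hv)).trans
    (Finset.le_sup (f := fun u : W n k => ((S φ u.1).map UWord.length).sup) (Finset.mem_univ u))

theorem mBound_le {k m : ℕ} (h : ∀ u : W n k, ∀ v ∈ S φ u.1, v.length ≤ m) : mBound φ k ≤ m := by
  refine Finset.sup_le fun u _ => Multiset.sup_le.2 fun l hl => ?_
  obtain ⟨v, hv, rfl⟩ := Multiset.mem_map.1 hl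
  exact h u v hv

theorem coeff_piMap_single (σ : Orientation n) {m : ℕ} {v : UWord n} (h : v.length ≤ m)
    (w : CWord n) : coeff σ m v (piMap n m (Finsupp.single w 1)) = homCount v w := by
  rw [coeff, dif_pos h, LinearMap.comp_apply, pComp_piMap, Finsupp.lapply_apply, piMap_single]

theorem sum_coeff_piMap_single (σ : Orientation n) {m : ℕ} (s : Multiset (UWord n))
    (h : ∀ v ∈ s, v.length ≤ m) (w : CWord n) :
    (s.map (coeff σ m)).sum (piMap n m (Finsupp.single w 1)) =
      ((s.map fun v => homCount v w).sum : ℕ) := by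
  induction s using Multiset.induction with
  | empty => simp
  | cons v s ih =>
    rw [Multiset.map_cons, Multiset.sum_cons, LinearMap.add_apply,
      ih fun v hv => h v (Multiset.mem_cons_of_mem hv),
      coeff_piMap_single σ (h v (Multiset.mem_cons_self v s)), Multiset.map_cons,
      Multiset.sum_cons, Nat.cast_add]

theorem phiLevel_piMap (hn : n ≠ 1) (σ : Orientation n) (k : ℕ) (y : ZC n) :
    phiLevel σ φ k (piMap n (mBound φ k) y) = piMap n k (actZC φ y) := by
  have key : phiLevel σ φ k ∘ₗ piMap n (mBound φ k) = piMap n k ∘ₗ actZC φ := by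
    refine Finsupp.lhom_ext' fun w => LinearMap.ext_ring (Finsupp.ext fun u => ?_)
    simp only [LinearMap.comp_apply, Finsupp.lsingle_apply]
    have h1 : actZC φ (Finsupp.single w 1) = Finsupp.single (CWord.map φ w) 1 := by
      simp [actZC]
    rw [h1, piMap_single, homCount_map hn]
    exact sum_coeff_piMap_single σ _ (fun v => length_le_mBound φ u) w
  exact LinearMap.congr_fun key y

variable {φ}

/-! ### Monotonicity of the lengths $m_k$. -/

theorem exists_mem_S {z a b : F n} (hz : z ≠ 1) (h : MinIdealSeg φ 1 z a b) :
    ∃ v ∈ S φ (UWord.mk ⟨z, hz⟩), v.length = tdist a b := by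
  have key : ∀ a b, MinIdealSeg φ 1 (UWord.mk ⟨z, hz⟩).rep a b →
      ∃ v ∈ S φ (UWord.mk ⟨z, hz⟩), v.length = tdist a b := by
    intro a b h
    have hne : a⁻¹ * b ≠ 1 := by
      rw [Ne, inv_mul_eq_one]; exact h.1
    refine ⟨UWord.mk ⟨_, hne⟩, mem_S_iff.2 ?_, rfl⟩
    rcases UWord.rep_mk _ hne with e | e
    · exact ⟨a, by rwa [e, mul_inv_cancel_left]⟩
    · refine ⟨b, ?_⟩
      rw [e, mul_inv_rev, inv_inv, mul_inv_cancel_left]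
      exact h.swap
  rcases UWord.rep_mk z hz with e | e
  · exact key a b (by rwa [e])
  · obtain ⟨v, hv, hl⟩ := key (φ.symm z⁻¹ * a) (φ.symm z⁻¹ * b) (by
      have := (h.mul_left (φ.symm z⁻¹)).swap_target
      rw [MulEquiv.apply_symm_apply, inv_mul_cancel, mul_one] at this
      rwa [e])
    exact ⟨v, hv, by rw [hl, tdist_mul_left]⟩

variable (φ) in
theorem exists_far_map (a y : F n) (C : ℕ) :
    ∃ D, ∀ x, D ≤ tdist a x → C < tdist (φ x) y := by
  have hfin := ((finite_ball y C).preimage φ.injective.injOn).image (tdist a)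
  obtain ⟨B, hB⟩ := hfin.bddAbove
  refine ⟨B + 1, fun x hx => ?_⟩
  by_contra hlt
  have : tdist a x ≤ B := hB ⟨x, show tdist y (φ x) ≤ C by rw [tdist_comm]; omega, rfl⟩
  omega

/-- A minimal ideal segment for `[1, u]` is contained in one for an extension of `[1, u]`. -/
theorem MinIdealSeg.exists_extension (hn : 2 ≤ n) {u a b : F n} (hu : u ≠ 1)
    (h : MinIdealSeg φ 1 u a b) : ∃ z c d, z.norm = u.norm + 1 ∧ MinIdealSeg φ 1 z c d ∧
      tdist a b ≤ tdist c d := by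
  obtain ⟨C, -, hC⟩ := exists_idealSeg_of_far φ
  obtain ⟨D₁, h1⟩ := exists_far_map φ a 1 (C + 1)
  obtain ⟨D₂, h2⟩ := exists_far_map φ a u (C + 1)
  obtain ⟨D₃, h3⟩ := exists_far_map φ b 1 (C + 1)
  obtain ⟨D₄, h4⟩ := exists_far_map φ b u (C + 1)
  -- The segment is prolonged on both sides until its image is far from `[1, u]`. The margin `C + 1`
  -- leaves more than `C` for `z`, which is one step from `u`.
  let D := max (max D₁ D₂) (max D₃ D₄)
  obtain ⟨a', ha', haa⟩ := exists_far hn b a D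
  obtain ⟨b', hb', hbb⟩ := exists_far hn a b D
  have g1 := h1 a' (by simp [D, ha'])
  have g2 := h2 a' (by simp [D, ha'])
  have g3 := h3 b' (by simp [D, hb'])
  have g4 := h4 b' (by simp [D, hb'])
  obtain ⟨hA, hB⟩ := haa.symm.concat hbb h.1
  obtain ⟨i1, i2⟩ := h.2.1 _ _ hA hB
  have hstep : ∃ z, tdist u z = 1 ∧ Btw 1 u z ∧ Btw (φ a') z (φ b') := by
    rcases i1.total i2 with ⟨j1, j2⟩ | ⟨j1, j2⟩
    · have hne : u ≠ φ b' := by rintro rfl; simp at g4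
      obtain ⟨z, hz, hzb⟩ := exists_step hne
      have j3 := i2.trans_right hzb
      exact ⟨z, hz, (j3.2.trans_left j1).2 , j3.1⟩
    · have hne : u ≠ φ a' := by rintro rfl; simp at g2
      obtain ⟨z, hz, hzb⟩ := exists_step hne
      have j3 := i2.symm.trans_right hzb
      exact ⟨z, hz, (j3.2.trans_left j2.symm).2, j3.1.symm⟩
  obtain ⟨z, hz, huz, hzb⟩ := hstep
  have hzn : z.norm = u.norm + 1 := by
    unfold Btw at huz
    rw [tdist_one_left, tdist_one_left, hz] at huz
    exact huz.symm
  have hz1 : (1 : F n) ≠ z := by rintro rfl; simp at hzn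
  have hne : a' ≠ b' := by
    rintro rfl
    exact h.1 (hA.eq_of_eq.trans hB.eq_of_eq.symm)
  have far : ∀ x, C + 1 < tdist x u → C < tdist x z := by
    intro x hx
    have := tdist_triangle x z u
    have := tdist_comm u z
    omega
  have hi := hC 1 z a' b' hz1 i1 hzb (by omega) (far _ g2) (by omega) (far _ g4)
  obtain ⟨c, d, hc, hd, hm⟩ := hi.exists_min hne
  -- A segment ideal for `[1, z]` is ideal for the shorter `[1, u]`. The minimal one inside it must
  -- be `[a, b]`, since both lie on `[a', b']`.
  have hi' : IdealSeg φ 1 u c d := fun p q hp hq =>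
    ⟨(hm.2.1 p q hp hq).1, (hm.2.1 p q hp hq).1.convex (hm.2.1 p q hp hq).2 huz⟩
  obtain ⟨e, f, he, hf, hm'⟩ := hi'.exists_min hm.1
  refine ⟨z, c, d, hzn, hm, ?_⟩
  have hle : tdist e f ≤ tdist c d := by
    have := tdist_comm e f
    rcases he.total hf with ⟨k1, k2⟩ | ⟨k1, k2⟩ <;>
    · unfold Btw at *
      omega
  have hu' := h.unique hn hu.symm hm' hA hB (hc.convex hd he) (hc.convex hd hf)
  rcases hu' with ⟨rfl, rfl⟩ | ⟨rfl, rfl⟩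
  · exact hle
  · rwa [tdist_comm]

theorem mBound_le_succ (hn : n ≠ 1) (φ : MulAut (F n)) (k : ℕ) :
    mBound φ k ≤ mBound φ (k + 1) := by
  refine mBound_le φ fun u v hv => ?_
  obtain ⟨g, hg⟩ := mem_S_iff.1 hv
  obtain ⟨z, c, d, hz, hm, hle⟩ :=
    hg.exists_extension (two_le_of_uWord hn v) u.1.rep_ne_one
  have hz1 : z ≠ 1 := by rintro rfl; simp at hz
  obtain ⟨v', hv', hl⟩ := exists_mem_S hz1 hm
  rw [← UWord.length_eq_norm_rep, u.2] at hz
  have := length_le_mBound φ (⟨UWord.mk ⟨z, hz1⟩, hz⟩ : W n (k + 1)) hv'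
  rw [tdist_mul_right_self, ← UWord.length_eq_norm_rep] at hle
  omega

end System

/-! ### The representation on the inverse limit -/

section Representation

variable {n : ℕ}

theorem pOut_phiLevel (hn : n ≠ 1) (σ : Orientation n) (φ : MulAut (F n)) (k : ℕ)
    (h : mBound φ k ≤ mBound φ (k + 1)) {x : M n (mBound φ (k + 1))}
    (hx : x ∈ Mtilde n (mBound φ (k + 1))) :
    pOut σ k (phiLevel σ φ (k + 1) x) = phiLevel σ φ k (pComp σ h x) := by
  obtain ⟨y, rfl⟩ := hx
  rw [phiLevel_piMap φ hn, pOut_piMap, pComp_piMap, phiLevel_piMap φ hn]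

theorem phiLevel_mem (hn : n ≠ 1) (σ : Orientation n) (φ : MulAut (F n)) (k : ℕ)
    {x : M n (mBound φ k)} (hx : x ∈ Mtilde n (mBound φ k)) : phiLevel σ φ k x ∈ Mtilde n k := by
  obtain ⟨y, rfl⟩ := hx
  exact ⟨_, (phiLevel_piMap φ hn σ k y).symm⟩

/-- The endomorphism of the inverse limit induced by an automorphism. -/
noncomputable def limMap (hn : n ≠ 1) (σ : Orientation n) (φ : MulAut (F n)) :
    invLimit σ →ₗ[ℤ] invLimit σ where
  toFun x := ⟨fun k => phiLevel σ φ k (x.1 (mBound φ k)),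
    fun k => phiLevel_mem hn σ φ k (x.2.1 _), fun k => by
      rw [pOut_phiLevel hn σ φ k (mBound_le_succ hn φ k) (x.2.1 _),
        pComp_eq_of_compatible σ x.2.2]⟩
  map_add' x y := Subtype.ext (funext fun k => by simp)
  map_smul' c x := Subtype.ext (funext fun k => by simp)

/-- Up to any finite level, an element of the limit comes from a single element of $\mathbb Z[C]$,
so identities between the induced maps can be checked there. -/
theorem exists_eq_piMap {σ : Orientation n} (x : invLimit σ) (m : ℕ) :
    ∃ y, ∀ l ≤ m, x.1 l = piMap n l y := by
  obtain ⟨y, hy⟩ := x.2.1 m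
  refine ⟨y, fun l hl => ?_⟩
  rw [← pComp_eq_of_compatible σ x.2.2 hl, ← hy, pComp_piMap]

theorem limMap_apply_of_eq (hn : n ≠ 1) {σ : Orientation n} (φ : MulAut (F n)) {x : invLimit σ}
    {k : ℕ} {y : ZC n} (h : x.1 (mBound φ k) = piMap n (mBound φ k) y) :
    (limMap hn σ φ x).1 k = piMap n k (actZC φ y) := by
  rw [← phiLevel_piMap φ hn σ k y, ← h]
  rfl

theorem actZC_single (φ : MulAut (F n)) (w : CWord n) :
    actZC φ (Finsupp.single w 1) = Finsupp.single (CWord.map φ w) 1 := by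
  simp [actZC]

theorem actZC_mul (φ ψ : MulAut (F n)) (y : ZC n) : actZC (φ * ψ) y = actZC φ (actZC ψ y) := by
  have h : CWord.map (φ * ψ) = CWord.map φ ∘ CWord.map ψ := by
    funext w
    induction w using CWord.ind with
    | h x => rfl
  rw [actZC, h, Finsupp.lmapDomain_comp]
  rfl

theorem actZC_conj (g : F n) (y : ZC n) : actZC (MulAut.conj g) y = y := by
  have h : CWord.map (MulAut.conj g) = id := by
    funext w
    induction w using CWord.ind with
    | h x => exact Quotient.sound (.inl (isConj_iff.2 ⟨g⁻¹, by simp [mul_assoc]⟩))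
  rw [actZC, h, Finsupp.lmapDomain_id]
  rfl

theorem limMap_mul (hn : n ≠ 1) (σ : Orientation n) (φ ψ : MulAut (F n)) :
    limMap hn σ (φ * ψ) = limMap hn σ φ ∘ₗ limMap hn σ ψ := by
  refine LinearMap.ext fun x => Subtype.ext (funext fun k => ?_)
  obtain ⟨y, hy⟩ := exists_eq_piMap x (max (mBound (φ * ψ) k) (mBound ψ (mBound φ k)))
  rw [limMap_apply_of_eq hn _ (hy _ (le_max_left _ _)), LinearMap.comp_apply,
    limMap_apply_of_eq hn φ (limMap_apply_of_eq hn ψ (hy _ (le_max_right _ _))), actZC_mul]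

theorem limMap_conj (hn : n ≠ 1) (σ : Orientation n) (g : F n) :
    limMap hn σ (MulAut.conj g) = LinearMap.id := by
  refine LinearMap.ext fun x => Subtype.ext (funext fun k => ?_)
  obtain ⟨y, hy⟩ := exists_eq_piMap x (max (mBound (MulAut.conj g) k) k)
  rw [limMap_apply_of_eq hn _ (hy _ (le_max_left _ _)), actZC_conj, ← hy _ (le_max_right _ _)]
  rfl

theorem limMap_one (hn : n ≠ 1) (σ : Orientation n) : limMap hn σ 1 = LinearMap.id := by
  rw [← limMap_conj hn σ 1, map_one]

/-- The action of the automorphism group on the inverse limit. -/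
noncomputable def limHom (hn : n ≠ 1) (σ : Orientation n) :
    MulAut (F n) →* (invLimit σ ≃ₗ[ℤ] invLimit σ) where
  toFun φ := LinearEquiv.ofLinearMap (limMap hn σ φ) (limMap hn σ φ⁻¹)
    (by rw [← limMap_mul, mul_inv_cancel, limMap_one])
    (by rw [← limMap_mul, inv_mul_cancel, limMap_one])
  map_one' := LinearEquiv.ext fun x => LinearMap.congr_fun (limMap_one hn σ) x
  map_mul' φ ψ := LinearEquiv.ext fun x => LinearMap.congr_fun (limMap_mul hn σ φ ψ) x

/-- The action of the outer automorphism group on the inverse limit. -/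
noncomputable def outHom (hn : n ≠ 1) (σ : Orientation n) :
    Out n →* (invLimit σ ≃ₗ[ℤ] invLimit σ) :=
  QuotientGroup.lift _ (limHom hn σ) (by
    rintro _ ⟨g, rfl⟩
    exact LinearEquiv.ext fun x => LinearMap.congr_fun (limMap_conj hn σ g) x)

theorem outHom_mk (hn : n ≠ 1) (σ : Orientation n) (φ : MulAut (F n)) (x : invLimit σ) (k : ℕ) :
    (outHom hn σ (QuotientGroup.mk φ) x).1 k = phiLevel σ φ k (x.1 (mBound φ k)) := rfl

theorem homCount_map_eq_of_limMap (hn : n ≠ 1) (σ : Orientation n) {φ : MulAut (F n)}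
    (h : limMap hn σ φ = LinearMap.id) (u : UWord n) (w : CWord n) :
    homCount u (CWord.map φ w) = homCount u w := by
  let x : invLimit σ := ⟨fun k => piMap n k (Finsupp.single w 1), fun k => ⟨_, rfl⟩,
    fun k => pOut_piMap σ k _⟩
  have h1 : (limMap hn σ φ x).1 u.length = piMap n u.length (actZC φ (Finsupp.single w 1)) :=
    limMap_apply_of_eq hn φ rfl
  rw [h, actZC_single] at h1
  have h2 := DFunLike.congr_fun h1 (⟨u, rfl⟩ : W n u.length)
  rw [piMap_single] at h2
  have h3 : (x.1 u.length) (⟨u, rfl⟩ : W n u.length) = homCount u w := piMap_single _ _ _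
  exact_mod_cast (h3.symm.trans h2).symm

end Representation

/-! ### Cyclic words are determined by their subwords -/

section Determined

variable {n : ℕ}

theorem exists_cyclicallyReduced_rep (w : CWord n) : ∃ L : List (Letter (Fin n)),
    FreeGroup.IsCyclicallyReduced L ∧ 0 < L.length ∧
      ∃ h : FreeGroup.mk L ≠ 1, CWord.mk ⟨FreeGroup.mk L, h⟩ = w := by
  induction w using CWord.ind with
  | h x =>
  obtain ⟨h1, h2, h, e⟩ := exists_cyclicallyReduced x.2
  refine ⟨_, h1, h2, mk_ne_one_of_isReduced h1.1 h2, ?_⟩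
  exact Quotient.sound (.inl (isConj_iff.2 ⟨h, e.symm⟩))

theorem card_hom_letter (L M : List (Letter (Fin n))) (l : Letter (Fin n)) (hM : M = [l])
    (hL : FreeGroup.IsCyclicallyReduced L) :
    Nat.card (LGraph.Hom (seg M) (cyc L)) =
      Nat.card {i : Fin L.length // L.get i = l ∨ L.get i = Letter.bar l} := by
  subst hM
  let e₀ : (seg [l]).E := ((⟨0, Nat.zero_lt_one⟩, true) : Fin 1 × Bool)
  have hlab : ∀ f : LGraph.Hom (seg [l]) (cyc L), (cyc L).label (f.onE e₀) = l :=
    fun f => f.map_label e₀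
  have hini : ∀ f : LGraph.Hom (seg [l]) (cyc L),
      (cyc L).ini (f.onE e₀) = f.onV (0 : Fin 2) := fun f => (f.map_ini e₀).symm
  have hmem : ∀ e : Fin L.length × Bool, (cyc L).label e = l →
      L.get e.1 = l ∨ L.get e.1 = Letter.bar l := by
    rintro ⟨i, b⟩ h
    cases b
    · right
      have h' : Letter.bar (L.get i) = l := h
      rw [← h', Letter.bar_bar]
    · left
      exact h
  let g : LGraph.Hom (seg [l]) (cyc L) →
      {i : Fin L.length // L.get i = l ∨ L.get i = Letter.bar l} :=
    fun f => ⟨(f.onE e₀ : Fin L.length × Bool).1, hmem _ (hlab f)⟩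
  refine Nat.card_congr (Equiv.ofBijective g ⟨?_, ?_⟩)
  · intro f f' h
    have h1 : (f.onE e₀ : Fin L.length × Bool).1 = (f'.onE e₀ : Fin L.length × Bool).1 :=
      congrArg Subtype.val h
    have h2 : f.onE e₀ = f'.onE e₀ := by
      have l1 := hlab f
      have l2 := hlab f'
      generalize f.onE e₀ = e at *
      generalize f'.onE e₀ = e' at *
      obtain ⟨i, b⟩ := e
      obtain ⟨i', b'⟩ := e'
      obtain rfl : i = i' := h1
      cases b <;> cases b'
      · rfl
      · exact absurd ((show Letter.bar (L.get i) = l from l1).trans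
          (show L.get i = l from l2).symm) (Letter.bar_ne _)
      · exact absurd ((show Letter.bar (L.get i) = l from l2).trans
          (show L.get i = l from l1).symm) (Letter.bar_ne _)
      · rfl
    exact seg_hom_ext (cyc_isFolded hL) (by
      refine (hini f).symm.trans (Eq.trans ?_ (hini f'))
      rw [h2])
  · rintro ⟨i, hi⟩
    have hex : ∃ b, (cyc L).label ((i, b) : Fin L.length × Bool) = l := by
      rcases hi with h | h
      · exact ⟨true, h⟩
      · exact ⟨false, by rw [← Letter.bar_bar l, ← h]; rfl⟩
    obtain ⟨b, hb⟩ := hex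
    have hr := (cyc L).reads_edge ((i, b) : Fin L.length × Bool)
    rw [hb] at hr
    obtain ⟨f, hf, -⟩ := hr.exists_hom
    have h1 : f.onE e₀ = ((i, b) : Fin L.length × Bool) :=
      cyc_isFolded hL _ _ ((hini f).trans hf) ((hlab f).trans hb.symm)
    exact ⟨f, Subtype.ext (congrArg Prod.fst h1)⟩

/-- Each position on the circle carries exactly one u-word of length one, so the counts of these
u-words recover the cyclic length. -/
theorem sum_homCount_one {L : List (Letter (Fin n))} (hL : FreeGroup.IsCyclicallyReduced L)
    (h0 : 0 < L.length) (h : FreeGroup.mk L ≠ 1) :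
    ∑ u : W n 1, homCount u.1 (CWord.mk ⟨FreeGroup.mk L, h⟩) = L.length := by
  classical
  have hl1 : ∀ l : Letter (Fin n), (FreeGroup.mk [l] : F n) ≠ 1 := fun l e => by
    have := congrArg FreeGroup.norm e
    simp at this
  let cls : Fin L.length → W n 1 := fun i =>
    ⟨UWord.mk ⟨FreeGroup.mk [L.get i], hl1 _⟩, norm_mk_singleton _⟩
  have key : ∀ u : W n 1, homCount u.1 (CWord.mk ⟨FreeGroup.mk L, h⟩) =
      Nat.card {i // cls i = u} := by
    intro u
    obtain ⟨E⟩ := exists_hom_cyc_equiv_occ hL h0 u.1.rep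
    obtain ⟨l, hl⟩ := eq_mk_singleton_of_norm (u.1.length_eq_norm_rep.symm.trans u.2)
    rw [homCount_mk, ← Nat.card_congr E,
      card_hom_letter L _ l (by rw [hl, toWord_mk_singleton]) hL]
    refine Nat.card_congr (Equiv.subtypeEquivRight fun i => ?_)
    have hinj : ∀ a b : Letter (Fin n), (FreeGroup.mk [a] : F n) = FreeGroup.mk [b] ↔ a = b := by
      intro a b
      rw [← FreeGroup.toWord_inj, toWord_mk_singleton, toWord_mk_singleton, List.singleton_inj]
    rw [Subtype.ext_iff]
    conv_rhs => rhs; rw [← UWord.mk_rep u.1]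
    rw [UWord.mk_eq_mk, hl, mk_singleton_inv, hinj, hinj]
  simp only [key]
  rw [← Nat.card_sigma, Nat.card_congr (Equiv.sigmaFiberEquiv cls), Nat.card_fin]

theorem tdist_zpow_ax {L : List (Letter (Fin n))} (hL : FreeGroup.IsCyclicallyReduced L)
    (h0 : 0 < L.length) {c : F n} (hc : Ax (FreeGroup.mk L) c) :
    tdist c (FreeGroup.mk L * c) = L.length := by
  obtain ⟨k, i, hi, rfl⟩ := (ax_mk_iff hL h0 c).1 hc
  have h1 := (hL.flatten_replicate 2).isReduced
  have e : (List.replicate 2 L).flatten = L.take i ++ (L.drop i ++ L.take i) ++ L.drop i := by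
    simp only [List.replicate_succ, List.replicate_zero, List.flatten_cons, List.flatten_nil,
      List.append_nil, List.append_assoc, List.take_append_drop]
    rw [← List.append_assoc, List.take_append_drop]
  rw [e] at h1
  have h2 : FreeGroup.IsReduced (L.drop i ++ L.take i) := h1.infix ⟨_, _, rfl⟩
  have e2 : (FreeGroup.mk L ^ k * FreeGroup.mk (L.take i))⁻¹ *
      (FreeGroup.mk L * (FreeGroup.mk L ^ k * FreeGroup.mk (L.take i))) =
      (FreeGroup.mk (L.drop i ++ L.take i) : F n) := by
    have h3 := mk_take_mul_mk_drop L i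
    have h4 : (FreeGroup.mk (L.drop i) : F n) = (FreeGroup.mk (L.take i))⁻¹ * FreeGroup.mk L := by
      rw [← h3, inv_mul_cancel_left]
    rw [← FreeGroup.mul_mk, h4]
    group
  rw [tdist, e2, FreeGroup.norm, FreeGroup.toWord_mk, h2.reduce_eq, List.length_append,
    List.length_drop, List.length_take]
  omega

/-- Cyclic words with the same numbers of subwords are equal. -/
theorem CWord.ext_homCount {w w' : CWord n} (h : ∀ u, homCount u w = homCount u w') : w = w' := by
  obtain ⟨L, hL, h0, h1, rfl⟩ := exists_cyclicallyReduced_rep w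
  obtain ⟨L', hL', h0', h1', rfl⟩ := exists_cyclicallyReduced_rep w'
  have hlen : L.length = L'.length := by
    rw [← sum_homCount_one hL h0 h1, ← sum_homCount_one hL' h0' h1']
    exact Finset.sum_congr rfl fun u _ => h u.1
  have hu := h (UWord.mk ⟨FreeGroup.mk L, h1⟩)
  rw [homCount_mk, homCount_mk,
    card_occ_of_mk_eq (UWord.rep_ne_one _) h1 (UWord.mk_rep _),
    card_occ_of_mk_eq (UWord.rep_ne_one _) h1 (UWord.mk_rep _)] at hu
  have := finite_occ h1 (FreeGroup.mk L)
  have hax1 : Ax (FreeGroup.mk L) (1 : F n) :=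
    (ax_mk_iff hL h0 1).2 ⟨0, 0, h0, by simp [← FreeGroup.one_eq_mk]⟩
  have hax2 : Ax (FreeGroup.mk L) (1 * FreeGroup.mk L : F n) :=
    (ax_mk_iff hL h0 _).2 ⟨1, 0, h0, by simp [← FreeGroup.one_eq_mk]⟩
  have hne : Nonempty (Occ (FreeGroup.mk L) (FreeGroup.mk L : F n)) :=
    ⟨Quotient.mk (occSetoid _ _) ⟨1, hax1, hax2⟩⟩
  have hpos := Nat.card_pos (α := Occ (FreeGroup.mk L) (FreeGroup.mk L : F n))
  rw [hu] at hpos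
  obtain ⟨⟨⟨c, hc, hcx⟩⟩⟩ := (Nat.card_pos_iff.1 hpos).1
  have a1 : Ax (FreeGroup.mk L') (FreeGroup.mk L' * c) := by
    have := (ax_zpow_mul (FreeGroup.mk L') c 1).2 hc
    rwa [zpow_one] at this
  have a2 : Ax (FreeGroup.mk L') ((FreeGroup.mk L')⁻¹ * c) := by
    have := (ax_zpow_mul (FreeGroup.mk L') c (-1)).2 hc
    rwa [zpow_neg_one] at this
  have d1 := tdist_zpow_ax hL' h0' hc
  have d2 : tdist c ((FreeGroup.mk L')⁻¹ * c) = L'.length := by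
    have := tdist_zpow_ax hL' h0' a2
    rw [mul_inv_cancel_left] at this
    rw [tdist_comm, this]
  have d3 : tdist c (c * FreeGroup.mk L) = L'.length := by
    rw [tdist_mul_right_self, FreeGroup.norm, FreeGroup.toWord_mk, hL.1.reduce_eq, hlen]
  obtain ⟨p, q, b1, b2, b3, b4⟩ := exists_common_segment hc hcx a1 a2
  -- The word of `w` occurs on the axis of the equally long `w'`. The end of this occurrence is one
  -- translation length away from `c`, and only the two translates of `c` by `w'` and its inverse
  -- are.
  have hcases : c * FreeGroup.mk L = FreeGroup.mk L' * c ∨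
      c * FreeGroup.mk L = (FreeGroup.mk L')⁻¹ * c := by
    have hne : FreeGroup.mk L' * c ≠ (FreeGroup.mk L')⁻¹ * c := by
      intro e
      have e1 : (FreeGroup.mk L' : F n) ^ 2 = 1 := by
        rw [pow_two, ← eq_inv_iff_mul_eq_one]
        exact mul_right_cancel e
      exact h1' ((pow_eq_one_iff_left (by norm_num)).1 e1)
    rcases b1.total b2 with ⟨-, r⟩ | ⟨r, -⟩ <;> rcases b1.total b3 with ⟨-, s⟩ | ⟨s, -⟩ <;>
      rcases b1.total b4 with ⟨-, t⟩ | ⟨t, -⟩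
    · exact absurd (s.eq_of_tdist t (d1.trans d2.symm)) hne
    · exact .inl (r.eq_of_tdist s (d3.trans d1.symm))
    · exact .inr (r.eq_of_tdist t (d3.trans d2.symm))
    · exact absurd (s.symm.eq_of_tdist t.symm (d1.trans d2.symm)) hne
    · exact absurd (s.eq_of_tdist t (d1.trans d2.symm)) hne
    · exact .inr (r.symm.eq_of_tdist t.symm (d3.trans d2.symm))
    · exact .inl (r.symm.eq_of_tdist s.symm (d3.trans d1.symm))
    · exact absurd (s.symm.eq_of_tdist t.symm (d1.trans d2.symm)) hne
  refine Quotient.sound ?_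
  rcases hcases with e | e
  · exact .inl (isConj_iff.2 ⟨c, by rw [e, mul_inv_cancel_right]⟩)
  · exact .inr (isConj_iff.2 ⟨c, by rw [e, mul_inv_cancel_right]⟩)

end Determined

/-! ### Automorphisms that fix all cyclic words -/

section Inner

variable {n : ℕ}

/-- The lengths of the `N`-th powers grow as `N` times the cyclic length, while conjugation changes
them by at most `2 * c.norm`. -/
theorem length_le_of_conj {L L' : List (Letter (Fin n))} (hL : FreeGroup.IsCyclicallyReduced L)
    (hL' : FreeGroup.IsCyclicallyReduced L')
    (h : IsConj (FreeGroup.mk L : F n) (FreeGroup.mk L')) : L.length ≤ L'.length := by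
  obtain ⟨c, hc⟩ := isConj_iff.1 h.symm
  have key : ∀ N : ℕ, N * L.length ≤ 2 * c.norm + N * L'.length := by
    intro N
    rw [← norm_pow_of_isCyclicallyReduced hL, ← norm_pow_of_isCyclicallyReduced hL', ← hc,
      conj_pow]
    have h1 := FreeGroup.norm_mul_le (c * FreeGroup.mk L' ^ N) c⁻¹
    have h2 := FreeGroup.norm_mul_le c (FreeGroup.mk L' ^ N)
    rw [FreeGroup.norm_inv_eq] at h1
    omega
  by_contra hlt
  have h1 := key (2 * c.norm + 1)
  have h2 : (2 * c.norm + 1) * (L'.length + 1) ≤ (2 * c.norm + 1) * L.length :=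
    Nat.mul_le_mul_left _ (by omega)
  rw [mul_add, mul_one] at h2
  omega

theorem length_eq_of_conj {L L' : List (Letter (Fin n))} (hL : FreeGroup.IsCyclicallyReduced L)
    (hL' : FreeGroup.IsCyclicallyReduced L')
    (h : IsConj (FreeGroup.mk L : F n) (FreeGroup.mk L')) : L.length = L'.length :=
  le_antisymm (length_le_of_conj hL hL' h) (length_le_of_conj hL' hL h.symm)

theorem mk_singleton_comm (i : Fin n) (b c : Bool) :
    (FreeGroup.mk [(i, b)] * FreeGroup.mk [(i, c)] : F n) =
      FreeGroup.mk [(i, c)] * FreeGroup.mk [(i, b)] := by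
  by_cases h : b = c
  · rw [h]
  · have e : (FreeGroup.mk [(i, b)] : F n) = (FreeGroup.mk [(i, c)])⁻¹ := by
      rw [mk_singleton_inv, Letter.bar]
      congr 3
      revert h; cases b <;> cases c <;> simp
    rw [e, inv_mul_cancel, mul_inv_cancel]

theorem exists_zpow_of (i : Fin n) (b : Bool) :
    ∃ s : ℤ, (FreeGroup.mk [(i, b)] : F n) = FreeGroup.of i ^ s := by
  cases b
  · exact ⟨-1, by rw [zpow_neg_one]; exact (mk_singleton_inv (i, true)).symm⟩
  · exact ⟨1, by rw [zpow_one]; rfl⟩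

theorem isConj_mul_conj (x y z : F n) : IsConj x y ↔ IsConj (z * x * z⁻¹) y := by
  have h : IsConj x (z * x * z⁻¹) := isConj_iff.2 ⟨z, rfl⟩
  exact ⟨fun k => h.symm.trans k, fun k => h.trans k⟩

theorem isCyclicallyReduced_conj {i j : Fin n} (hij : i ≠ j) (b c : Bool)
    {W : List (Letter (Fin n))} (hW : FreeGroup.IsReduced W)
    (hW' : FreeGroup.IsReduced (FreeGroup.invRev W)) (hhead : ∀ x ∈ W.head?, x.1 ≠ i)
    (hlast : ∀ x ∈ W.getLast?, x.1 ≠ j) :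
    FreeGroup.IsCyclicallyReduced ((i, b) :: (W ++ (j, c) :: FreeGroup.invRev W)) := by
  have hhead' : ∀ x ∈ (FreeGroup.invRev W).head?, x.1 ≠ j := by
    intro x hx
    simp only [FreeGroup.invRev, List.head?_reverse, List.getLast?_map, Option.mem_def,
      Option.map_eq_some_iff] at hx
    obtain ⟨y, hy, rfl⟩ := hx
    exact hlast y hy
  have hlast' : ∀ x ∈ (FreeGroup.invRev W).getLast?, x.1 ≠ i := by
    intro x hx
    simp only [FreeGroup.invRev, List.getLast?_reverse, List.head?_map, Option.mem_def,
      Option.map_eq_some_iff] at hx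
    obtain ⟨y, hy, rfl⟩ := hx
    exact hhead y hy
  constructor
  · refine List.isChain_cons.2 ⟨?_, List.isChain_append.2 ⟨hW, List.isChain_cons.2 ⟨?_, hW'⟩, ?_⟩⟩
    · intro y hy h
      cases W with
      | nil =>
        simp only [List.nil_append, List.head?_cons, Option.mem_def, Option.some.injEq] at hy
        exact absurd (h.trans (congrArg Prod.fst hy).symm) hij
      | cons z P => exact absurd h.symm (hhead y hy)
    · exact fun y hy h => absurd h.symm (hhead' y hy)
    · intro x hx y hy h
      simp only [List.head?_cons, Option.mem_def, Option.some.injEq] at hy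
      exact absurd (h.trans (congrArg Prod.fst hy).symm) (hlast x hx)
  · intro x hx y hy h
    simp only [List.head?_cons, Option.mem_def, Option.some.injEq] at hy
    have hyi : y.1 = i := (congrArg Prod.fst hy).symm
    rw [← List.cons_append, List.getLast?_append_of_ne_nil _ (List.cons_ne_nil _ _)] at hx
    rw [hyi] at h
    cases hV : FreeGroup.invRev W with
    | nil =>
      rw [hV] at hx
      simp only [List.getLast?_singleton, Option.mem_def, Option.some.injEq] at hx
      exact absurd (h.symm.trans (congrArg Prod.fst hx).symm) hij
    | cons z P =>
      rw [hV, List.getLast?_cons_cons, ← hV] at hx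
      exact absurd h (hlast' x hx)

/-- If the product of a conjugate of a letter with another letter has cyclic length two then the
conjugating element is a product of powers of the letters. -/
theorem exists_eq_zpow_mul_zpow {i j : Fin n} (hij : i ≠ j) (b c : Bool)
    {L : List (Letter (Fin n))} (hL : FreeGroup.IsCyclicallyReduced L) (hL2 : L.length = 2)
    {g : F n} (h : IsConj (FreeGroup.mk [(i, b)] * (g * FreeGroup.mk [(j, c)] * g⁻¹))
      (FreeGroup.mk L)) : ∃ s t : ℤ, g = FreeGroup.of i ^ s * FreeGroup.of j ^ t := by
  induction hm : g.norm using Nat.strong_induction_on generalizing g with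
  | _ m ih =>
    -- A first letter $x_i^{\pm1}$ of `g` commutes with the outer letter, and a last letter
    -- $x_j^{\pm1}$ with the inner one; such letters are split off by induction.
    by_cases h1 : ∃ e, (i, e) ∈ g.toWord.head?
    · obtain ⟨e, he⟩ := h1
      obtain ⟨G, hG⟩ : ∃ G, g.toWord = (i, e) :: G := by
        cases hw : g.toWord with
        | nil => simp [hw] at he
        | cons y P => simp [hw] at he; exact ⟨P, by rw [he]⟩
      have hg : g = FreeGroup.mk [(i, e)] * FreeGroup.mk G := by
        rw [FreeGroup.mul_mk, ← FreeGroup.mk_toWord (x := g), hG]; rfl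
      have hlt : (FreeGroup.mk G : F n).norm < m := by
        have := FreeGroup.norm_mk_le (L₁ := G)
        rw [← hm, FreeGroup.norm, FreeGroup.norm, hG, List.length_cons]
        exact Nat.lt_succ_of_le this
      obtain ⟨s, t, hst⟩ := ih _ hlt (g := FreeGroup.mk G) (by
        rw [isConj_mul_conj _ _ (FreeGroup.mk [(i, e)])]
        convert h using 1
        have hcomm := mk_singleton_comm i e b
        rw [hg, mul_inv_rev]
        simp only [mul_assoc]
        rw [← mul_assoc, hcomm, mul_assoc]) rfl
      obtain ⟨r, hr⟩ := exists_zpow_of i e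
      exact ⟨r + s, t, by rw [hg, hr, hst, zpow_add, mul_assoc]⟩
    by_cases h2 : ∃ e, (j, e) ∈ g.toWord.getLast?
    · obtain ⟨e, he⟩ := h2
      obtain ⟨G, hG⟩ : ∃ G, g.toWord = G ++ [(j, e)] := by
        obtain ⟨G, hG⟩ := List.mem_getLast?_eq_getLast he
        exact ⟨g.toWord.dropLast, by rw [hG, List.dropLast_append_getLast]⟩
      have hg : g = FreeGroup.mk G * FreeGroup.mk [(j, e)] := by
        rw [FreeGroup.mul_mk, ← FreeGroup.mk_toWord (x := g), hG]
      have hlt : (FreeGroup.mk G : F n).norm < m := by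
        have := FreeGroup.norm_mk_le (L₁ := G)
        rw [← hm, FreeGroup.norm, FreeGroup.norm, hG, List.length_append]
        exact Nat.lt_succ_of_le this
      obtain ⟨s, t, hst⟩ := ih _ hlt (g := FreeGroup.mk G) (by
        convert h using 2
        rw [hg, mul_assoc (FreeGroup.mk G) (FreeGroup.mk [(j, e)]), mk_singleton_comm j e c]
        group) rfl
      obtain ⟨r, hr⟩ := exists_zpow_of j e
      exact ⟨s, t + r, by rw [hg, hr, hst, zpow_add, mul_assoc]⟩
    -- With nothing left to split off, the word is cyclically reduced of length `2 + 2 * g.norm`,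
    -- which forces `g = 1`.
    · have hword : FreeGroup.mk [(i, b)] * (g * FreeGroup.mk [(j, c)] * g⁻¹) =
          FreeGroup.mk ((i, b) :: (g.toWord ++ (j, c) :: FreeGroup.invRev g.toWord)) := by
        conv_lhs => rw [← FreeGroup.mk_toWord (x := g)]
        rw [FreeGroup.inv_mk, FreeGroup.mul_mk, FreeGroup.mul_mk, FreeGroup.mul_mk]
        simp
      have hhead : ∀ x ∈ g.toWord.head?, x.1 ≠ i := by
        rintro ⟨x, e⟩ hx rfl
        exact h1 ⟨e, hx⟩
      have hlast : ∀ x ∈ g.toWord.getLast?, x.1 ≠ j := by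
        rintro ⟨x, e⟩ hx rfl
        exact h2 ⟨e, hx⟩
      have hred : FreeGroup.IsCyclicallyReduced
          ((i, b) :: (g.toWord ++ (j, c) :: FreeGroup.invRev g.toWord)) :=
        isCyclicallyReduced_conj hij b c FreeGroup.isReduced_toWord
          (by rw [← FreeGroup.toWord_inv]; exact FreeGroup.isReduced_toWord) hhead hlast
      rw [hword] at h
      have hlen := length_eq_of_conj hred hL h
      simp only [List.length_cons, List.length_append, FreeGroup.invRev_length, hL2] at hlen
      have : g = 1 := by
        rw [← FreeGroup.norm_eq_zero, FreeGroup.norm]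
        omega
      exact ⟨0, 0, by simp [this]⟩

/-- The exponent sum of a generator. -/
def expSum (i : Fin n) : F n →* Multiplicative ℤ :=
  FreeGroup.lift fun k => if k = i then Multiplicative.ofAdd 1 else 1

theorem expSum_conj (i : Fin n) {x y : F n} (h : IsConj x y) : expSum i x = expSum i y := by
  obtain ⟨c, rfl⟩ := isConj_iff.1 h
  simp [mul_comm]

theorem expSum_of_self (i : Fin n) : expSum i (FreeGroup.of i) = Multiplicative.ofAdd 1 := by
  simp [expSum]

theorem expSum_of_ne {i j : Fin n} (h : j ≠ i) : expSum i (FreeGroup.of j) = 1 := by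
  simp [expSum, h]

/-- The two words are reversals of each other; under a homomorphism to the permutations of five
points the first becomes trivial and the second does not. -/
theorem sq_mul_sq_not_conj {i j : Fin n} (hij : i ≠ j) :
    ¬ IsConj (FreeGroup.of i * FreeGroup.of j * FreeGroup.of i ^ 2 * FreeGroup.of j ^ 2 : F n)
      (FreeGroup.of j ^ 2 * FreeGroup.of i ^ 2 * FreeGroup.of j * FreeGroup.of i) := by
  intro h
  obtain ⟨c, hc⟩ := isConj_iff.1 h
  let f : F n →* Equiv.Perm (Fin 5) := FreeGroup.lift fun k =>
    if k = i then c[1, 2, 3, 4] else if k = j then c[0, 1, 2, 4] else 1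
  have hi : f (FreeGroup.of i) = c[1, 2, 3, 4] := by simp [f]
  have hj : f (FreeGroup.of j) = c[0, 1, 2, 4] := by simp [f, hij.symm]
  have h1 := congrArg f hc
  simp only [map_mul, map_inv, map_pow, hi, hj] at h1
  have h2 : (c[1, 2, 3, 4] * c[0, 1, 2, 4] * c[1, 2, 3, 4] ^ 2 * c[0, 1, 2, 4] ^ 2 :
    Equiv.Perm (Fin 5)) = 1 := by decide
  rw [h2, mul_one, mul_inv_cancel] at h1
  exact absurd h1 (by decide)

/-- An automorphism of a free group of rank at least two that fixes all conjugacy classes up to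
inversion is inner. -/
theorem exists_conj_of_isConj (hn : 2 ≤ n) (φ : MulAut (F n))
    (h : ∀ g, IsConj (φ g) g ∨ IsConj (φ g) g⁻¹) : ∃ c, MulAut.conj c = φ := by
  have gen : ∀ i : Fin n, ∃ (c : F n) (b : Bool),
      φ (FreeGroup.of i) = c * FreeGroup.mk [(i, b)] * c⁻¹ := by
    intro i
    rcases h (FreeGroup.of i) with k | k
    · obtain ⟨c, hc⟩ := isConj_iff.1 k.symm
      exact ⟨c, true, hc.symm⟩
    · obtain ⟨c, hc⟩ := isConj_iff.1 k.symm
      refine ⟨c, false, ?_⟩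
      rw [← hc]
      rfl
  choose c b hcb using gen
  have pair : ∀ i j, i ≠ j → ∃ s t : ℤ,
      (c i)⁻¹ * c j = FreeGroup.of i ^ s * FreeGroup.of j ^ t := by
    intro i j hij
    have hconj : IsConj (φ (FreeGroup.of i * FreeGroup.of j)) (FreeGroup.mk [(i, b i)] *
        ((c i)⁻¹ * c j * FreeGroup.mk [(j, b j)] * ((c i)⁻¹ * c j)⁻¹)) := by
      refine isConj_iff.2 ⟨(c i)⁻¹, ?_⟩
      rw [map_mul, hcb i, hcb j]
      group
    have cred : ∀ (i j : Fin n) (e : Bool), i ≠ j →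
        FreeGroup.IsCyclicallyReduced [(i, e), (j, e)] := by
      intro i j e hij
      simp [FreeGroup.IsCyclicallyReduced, FreeGroup.IsReduced]
    rcases h (FreeGroup.of i * FreeGroup.of j) with k | k
    · refine exists_eq_zpow_mul_zpow hij (b i) (b j) (cred i j true hij) rfl ?_
      exact hconj.symm.trans k
    · refine exists_eq_zpow_mul_zpow hij (b i) (b j) (cred j i false hij.symm) rfl ?_
      exact hconj.symm.trans k
  let i₀ : Fin n := ⟨0, by omega⟩
  let i₁ : Fin n := ⟨1, by omega⟩
  have h01 : i₀ ≠ i₁ := by simp [i₀, i₁]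
  obtain ⟨s, t, hst⟩ := pair i₀ i₁ h01
  -- The conjugator `c j` matters only up to powers of the `j`-th generator on the right. The
  -- relation for `i₀` and `i₁` therefore allows both to be replaced by `d`.
  let d : F n := c i₀ * FreeGroup.of i₀ ^ s
  have comm : ∀ (i : Fin n) (e : Bool) (r : ℤ), FreeGroup.of i ^ r * FreeGroup.mk [(i, e)] =
      (FreeGroup.mk [(i, e)] * FreeGroup.of i ^ r : F n) := by
    intro i e r
    obtain ⟨q, hq⟩ := exists_zpow_of i e
    rw [hq, ← zpow_add, ← zpow_add, add_comm]
  have hd : ∀ j, ∃ r : ℤ, c j = d * FreeGroup.of j ^ r := by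
    intro j
    by_cases hj0 : j = i₀
    · subst hj0
      exact ⟨-s, by simp [d]⟩
    by_cases hj1 : j = i₁
    · subst hj1
      exact ⟨t, by rw [mul_assoc, ← hst, mul_inv_cancel_left]⟩
    obtain ⟨s', t', h1⟩ := pair i₀ j (Ne.symm hj0)
    obtain ⟨s'', t'', h2⟩ := pair i₁ j (Ne.symm hj1)
    have h3 : FreeGroup.of i₀ ^ s' * FreeGroup.of j ^ t' =
        (FreeGroup.of i₀ ^ s * FreeGroup.of i₁ ^ t) *
          (FreeGroup.of i₁ ^ s'' * FreeGroup.of j ^ t'') := by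
      rw [← h1, ← h2, ← hst]
      group
    -- Comparing exponent sums of the generator `i₀` shows that a third generator leads to the same
    -- `d`.
    have h4 := congrArg (expSum i₀) h3
    simp only [map_mul, map_zpow, expSum_of_self, expSum_of_ne hj0, expSum_of_ne h01.symm,
      one_zpow, mul_one] at h4
    have h5 : s' = s := by
      have := congrArg Multiplicative.toAdd h4
      simpa using this
    refine ⟨t', ?_⟩
    rw [mul_assoc, ← h5, ← h1, mul_inv_cancel_left]
  have hφ : ∀ j, φ (FreeGroup.of j) = d * FreeGroup.mk [(j, b j)] * d⁻¹ := by
    intro j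
    obtain ⟨r, hr⟩ := hd j
    rw [hcb, hr, mul_assoc d, comm]
    group
  -- The image of the product of the two generators is conjugate to it or to its inverse, so both
  -- exponent sums have the same sign.
  have hsign : ∀ i j, i ≠ j → b i = b j := by
    intro i j hij
    have hval : ∀ (k : Fin n) (e : Bool), (expSum k (FreeGroup.mk [(k, e)])).toAdd =
        if e = true then 1 else -1 := by
      intro k e
      cases e
      · rw [show (FreeGroup.mk [(k, false)] : F n) = (FreeGroup.of k)⁻¹ from rfl, map_inv,
          expSum_of_self]
        rfl
      · exact congrArg Multiplicative.toAdd (expSum_of_self k)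
    have hval' : ∀ (k l : Fin n) (e : Bool), l ≠ k →
        expSum k (FreeGroup.mk [(l, e)]) = 1 := by
      intro k l e hl
      cases e
      · rw [show (FreeGroup.mk [(l, false)] : F n) = (FreeGroup.of l)⁻¹ from rfl, map_inv,
          expSum_of_ne hl, inv_one]
      · exact expSum_of_ne hl
    have hi : (expSum i (φ (FreeGroup.of i * FreeGroup.of j))).toAdd =
        if b i = true then 1 else -1 := by
      rw [← hval i, map_mul, hφ, hφ]
      simp only [map_mul, map_inv, hval' i j _ hij.symm, mul_one, mul_inv_cancel_comm, mul_inv_cancel]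
    have hj : (expSum j (φ (FreeGroup.of i * FreeGroup.of j))).toAdd =
        if b j = true then 1 else -1 := by
      rw [← hval j, map_mul, hφ, hφ]
      simp only [map_mul, map_inv, hval' j i _ hij, mul_one, mul_inv_cancel_comm, mul_inv_cancel,
        one_mul]
    rcases h (FreeGroup.of i * FreeGroup.of j) with k | k
    all_goals
      rw [expSum_conj i k] at hi
      rw [expSum_conj j k] at hj
      simp only [map_inv, map_mul, expSum_of_self, expSum_of_ne hij, expSum_of_ne hij.symm, one_mul,
        mul_one, toAdd_inv, toAdd_ofAdd] at hi hj
      revert hi hj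
      cases b i <;> cases b j <;> simp
  by_cases hb : b i₀ = true
  · have hall : ∀ j, b j = true := by
      intro j
      by_cases hj : i₀ = j
      · rw [← hj, hb]
      · rw [← hsign i₀ j hj, hb]
    refine ⟨d, MulEquiv.toMonoidHom_injective (FreeGroup.ext_hom _ _ fun j => ?_)⟩
    change d * FreeGroup.of j * d⁻¹ = φ (FreeGroup.of j)
    rw [hφ, hall]
    rfl
  · exfalso
    have hall : ∀ j, FreeGroup.mk [(j, b j)] = (FreeGroup.of j : F n)⁻¹ := by
      intro j
      have hbj : b j = false := by
        by_cases hj : i₀ = j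
        · rw [← hj]; simpa using hb
        · rw [← hsign i₀ j hj]; simpa using hb
      rw [hbj]
      exact (mk_singleton_inv (j, true)).symm
    have hx : φ (FreeGroup.of i₀) = d * (FreeGroup.of i₀)⁻¹ * d⁻¹ := by rw [hφ, hall]
    have hy : φ (FreeGroup.of i₁) = d * (FreeGroup.of i₁)⁻¹ * d⁻¹ := by rw [hφ, hall]
    have hex := expSum_of_self i₀
    have hey := expSum_of_ne h01.symm
    have hxy := sq_mul_sq_not_conj h01
    generalize FreeGroup.of i₀ = x at hx hex hxy
    generalize FreeGroup.of i₁ = y at hy hey hxy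
    -- If every generator were inverted, the image of this word would be conjugate to the inverse of
    -- its reversal. Exponent sums exclude a conjugate of the word itself, and `sq_mul_sq_not_conj`
    -- one of its inverse.
    have hw : φ (x * y * x ^ 2 * y ^ 2) = d * (y ^ 2 * x ^ 2 * y * x)⁻¹ * d⁻¹ := by
      simp only [map_mul, hx, hy, pow_two, mul_inv_rev, mul_assoc, inv_mul_cancel_left]
    rcases h (x * y * x ^ 2 * y ^ 2) with k | k
    · have h1 := expSum_conj i₀ k
      rw [hw] at h1
      simp only [map_mul, map_inv, map_pow, hex, hey, one_pow, mul_one, one_mul] at h1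
      have := congrArg Multiplicative.toAdd h1
      simp at this
    · have k' : IsConj (y ^ 2 * x ^ 2 * y * x)⁻¹ (x * y * x ^ 2 * y ^ 2)⁻¹ := by
        rw [hw] at k
        exact (isConj_mul_conj _ _ d).2 k
      obtain ⟨e, he⟩ := isConj_iff.1 k'
      refine hxy (IsConj.symm (isConj_iff.2 ⟨e, ?_⟩))
      rw [← inv_inj, ← he]
      simp only [mul_inv_rev, inv_inv, mul_assoc]

theorem outHom_injective (hn : n ≠ 1) (σ : Orientation n) : Function.Injective (outHom hn σ) := by
  rw [injective_iff_map_eq_one]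
  intro a ha
  induction a using QuotientGroup.induction_on with
  | H φ =>
    have hlim : limMap hn σ φ = LinearMap.id :=
      LinearMap.ext fun x => LinearEquiv.congr_fun ha x
    have hconj : ∀ g, IsConj (φ g) g ∨ IsConj (φ g) g⁻¹ := by
      intro g
      by_cases hg : g = 1
      · rw [hg, map_one]
        exact Or.inl (IsConj.refl 1)
      · exact Quotient.exact
          (CWord.ext_homCount fun u => homCount_map_eq_of_limMap hn σ hlim u (Quotient.mk _ ⟨g, hg⟩))
    refine (QuotientGroup.eq_one_iff φ).2 ?_
    -- In rank zero the group is trivial, so there is nothing to conjugate.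
    rcases Nat.eq_zero_or_pos n with rfl | h0
    · have hφ : φ = 1 := MulEquiv.ext fun x => Subsingleton.elim _ _
      rw [hφ]
      exact one_mem _
    · exact exists_conj_of_isConj (by omega) φ hconj

end Inner

end OutRep

theorem mainTheorem2 (n : ℕ) (hn : n ≠ 1) (σ : OutRep.Orientation n) :
    -- the finite multisets `S_{u,φ}` count subwords of images of cyclic words
    (∀ (φ : MulAut (OutRep.F n)) (u : OutRep.UWord n), (OutRep.minimalIdeals φ u).Finite ∧
      ∀ w : OutRep.CWord n, OutRep.homCount u (OutRep.CWord.map φ w) =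
        ((OutRep.S φ u).map (fun v => OutRep.homCount v w)).sum) ∧
    -- the inverse system
    (∀ (k : ℕ) (x : OutRep.M n (k + 1)), x ∈ OutRep.Mtilde n (k + 1) →
      OutRep.pIn σ k x = OutRep.pOut σ k x ∧ OutRep.pOut σ k x ∈ OutRep.Mtilde n k) ∧
    (∀ k : ℕ, OutRep.pOut σ k ∘ₗ OutRep.piMap n (k + 1) = OutRep.piMap n k) ∧
    -- the homomorphisms `φ_k`
    (∀ (φ : MulAut (OutRep.F n)) (k : ℕ),
      OutRep.phiLevel σ φ k ∘ₗ OutRep.piMap n (OutRep.mBound φ k) =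
        OutRep.piMap n k ∘ₗ OutRep.actZC φ) ∧
    (∀ (φ : MulAut (OutRep.F n)) (k : ℕ), ∀ x ∈ OutRep.Mtilde n (OutRep.mBound φ k),
      OutRep.phiLevel σ φ k x ∈ OutRep.Mtilde n k) ∧
    (∀ (φ : MulAut (OutRep.F n)) (k : ℕ),
      ∃ h : OutRep.mBound φ k ≤ OutRep.mBound φ (k + 1),
        ∀ x ∈ OutRep.Mtilde n (OutRep.mBound φ (k + 1)),
          OutRep.pOut σ k (OutRep.phiLevel σ φ (k + 1) x) =
            OutRep.phiLevel σ φ k (OutRep.pComp σ h x)) ∧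
    -- the representation on the inverse limit
    ∃ ρ : OutRep.Out n →* (OutRep.invLimit σ ≃ₗ[ℤ] OutRep.invLimit σ),
      (∀ (φ : MulAut (OutRep.F n)) (x : OutRep.invLimit σ) (k : ℕ),
        (ρ (QuotientGroup.mk φ) x).1 k = OutRep.phiLevel σ φ k (x.1 (OutRep.mBound φ k))) ∧
      Function.Injective ρ := by
  open OutRep in
  refine ⟨fun φ u => ⟨finite_minimalIdeals φ u, homCount_map hn φ u⟩, ?_, pOut_comp_piMap σ,
    fun φ k => LinearMap.ext fun y => phiLevel_piMap φ hn σ k y,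
    fun φ k _ hx => phiLevel_mem hn σ φ k hx,
    fun φ k => ⟨mBound_le_succ hn φ k, fun x hx => pOut_phiLevel hn σ φ k _ hx⟩,
    outHom hn σ, outHom_mk hn σ, outHom_injective hn σ⟩
  rintro k _ ⟨y, rfl⟩
  rw [pIn_piMap, pOut_piMap]
  exact ⟨rfl, y, rfl⟩
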